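/- Let $\mathbb T^3=\mathbb R^3/\mathbb Z^3$, let $0<\nu\le\kappa$, let $\gamma=2$ or $9/4\le\gamma<\infty$, let $T>0$, and put $K=\kappa/\nu+1$. Consider the thermal reduced Burgers system for $u=(u_1,u_2,u_3)$ and $\theta$ (summation over repeated indices) $$\partial_t u_j+u_i\partial_i u_j+\tfrac1\gamma\,u_j\,\partial_i u_i-\nu\,\partial_i(\theta\,\partial_i u_j)=0,$$ $$\partial_t(\theta^2)+\partial_i(u_i\theta^2)-\kappa\,\partial_i\big(\theta\,\partial_i(\theta^2)\big)=\nu\,\theta\,|\nabla u|^2 .$$ Let $u_0\in H^1(\mathbb T^3)\cap L^\gamma(\mathbb T^3)$ be vector valued and let $\theta_0\in L^2(\mathbb T^3)$ with $\theta_0\ge 1$ almost everywhere. Let $(u,\theta)$ be a classical solution on $\mathbb T^3\times[0,T]$ with initial data $(u_0,\theta_0)$, in the following sense: $u(\cdot,0)=u_0$ and $\theta(\cdot,0)=\theta_0$; the functions $u,\theta$, their spatial derivatives of order at most $2$ and their first time derivatives exist and are continuous on $\mathbb T^3\times(0,T]$; the two equations hold pointwise there; $u(\cdot,t)\to u_0$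 in $H^1$ and $\theta(\cdot,t)\to\theta_0$ in $L^2$ as $t\to0^+$; and $\theta(\cdot,t)>0$ for all sufficiently small $t>0$ ($\theta$ is the positive square root of the temperature $\theta^2$). Then there are constants $C=C(\nu,\gamma,K,\|u_0\|_{L^\gamma},\|\theta_0\|_{L^2})>0$ and $M=M(K,\gamma)>0$, depending only on the quantities indicated (not on $T$, $u$ or $\theta$ otherwise), such that for all $t\in[0,T]$ the integral on the left below is finite and $$\int_{\mathbb T^3}\theta(x,t)^{-1/K}|\nabla u(x,t)|^2\,dx\le\int_{\mathbb T^3}\theta_0(x)^{-1/K}|\nabla u_0(x)|^2\,dx+C\,(t^M+1).$$ Moreover, the quantities $$\int_{\mathbb T^3}\theta^{(K-1)/K}|\nabla^2u|^2\,dx,\qquad\int_{\mathbb T^3}\theta^{-(K+1)/K}|\nabla u|^4\,dx,\qquad\int_{\mathbb T^3}\theta^{-(K+1)/K}|\nabla u|^2|\nabla\theta|^2\,dx$$ are finite for every $t\in(0,T]$ and are integrable in time on $[0,T]$. Here $|\nabla u|^2=\sum_{i,j}(\partial_iu_j)^2$ and $|\nabla^2u|^2=\sum_{i,k,j}(\partial_i\partial_ku_j)^2$.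 -/

import Mathlib

open MeasureTheory Filter Topology Set
open scoped ContDiff

noncomputable section

/-- Euclidean space `ℝ³`. Functions on the torus `𝕋³ = ℝ³ / ℤ³` are represented by
`ℤ³`-periodic functions on `ℝ³`. -/
abbrev E3 : Type := EuclideanSpace ℝ (Fin 3)

/-- Periodicity with respect to the lattice `ℤ³`. -/
def IsPeriodic3 {α : Type*} (f : E3 → α) : Prop :=
  ∀ (x : E3) (i : Fin 3), f (x + EuclideanSpace.single i 1) = f x

/-- The fundamental cell `[0,1)³` of the torus. -/
def unitCell : Set E3 := {x | ∀ i, x i ∈ Set.Ico (0 : ℝ) 1}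

/-- Lebesgue measure on the fundamental cell, i.e. the standard measure of `𝕋³`. -/
def torusMeasure : Measure E3 := (volume : Measure E3).restrict unitCell

/-- The partial derivative `∂ᵢ f`. -/
def pd (i : Fin 3) (f : E3 → ℝ) (x : E3) : ℝ :=
  fderiv ℝ f x (EuclideanSpace.single i 1)

/-- The Jacobian of a vector field: the entry `i j` is `∂ᵢ vⱼ`. -/
def jac (v : E3 → E3) (x : E3) (i j : Fin 3) : ℝ := pd i (fun y => v y j) x

/-- `∑ᵢⱼ Gᵢⱼ²`, the squared Frobenius norm. -/
def frobSq (G : Fin 3 → Fin 3 → ℝ) : ℝ := ∑ i, ∑ j, G i j ^ 2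

/-- `|∇²v|² = ∑ᵢₖⱼ (∂ᵢ∂ₖvⱼ)²`. -/
def hessSq (v : E3 → E3) (x : E3) : ℝ :=
  ∑ i, ∑ k, ∑ j, pd i (pd k (fun y => v y j)) x ^ 2

/-- `|∇f|²` for a scalar function. -/
def gradSq (f : E3 → ℝ) (x : E3) : ℝ := ∑ i, pd i f x ^ 2

/-- The time derivative on the time interval `[0,T]` (one-sided at `t = T`). -/
def timeDeriv (T : ℝ) (f : ℝ → E3 → ℝ) (t : ℝ) (x : E3) : ℝ :=
  derivWithin (fun s => f s x) (Set.Icc 0 T) t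

/-- The parabolic class `C^{2,1}` on `𝕋³ × (0,T]`: the function is spatially periodic, it is
twice differentiable in `x` and once in `t`, and `f`, `∂ᵢf`, `∂ᵢ∂ₖf`, `∂ₜf` are jointly
continuous. Nothing is required at `t = 0`. -/
structure IsC21 (T : ℝ) (f : ℝ → E3 → ℝ) : Prop where
  periodic : ∀ t ∈ Set.Ioc 0 T, IsPeriodic3 (f t)
  contDiff_space : ∀ t ∈ Set.Ioc 0 T, ContDiff ℝ 2 (f t)
  diff_time : ∀ t ∈ Set.Ioc 0 T, ∀ x,
    DifferentiableWithinAt ℝ (fun s => f s x) (Set.Icc 0 T) t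
  cont : ContinuousOn (fun p : ℝ × E3 => f p.1 p.2) (Set.Ioc 0 T ×ˢ Set.univ)
  cont_pd : ∀ i, ContinuousOn (fun p : ℝ × E3 => pd i (f p.1) p.2)
    (Set.Ioc 0 T ×ˢ Set.univ)
  cont_pd_pd : ∀ i k, ContinuousOn (fun p : ℝ × E3 => pd i (pd k (f p.1)) p.2)
    (Set.Ioc 0 T ×ˢ Set.univ)
  cont_time : ContinuousOn (fun p : ℝ × E3 => timeDeriv T f p.1 p.2)
    (Set.Ioc 0 T ×ˢ Set.univ)

/-- `v` belongs to `H¹(𝕋³)` (vector valued), with weak gradient `G`, `Gᵢⱼ = ∂ᵢvⱼ`; the weak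
derivatives are tested against smooth functions on the torus. -/
structure HasH1Gradient (v : E3 → E3) (G : E3 → Fin 3 → Fin 3 → ℝ) : Prop where
  periodic : IsPeriodic3 v
  memLp : MemLp v 2 torusMeasure
  grad_memLp : ∀ i j, MemLp (fun x => G x i j) 2 torusMeasure
  weak : ∀ φ : E3 → ℝ, ContDiff ℝ ∞ φ → IsPeriodic3 φ → ∀ i j,
    ∫ x, v x j * pd i φ x ∂torusMeasure = - ∫ x, G x i j * φ x ∂torusMeasure

/-- Classical solutions on `𝕋³ × [0,T]` of the thermal reduced Burgers system
`∂ₜuⱼ + uᵢ∂ᵢuⱼ + γ⁻¹ uⱼ ∂ᵢuᵢ - ν ∂ᵢ(θ ∂ᵢuⱼ) = 0`,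
`∂ₜ(θ²) + ∂ᵢ(uᵢθ²) - κ ∂ᵢ(θ ∂ᵢ(θ²)) = ν θ |∇u|²`
with initial data `u0 ∈ H¹` (weak gradient `G0`) and `θ0 ∈ L²`. The equations hold pointwise for
`0 < t ≤ T`; the data are attained in `H¹` and in `L²` as `t → 0+`. Since `θ²` is the temperature
and `θ` its positive square root, `θ` is positive at small positive times. -/
structure IsClassicalSolution (ν κ γ T : ℝ) (u0 : E3 → E3) (G0 : E3 → Fin 3 → Fin 3 → ℝ)
    (θ0 : E3 → ℝ) (u : ℝ → E3 → E3) (θ : ℝ → E3 → ℝ) : Prop where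
  regular_u : ∀ j, IsC21 T (fun t x => u t x j)
  regular_θ : IsC21 T θ
  momentum : ∀ t ∈ Set.Ioc 0 T, ∀ x, ∀ j,
    timeDeriv T (fun s y => u s y j) t x
      + ∑ i, u t x i * pd i (fun y => u t y j) x
      + 1 / γ * (u t x j * ∑ i, pd i (fun y => u t y i) x)
      - ν * ∑ i, pd i (fun y => θ t y * pd i (fun z => u t z j) y) x = 0
  heat : ∀ t ∈ Set.Ioc 0 T, ∀ x,
    timeDeriv T (fun s y => θ s y ^ 2) t x
      + ∑ i, pd i (fun y => u t y i * θ t y ^ 2) x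
      - κ * ∑ i, pd i (fun y => θ t y * pd i (fun z => θ t z ^ 2) y) x
      = ν * θ t x * frobSq (jac (u t) x)
  init_u_H1 : HasH1Gradient u0 G0
  init_θ_periodic : IsPeriodic3 θ0
  init_θ_memLp : MemLp θ0 2 torusMeasure
  u_zero : u 0 = u0
  θ_zero : θ 0 = θ0
  tendsto_u : Tendsto (fun t => eLpNorm (fun x => u t x - u0 x) 2 torusMeasure)
    (𝓝[>] 0) (𝓝 0)
  tendsto_grad : ∀ i j,
    Tendsto (fun t => eLpNorm (fun x => jac (u t) x i j - G0 x i j) 2 torusMeasure)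
      (𝓝[>] 0) (𝓝 0)
  tendsto_θ : Tendsto (fun t => eLpNorm (fun x => θ t x - θ0 x) 2 torusMeasure)
    (𝓝[>] 0) (𝓝 0)
  pos_θ : ∀ᶠ t in 𝓝[>] (0 : ℝ), ∀ x, 0 < θ t x

/-- `∇u(t)` for `0 ≤ t ≤ T`: the classical gradient for `t ≠ 0`, and at `t = 0` the weak gradient
`G0` of the initial velocity. -/
def velGrad (G0 : E3 → Fin 3 → Fin 3 → ℝ) (u : ℝ → E3 → E3) (t : ℝ) :
    E3 → Fin 3 → Fin 3 → ℝ :=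
  if t = 0 then G0 else jac (u t)

/-- `t ↦ ∫_{𝕋³} q(t,x) dx` is well defined for `0 < t ≤ T` and integrable on `[0,T]`. -/
def TimeIntegrable (T : ℝ) (q : ℝ → E3 → ℝ) : Prop :=
  (∀ t ∈ Set.Ioc 0 T, Integrable (q t) torusMeasure) ∧
    IntegrableOn (fun t => ∫ x, q t x ∂torusMeasure) (Set.Icc 0 T) volume

end

/-! Put `a = 1/K`, so that `a κ = ν (1 - a)`, and differentiate `∫ θ^{-a} |∇u|²` in time. The
momentum and temperature equations both produce the mixed term `∑ ∂ₖθ ∂ᵢuⱼ ∂ₖ∂ᵢuⱼ`. With this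
exponent the two contributions cancel, once a heat flux and a Hessian null form, both of integral
zero, have been added. The viscous heating `ν |∇u|²` in the temperature equation, multiplied by the
negative derivative of the weight, gives the quartic dissipation `θ^{-a-1} |∇u|⁴`. The condition `ν
≤ κ`, that is `a ≤ 1/2`, makes the remaining quadratic form negative. This is
`weighted_dissipation_pointwise`.

What is left are the errors `∫ θ |∇u|²` and `∫ |u|⁴`, with coefficients that are powers of `1/θ`.
Three facts control them. First, `minimum_principle` keeps `θ` above the explicit barrier `1 / (1 +
3t/(8ν))`, because the viscous heating beats the compression terms up to a Riccati loss. Second, the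
factor `1/γ` in the momentum equation makes `∫ (1 + |u|²)^{γ/2}` nearly conserved: its rate contains
only the lower power `γ/2 - 1`, so `exists_energy_bound` gives polynomial growth and a bound on `∫∫
θ |∇u|²`. Third, `integral_speedWeight_sq_le` interpolates `∫ (1 + |u|²)²` between the quartic
dissipation, `∫ θ |∇u|²` and `∫ (1 + |u|²)` by means of the Sobolev inequality.

Two difficulties come from the weak regularity. The velocity is only `C²` in space and `∂ₜ∇u` need
not exist, so the integrations by parts involving third or mixed derivatives are done on difference
quotients (`integral_mul_pd_mul_pd`, `slope_weightedEnergy`). The data are attained only in `H¹`,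
while the constant must depend on the `L^γ` norm; `exists_short_time_bound` recovers that norm with
truncated entropies whose growth rate does not depend on the truncation. The weighted energy passes
to time zero along a sequence on which `θ` converges almost everywhere. -/

/-! ### Integration over the fundamental cell -/

theorem unitCell_eq_fundamentalDomain :
    unitCell = ZSpan.fundamentalDomain (EuclideanSpace.basisFun (Fin 3) ℝ).toBasis := by
  ext x
  simp [unitCell, ZSpan.mem_fundamentalDomain]

theorem measurableSet_unitCell : MeasurableSet unitCell := by
  rw [unitCell_eq_fundamentalDomain]
  exact ZSpan.fundamentalDomain_measurableSet _

theorem isAddFundamentalDomain_unitCell :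
    IsAddFundamentalDomain
      (Submodule.span ℤ
        (Set.range (EuclideanSpace.basisFun (Fin 3) ℝ).toBasis)).toAddSubgroup unitCell
      (volume : Measure E3) := by
  rw [unitCell_eq_fundamentalDomain]
  exact ZSpan.isAddFundamentalDomain' _ _

theorem norm_le_two_of_mem_unitCell {x : E3} (hx : x ∈ unitCell) : ‖x‖ ≤ 2 := by
  rw [EuclideanSpace.norm_eq]
  apply Real.sqrt_le_iff.2
  refine ⟨by norm_num, ?_⟩
  rw [Fin.sum_univ_three]
  have h : ∀ i, ‖x i‖ ^ 2 ≤ 1 := fun i => by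
    have := hx i
    rw [Real.norm_eq_abs, sq_abs]
    nlinarith [this.1, this.2]
  linarith [h 0, h 1, h 2]

theorem volume_unitCell : (volume : Measure E3) unitCell = 1 := by
  have h := EuclideanSpace.volume_preserving_symm_measurableEquiv_toLp (Fin 3)
  have h2 := h.measure_preimage (s := Set.pi Set.univ fun _ : Fin 3 => Set.Ico (0 : ℝ) 1)
    (MeasurableSet.univ_pi fun _ => measurableSet_Ico).nullMeasurableSet
  rw [Real.volume_pi_Ico] at h2
  have : unitCell = (MeasurableEquiv.toLp 2 (Fin 3 → ℝ)).symm ⁻¹'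
      (Set.pi Set.univ fun _ : Fin 3 => Set.Ico (0 : ℝ) 1) := by
    ext x
    simp [unitCell, Set.mem_pi]
  rw [this]
  simpa using h2

instance : IsProbabilityMeasure torusMeasure :=
  ⟨by rw [torusMeasure, Measure.restrict_apply_univ, volume_unitCell]⟩

theorem integrable_torus {f : E3 → ℝ} (hf : Continuous f) : Integrable f torusMeasure := by
  have h : IntegrableOn f (Metric.closedBall (0 : E3) 2) volume :=
    hf.continuousOn.integrableOn_compact (isCompact_closedBall _ _)
  exact h.mono_set fun x hx => by simpa using norm_le_two_of_mem_unitCell hx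

theorem IsPeriodic3.add_mem_span {α : Type*} {f : E3 → α} (hf : IsPeriodic3 f) {z : E3}
    (hz : z ∈ Submodule.span ℤ (Set.range (EuclideanSpace.basisFun (Fin 3) ℝ).toBasis)) :
    ∀ x, f (x + z) = f x := by
  refine Submodule.span_induction ?_ ?_ ?_ ?_ hz
  · rintro _ ⟨i, rfl⟩ x
    simpa using hf x i
  · simp
  · intro y z _ _ hy hz' x
    rw [← add_assoc, hz', hy]
  · intro n y _ hy x
    induction n using Int.induction_on generalizing x with
    | zero => simp
    | succ n ih => rw [add_smul, one_smul, ← add_assoc, hy, ih]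
    | pred n ih =>
      rw [sub_smul, one_smul]
      have := hy (x + ((-n : ℤ) • y - y))
      rw [← this, ← ih x]
      congr 1
      abel

theorem memLp_torus {f : E3 → ℝ} (hf : Continuous f) (p : ENNReal) : MemLp f p torusMeasure := by
  obtain ⟨A, hA⟩ := (isCompact_closedBall (0 : E3) 2).exists_bound_of_continuousOn hf.continuousOn
  refine MemLp.of_bound hf.aestronglyMeasurable A ?_
  filter_upwards [ae_restrict_mem measurableSet_unitCell] with x hx
  exact hA x (by simpa using norm_le_two_of_mem_unitCell hx)

theorem integral_torus_add {f g : E3 → ℝ} (hf : Continuous f) (hg : Continuous g) :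
    ∫ x, f x + g x ∂torusMeasure = ∫ x, f x ∂torusMeasure + ∫ x, g x ∂torusMeasure :=
  integral_add (integrable_torus hf) (integrable_torus hg)

theorem integral_torus_sub {f g : E3 → ℝ} (hf : Continuous f) (hg : Continuous g) :
    ∫ x, f x - g x ∂torusMeasure = ∫ x, f x ∂torusMeasure - ∫ x, g x ∂torusMeasure :=
  integral_sub (integrable_torus hf) (integrable_torus hg)

theorem integral_torus_sum {ι : Type*} (s : Finset ι) {f : ι → E3 → ℝ}
    (hf : ∀ i ∈ s, Continuous (f i)) :
    ∫ x, ∑ i ∈ s, f i x ∂torusMeasure = ∑ i ∈ s, ∫ x, f i x ∂torusMeasure :=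
  integral_finsetSum s fun i hi => integrable_torus (hf i hi)

theorem integral_torus_mono {f g : E3 → ℝ} (hf : Continuous f) (hg : Continuous g)
    (h : ∀ x, f x ≤ g x) : ∫ x, f x ∂torusMeasure ≤ ∫ x, g x ∂torusMeasure :=
  integral_mono (integrable_torus hf) (integrable_torus hg) h

-- A translate of the cell is again a fundamental domain of the same lattice, and a
-- lattice-invariant function has equal integrals over any two fundamental domains.
open scoped Pointwise in
theorem integral_torus_translate {f : E3 → ℝ} (hf : IsPeriodic3 f) (v : E3) :
    ∫ x, f (x + v) ∂torusMeasure = ∫ x, f x ∂torusMeasure := by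
  have h1 : ∫ x, f (x + v) ∂torusMeasure = ∫ x in (fun x => x + v) '' unitCell, f x := by
    rw [torusMeasure]
    exact ((measurePreserving_add_right (volume : Measure E3) v).setIntegral_image_emb
      (measurableEmbedding_addRight v) f unitCell).symm
  rw [h1]
  have h2 := isAddFundamentalDomain_unitCell.vadd_of_comm v
  have h3 : (fun x => x + v) '' unitCell = (v +ᵥ unitCell : Set E3) := by
    ext x
    simp only [Set.mem_vadd_set, Set.mem_image, vadd_eq_add, add_comm]
  rw [h3]
  have : Countable (Submodule.span ℤ
      (Set.range (EuclideanSpace.basisFun (Fin 3) ℝ).toBasis)).toAddSubgroup :=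
    inferInstanceAs (Countable (Submodule.span ℤ
      (Set.range (EuclideanSpace.basisFun (Fin 3) ℝ).toBasis)))
  refine h2.setIntegral_eq isAddFundamentalDomain_unitCell fun g x => ?_
  have := hf.add_mem_span g.2 x
  rw [add_comm] at this
  exact this

/-! ### Calculus of partial derivatives -/

theorem HasFDerivAt.pd_eq {f : E3 → ℝ} {f' : E3 →L[ℝ] ℝ} {x : E3} (h : HasFDerivAt f f' x)
    (i : Fin 3) : pd i f x = f' (EuclideanSpace.single i 1) := by
  rw [pd, h.fderiv]

theorem pd_mul {f g : E3 → ℝ} {x : E3} (hf : DifferentiableAt ℝ f x)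
    (hg : DifferentiableAt ℝ g x) (i : Fin 3) :
    pd i (fun y => f y * g y) x = pd i f x * g x + f x * pd i g x := by
  refine ((hf.hasFDerivAt.mul hg.hasFDerivAt).pd_eq i).trans ?_
  simp [pd]
  ring

theorem pd_add {f g : E3 → ℝ} {x : E3} (hf : DifferentiableAt ℝ f x)
    (hg : DifferentiableAt ℝ g x) (i : Fin 3) :
    pd i (fun y => f y + g y) x = pd i f x + pd i g x := by
  refine ((hf.hasFDerivAt.add hg.hasFDerivAt).pd_eq i).trans ?_
  simp [pd]

theorem pd_sub {f g : E3 → ℝ} {x : E3} (hf : DifferentiableAt ℝ f x)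
    (hg : DifferentiableAt ℝ g x) (i : Fin 3) :
    pd i (fun y => f y - g y) x = pd i f x - pd i g x := by
  refine ((hf.hasFDerivAt.sub hg.hasFDerivAt).pd_eq i).trans ?_
  simp [pd]

theorem pd_const_mul {f : E3 → ℝ} {x : E3} (hf : DifferentiableAt ℝ f x) (c : ℝ) (i : Fin 3) :
    pd i (fun y => c * f y) x = c * pd i f x := by
  refine ((hf.hasFDerivAt.const_mul c).pd_eq i).trans ?_
  simp [pd]

theorem pd_sum {ι : Type*} (s : Finset ι) {f : ι → E3 → ℝ} {x : E3}
    (hf : ∀ j ∈ s, DifferentiableAt ℝ (f j) x) (i : Fin 3) :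
    pd i (fun y => ∑ j ∈ s, f j y) x = ∑ j ∈ s, pd i (f j) x := by
  rw [(HasFDerivAt.fun_sum fun j hj => (hf j hj).hasFDerivAt).pd_eq i]
  simp [pd]

theorem pd_comp {φ : ℝ → ℝ} {φ' : ℝ} {f : E3 → ℝ} {x : E3} (hφ : HasDerivAt φ φ' (f x))
    (hf : DifferentiableAt ℝ f x) (i : Fin 3) :
    pd i (fun y => φ (f y)) x = φ' * pd i f x := by
  refine ((hφ.comp_hasFDerivAt x hf.hasFDerivAt).pd_eq i).trans ?_
  simp [pd]

theorem pd_sq {f : E3 → ℝ} {x : E3} (hf : DifferentiableAt ℝ f x) (i : Fin 3) :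
    pd i (fun y => f y ^ 2) x = 2 * f x * pd i f x := by
  rw [pd_comp (φ := fun r => r ^ 2) (hasDerivAt_pow 2 (f x)) hf]
  simp

theorem ContDiff.pd {f : E3 → ℝ} {m n : WithTop ℕ∞} (hf : ContDiff ℝ n f) (hmn : m + 1 ≤ n)
    (i : Fin 3) : ContDiff ℝ m (pd i f) :=
  (hf.fderiv_right hmn).clm_apply contDiff_const

theorem ContDiff.continuous_pd {f : E3 → ℝ} (hf : ContDiff ℝ 1 f) (i : Fin 3) :
    Continuous (_root_.pd i f) :=
  (hf.pd (m := 0) (by norm_num) i).continuous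

theorem IsPeriodic3.pd {f : E3 → ℝ} (hf : IsPeriodic3 f) (i : Fin 3) :
    IsPeriodic3 (pd i f) := by
  intro x j
  have h : (fun y => f (y + EuclideanSpace.single j 1)) = f := funext fun y => hf y j
  simp only [_root_.pd]
  rw [← fderiv_comp_add_right, h]

/-! ### Difference quotients and integration by parts -/

theorem hasDerivAt_line {f : E3 → ℝ} (hf : Differentiable ℝ f) (i : Fin 3) (x : E3) (s : ℝ) :
    HasDerivAt (fun s : ℝ => f (x + s • EuclideanSpace.single i 1))
      (pd i f (x + s • EuclideanSpace.single i 1)) s := by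
  have h1 : HasDerivAt (fun s : ℝ => x + s • (EuclideanSpace.single i 1 : E3))
      (EuclideanSpace.single i 1) s := by
    simpa using ((hasDerivAt_id s).smul_const (EuclideanSpace.single i 1 : E3)).const_add x
  exact (hf _).hasFDerivAt.comp_hasDerivAt s h1

/-- The difference quotient of `f` in the direction `eᵢ`. -/
noncomputable def diffQuot (i : Fin 3) (h : ℝ) (f : E3 → ℝ) (x : E3) : ℝ :=
  (f (x + h • EuclideanSpace.single i 1) - f x) / h

theorem tendsto_diffQuot {f : E3 → ℝ} (hf : Differentiable ℝ f) (i : Fin 3) (x : E3) :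
    Tendsto (fun h => diffQuot i h f x) (𝓝[≠] 0) (𝓝 (pd i f x)) := by
  have := (hasDerivAt_line hf i x 0).tendsto_slope
  simp only [zero_smul, add_zero] at this
  refine this.congr fun h => ?_
  simp [slope, diffQuot, div_eq_inv_mul]

theorem tendsto_integral_mul_diffQuot {f g : E3 → ℝ} (hf : ContDiff ℝ 1 f) (hg : Continuous g)
    (i : Fin 3) :
    Tendsto (fun h => ∫ x, g x * diffQuot i h f x ∂torusMeasure) (𝓝[≠] 0)
      (𝓝 (∫ x, g x * pd i f x ∂torusMeasure)) := by
  -- The cell lies in the ball of radius 2, so its shifts by less than one stay in the ball of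
  -- radius 3; the bound there dominates all the quotients.
  obtain ⟨A, hA⟩ := (isCompact_closedBall (0 : E3) 3).exists_bound_of_continuousOn
    (hf.continuous_pd i).continuousOn
  have hfc := hf.continuous
  refine tendsto_integral_filter_of_dominated_convergence (fun x => |g x| * A) ?_ ?_ ?_ ?_
  · refine Eventually.of_forall fun h => Continuous.aestronglyMeasurable ?_
    unfold diffQuot
    fun_prop
  · have h1 : ∀ᶠ h : ℝ in 𝓝[≠] 0, |h| < 1 := by
      refine eventually_nhdsWithin_of_eventually_nhds ?_
      filter_upwards [Metric.ball_mem_nhds (0 : ℝ) one_pos] with h hh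
      simpa using hh
    filter_upwards [h1, self_mem_nhdsWithin] with h hh hne
    filter_upwards [ae_restrict_mem measurableSet_unitCell] with x hx
    rw [Real.norm_eq_abs, abs_mul]
    refine mul_le_mul_of_nonneg_left ?_ (abs_nonneg _)
    have hMVT := (convex_Icc (-1 : ℝ) 1).norm_image_sub_le_of_norm_hasDerivWithin_le
      (f := fun s : ℝ => f (x + s • EuclideanSpace.single i 1))
      (f' := fun s => pd i f (x + s • EuclideanSpace.single i 1)) (C := A) (x := 0) (y := h)
      (fun s _ => (hasDerivAt_line (hf.differentiable (by norm_num)) i x s).hasDerivWithinAt)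
      (fun s hs => hA _ ?_) (by simp) (abs_le.1 hh.le)
    · simp only [zero_smul, add_zero, sub_zero, Real.norm_eq_abs] at hMVT
      rw [diffQuot, abs_div, div_le_iff₀ (abs_pos.2 hne)]
      exact hMVT
    · rw [mem_closedBall_zero_iff]
      refine (norm_add_le _ _).trans ?_
      have := norm_le_two_of_mem_unitCell hx
      have h2 : ‖s • (EuclideanSpace.single i 1 : E3)‖ ≤ 1 := by
        rw [norm_smul]
        simpa using abs_le.2 hs
      linarith
  · exact ((integrable_torus (continuous_abs.comp hg)).mul_const A)
  · exact Eventually.of_forall fun x =>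
      (tendsto_diffQuot (hf.differentiable (by norm_num)) i x).const_mul _

/-- By translation invariance every difference quotient has integral zero, and this survives the
limit. It discards all divergence terms below. -/
theorem integral_pd_eq_zero {f : E3 → ℝ} (hf : ContDiff ℝ 1 f) (hp : IsPeriodic3 f) (i : Fin 3) :
    ∫ x, pd i f x ∂torusMeasure = 0 := by
  have h := tendsto_integral_mul_diffQuot hf (continuous_const (y := (1 : ℝ))) i
  simp only [one_mul] at h
  have h0 : ∀ t, ∫ x, diffQuot i t f x ∂torusMeasure = 0 := fun t => by
    have hfc := hf.continuous
    simp only [diffQuot]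
    rw [integral_div, integral_torus_sub (by fun_prop) hfc,
      integral_torus_translate hp, sub_self, zero_div]
  simp only [h0] at h
  exact tendsto_nhds_unique h tendsto_const_nhds

theorem IsPeriodic3.mul {f g : E3 → ℝ} (hf : IsPeriodic3 f) (hg : IsPeriodic3 g) :
    IsPeriodic3 fun x => f x * g x := fun x i => by simp only [hf x i, hg x i]

theorem IsPeriodic3.add {f g : E3 → ℝ} (hf : IsPeriodic3 f) (hg : IsPeriodic3 g) :
    IsPeriodic3 fun x => f x + g x := fun x i => by simp only [hf x i, hg x i]

theorem IsPeriodic3.sub {f g : E3 → ℝ} (hf : IsPeriodic3 f) (hg : IsPeriodic3 g) :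
    IsPeriodic3 fun x => f x - g x := fun x i => by simp only [hf x i, hg x i]

theorem IsPeriodic3.comp {α β : Type*} {f : E3 → α} (hf : IsPeriodic3 f) (φ : α → β) :
    IsPeriodic3 fun x => φ (f x) := fun x i => by simp only [hf x i]

theorem IsPeriodic3.sum {ι : Type*} {s : Finset ι} {f : ι → E3 → ℝ}
    (hf : ∀ j ∈ s, IsPeriodic3 (f j)) : IsPeriodic3 fun x => ∑ j ∈ s, f j x :=
  fun x i => Finset.sum_congr rfl fun j hj => hf j hj x i

theorem integral_mul_pd {f g : E3 → ℝ} (hf : ContDiff ℝ 1 f) (hg : ContDiff ℝ 1 g)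
    (pf : IsPeriodic3 f) (pg : IsPeriodic3 g) (i : Fin 3) :
    ∫ x, f x * pd i g x ∂torusMeasure = - ∫ x, pd i f x * g x ∂torusMeasure := by
  have h := integral_pd_eq_zero (hf.mul hg) (pf.mul pg) i
  have h2 : ∀ x, pd i (fun y => f y * g y) x = pd i f x * g x + f x * pd i g x := fun x =>
    pd_mul (hf.differentiable (by norm_num) x) (hg.differentiable (by norm_num) x) i
  simp only [h2] at h
  have c1 := hf.continuous_pd i
  have c2 := hg.continuous_pd i
  have c3 := hf.continuous
  have c4 := hg.continuous
  rw [integral_torus_add (by fun_prop) (by fun_prop)] at h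
  linarith

theorem pd_diffQuot {f : E3 → ℝ} (hf : Differentiable ℝ f) (i k : Fin 3) (h : ℝ) (x : E3) :
    pd k (diffQuot i h f) x = diffQuot i h (pd k f) x := by
  have h1 : HasFDerivAt (fun x => f (x + h • EuclideanSpace.single i 1))
      (fderiv ℝ f (x + h • EuclideanSpace.single i 1)) x :=
    (hasFDerivAt_comp_add_right _).2 (hf _).hasFDerivAt
  have h2 := ((h1.sub (hf x).hasFDerivAt).mul_const h⁻¹)
  have e : diffQuot i h f = fun x => (f (x + h • EuclideanSpace.single i 1) - f x) * h⁻¹ :=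
    funext fun x => div_eq_mul_inv _ _
  have h3 := h2.pd_eq k
  rw [e]
  refine Eq.trans h3 ?_
  simp [diffQuot, pd]
  ring

/-- Discrete integration by parts: translating the product back by `h eᵢ` moves the shift from `g`
to `f`. Continuity suffices. -/
theorem integral_mul_diffQuot {f g : E3 → ℝ} (hf : Continuous f) (hg : Continuous g)
    (pf : IsPeriodic3 f) (pg : IsPeriodic3 g) (i : Fin 3) (h : ℝ) :
    ∫ x, f x * diffQuot i h g x ∂torusMeasure
      = - ∫ x, g x * diffQuot i (-h) f x ∂torusMeasure := by
  have e1 := integral_torus_translate (f := fun x => f x * g (x + h • EuclideanSpace.single i 1))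
    (pf.mul fun x j => by
      rw [add_right_comm, pg]) (-(h • EuclideanSpace.single i 1))
  simp only [neg_add_cancel_right] at e1
  have i1 : Integrable (fun x => f x * g (x + h • EuclideanSpace.single i 1)) torusMeasure :=
    integrable_torus (by fun_prop)
  have i2 : Integrable (fun x => f x * g x) torusMeasure := integrable_torus (by fun_prop)
  have i3 : Integrable (fun x => f (x + -(h • EuclideanSpace.single i 1)) * g x) torusMeasure :=
    integrable_torus (by fun_prop)
  have l : ∀ x, f x * diffQuot i h g x
      = (f x * g (x + h • EuclideanSpace.single i 1) - f x * g x) / h := fun x => by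
    rw [diffQuot]; ring
  have r : ∀ x, g x * diffQuot i (-h) f x
      = -((f (x + -(h • EuclideanSpace.single i 1)) * g x - f x * g x) / h) := fun x => by
    rw [diffQuot, neg_smul, div_neg]; ring
  simp only [l, r, integral_neg, neg_neg]
  rw [integral_div, integral_div, integral_sub i1 i2, integral_sub i3 i2, e1]

/-- Exchange of the two derivatives in a product of first derivatives, for functions that are
only once continuously differentiable. -/
theorem integral_mul_pd_mul_pd {p q w : E3 → ℝ} (hp : ContDiff ℝ 1 p) (hq : ContDiff ℝ 1 q)
    (hw : ContDiff ℝ 1 w) (pp : IsPeriodic3 p) (pq : IsPeriodic3 q) (pw : IsPeriodic3 w)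
    (i k : Fin 3) :
    ∫ x, w x * pd k q x * pd i p x ∂torusMeasure
      = - (∫ x, q x * pd k w x * pd i p x ∂torusMeasure)
        + ∫ x, pd k p x * pd i (fun y => q y * w y) x ∂torusMeasure := by
  -- Integrating `∂ₖ` by parts directly would need `∂ₖ∂ᵢp`. The quotient replacing `∂ᵢp` is as
  -- smooth as `p` and commutes with `∂ₖ`, so it can be moved onto `q w` by `integral_mul_diffQuot`
  -- before the limit is taken.
  have dC : ∀ h, ContDiff ℝ 1 (diffQuot i h p) := fun h => by
    unfold diffQuot
    exact ((hp.comp (contDiff_id.add contDiff_const)).sub hp).div_const h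
  have dP : ∀ h, IsPeriodic3 (diffQuot i h p) := fun h x j => by
    simp only [diffQuot]
    rw [add_right_comm, pp, pp]
  have key : ∀ h, ∫ x, w x * pd k q x * diffQuot i h p x ∂torusMeasure
      = - (∫ x, q x * pd k w x * diffQuot i h p x ∂torusMeasure)
        + ∫ x, pd k p x * diffQuot i (-h) (fun y => q y * w y) x ∂torusMeasure := fun h => by
    have e1 := integral_mul_pd (f := fun x => w x * diffQuot i h p x) (hw.mul (dC h)) hq
      (pw.mul (dP h)) pq k
    have e2 := integral_mul_diffQuot (f := fun y => q y * w y) (hq.continuous.mul hw.continuous)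
      (hp.continuous_pd k) (pq.mul pw) (pp.pd k) i h
    have e3 : ∀ x, pd k (fun x => w x * diffQuot i h p x) x * q x
        = q x * pd k w x * diffQuot i h p x + q x * w x * diffQuot i h (pd k p) x := fun x => by
      rw [pd_mul (hw.differentiable (by norm_num) x) ((dC h).differentiable (by norm_num) x),
        pd_diffQuot (hp.differentiable (by norm_num))]
      ring
    have c1 : Continuous (pd k w) := hw.continuous_pd k
    have c2 : Continuous (diffQuot i h p) := (dC h).continuous
    have c3 : Continuous (diffQuot i h (pd k p)) := by
      have := hp.continuous_pd k
      unfold diffQuot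
      fun_prop
    have c4 := hq.continuous
    have c5 := hw.continuous
    simp only [e3] at e1
    rw [integral_add (integrable_torus (by fun_prop)) (integrable_torus (by fun_prop)), e2] at e1
    calc _ = ∫ x, w x * diffQuot i h p x * pd k q x ∂torusMeasure := by
          congr 1; ext x; ring
      _ = _ := by rw [e1]; ring
  have l1 := tendsto_integral_mul_diffQuot hp (g := fun x => w x * pd k q x)
    (hw.continuous.mul (hq.continuous_pd k)) i
  have l2 := tendsto_integral_mul_diffQuot hp (g := fun x => q x * pd k w x)
    (hq.continuous.mul (hw.continuous_pd k)) i
  have l3 := tendsto_integral_mul_diffQuot (hq.mul hw) (hp.continuous_pd k) i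
  have hneg : Tendsto (fun h : ℝ => -h) (𝓝[≠] 0) (𝓝[≠] 0) := by
    refine tendsto_nhdsWithin_iff.2 ⟨?_, ?_⟩
    · have : Tendsto (fun h : ℝ => -h) (𝓝 0) (𝓝 0) := by simpa using continuous_neg.tendsto (0 : ℝ)
      exact this.mono_left nhdsWithin_le_nhds
    · filter_upwards [self_mem_nhdsWithin] with h hh
      simpa using hh
  simp only [key] at l1
  exact tendsto_nhds_unique l1 (l2.neg.add (l3.comp hneg))

/-! ### Continuity and differentiation in time under the integral -/

/-- Joint continuity on `(0,T] × ℝ³`. -/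
def JointCont (T : ℝ) (f : ℝ → E3 → ℝ) : Prop :=
  ContinuousOn (fun p : ℝ × E3 => f p.1 p.2) (Set.Ioc 0 T ×ˢ Set.univ)

namespace JointCont

variable {T : ℝ} {f g : ℝ → E3 → ℝ}

theorem slice (hf : JointCont T f) {t : ℝ} (ht : t ∈ Ioc 0 T) : Continuous (f t) :=
  ContinuousOn.comp_continuous (f := fun x : E3 => (t, x)) hf (by fun_prop)
    fun x => ⟨ht, mem_univ x⟩

theorem time_slice (hf : JointCont T f) (x : E3) : ContinuousOn (fun t => f t x) (Ioc 0 T) :=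
  ContinuousOn.comp (f := fun t : ℝ => (t, x)) hf (by fun_prop) fun _ ht => ⟨ht, mem_univ x⟩

theorem exists_bound (hf : JointCont T f) {K : Set ℝ} (hK : IsCompact K) (hKT : K ⊆ Ioc 0 T)
    (r : ℝ) : ∃ A, ∀ s ∈ K, ∀ x : E3, ‖x‖ ≤ r → |f s x| ≤ A := by
  obtain ⟨A, hA⟩ := (hK.prod (isCompact_closedBall (0 : E3) r)).exists_bound_of_continuousOn
    (hf.mono (prod_mono hKT (subset_univ _)))
  exact ⟨A, fun s hs x hx => hA (s, x) ⟨hs, by simpa using hx⟩⟩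

theorem mul (hf : JointCont T f) (hg : JointCont T g) : JointCont T fun t x => f t x * g t x :=
  ContinuousOn.mul hf hg

theorem add (hf : JointCont T f) (hg : JointCont T g) : JointCont T fun t x => f t x + g t x :=
  ContinuousOn.add hf hg

theorem sub (hf : JointCont T f) (hg : JointCont T g) : JointCont T fun t x => f t x - g t x :=
  ContinuousOn.sub hf hg

theorem pow (hf : JointCont T f) (n : ℕ) : JointCont T fun t x => f t x ^ n :=
  ContinuousOn.pow hf n

theorem sum {ι : Type*} {s : Finset ι} {f : ι → ℝ → E3 → ℝ} (hf : ∀ i ∈ s, JointCont T (f i)) :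
    JointCont T fun t x => ∑ i ∈ s, f i t x :=
  continuousOn_finsetSum s hf

theorem const_slice {h : E3 → ℝ} (hh : Continuous h) : JointCont T fun _ => h :=
  (hh.comp continuous_snd).continuousOn

theorem of_time {h : ℝ → ℝ} (hh : ContinuousOn h (Ioc 0 T)) : JointCont T fun t _ => h t :=
  hh.comp continuous_fst.continuousOn fun _ hp => hp.1

theorem const (c : ℝ) : JointCont T fun _ _ => c := continuousOn_const

theorem comp {φ : ℝ → ℝ} {S : Set ℝ} (hf : JointCont T f) (hφ : ContinuousOn φ S)
    (hS : ∀ t ∈ Ioc 0 T, ∀ x, f t x ∈ S) : JointCont T fun t x => φ (f t x) :=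
  ContinuousOn.comp (g := φ) hφ hf fun p hp => hS p.1 hp.1 p.2

theorem mono {T' : ℝ} (hf : JointCont T f) (h : T' ≤ T) : JointCont T' f :=
  ContinuousOn.mono hf (prod_mono (Ioc_subset_Ioc_right h) subset_rfl)

theorem continuousOn_integral (hf : JointCont T f) :
    ContinuousOn (fun t => ∫ x, f t x ∂torusMeasure) (Ioc 0 T) := by
  intro t ht
  obtain ⟨A, hA⟩ := hf.exists_bound (isCompact_Icc (a := t / 2) (b := T))
    (fun s hs => ⟨(half_pos ht.1).trans_le hs.1, hs.2⟩) 2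
  have hev : ∀ᶠ s in 𝓝[Ioc 0 T] t, s ∈ Icc (t / 2) T := by
    have h1 : ∀ᶠ s in 𝓝[Ioc 0 T] t, t / 2 < s :=
      eventually_nhdsWithin_of_eventually_nhds (lt_mem_nhds (half_lt_self ht.1))
    filter_upwards [h1, self_mem_nhdsWithin] with s hs hs2 using ⟨hs.le, hs2.2⟩
  refine continuousWithinAt_of_dominated (bound := fun _ => A) ?_ ?_ (integrable_const A) ?_
  · filter_upwards [self_mem_nhdsWithin] with s hs using (hf.slice hs).aestronglyMeasurable
  · filter_upwards [hev] with s hs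
    filter_upwards [ae_restrict_mem measurableSet_unitCell] with x hx
    exact hA s hs x (norm_le_two_of_mem_unitCell hx)
  · exact Eventually.of_forall fun x => hf.time_slice x t ht

end JointCont

/-- `f` is jointly continuous on `(0,T] × ℝ³` and `ft` is its time derivative for `0 < t < T`,
also jointly continuous. -/
structure TimeC1 (T : ℝ) (f ft : ℝ → E3 → ℝ) : Prop where
  cont : JointCont T f
  cont_deriv : JointCont T ft
  hasDerivAt : ∀ t ∈ Ioo 0 T, ∀ x, HasDerivAt (fun s => f s x) (ft t x) t

namespace TimeC1

variable {T : ℝ} {f ft g gt : ℝ → E3 → ℝ}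

theorem mono {T' : ℝ} (hf : TimeC1 T f ft) (h : T' ≤ T) : TimeC1 T' f ft :=
  ⟨hf.cont.mono h, hf.cont_deriv.mono h,
    fun t ht => hf.hasDerivAt t ⟨ht.1, ht.2.trans_le h⟩⟩

theorem sub (hf : TimeC1 T f ft) (hg : TimeC1 T g gt) :
    TimeC1 T (fun t x => f t x - g t x) (fun t x => ft t x - gt t x) :=
  ⟨hf.cont.sub hg.cont, hf.cont_deriv.sub hg.cont_deriv,
    fun t ht x => (hf.hasDerivAt t ht x).sub (hg.hasDerivAt t ht x)⟩

theorem of_time {h h' : ℝ → ℝ} (hc : ContinuousOn h (Ioc 0 T)) (hc' : ContinuousOn h' (Ioc 0 T))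
    (hd : ∀ t ∈ Ioo 0 T, HasDerivAt h (h' t) t) :
    TimeC1 T (fun t _ => h t) (fun t _ => h' t) :=
  ⟨.of_time hc, .of_time hc', fun t ht _ => hd t ht⟩

theorem comp {φ φ' : ℝ → ℝ} {S : Set ℝ} (hf : TimeC1 T f ft) (hφ : ∀ r ∈ S, HasDerivAt φ (φ' r) r)
    (hφ' : ContinuousOn φ' S) (hS : ∀ t ∈ Ioc 0 T, ∀ x, f t x ∈ S) :
    TimeC1 T (fun t x => φ (f t x)) (fun t x => φ' (f t x) * ft t x) :=
  ⟨hf.cont.comp (fun r hr => (hφ r hr).continuousAt.continuousWithinAt) hS,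
    (hf.cont.comp hφ' hS).mul hf.cont_deriv,
    fun t ht x => (hφ _ (hS t ⟨ht.1, ht.2.le⟩ x)).comp t (hf.hasDerivAt t ht x)⟩

/-- The factor `ψ` is taken at the moving time and needs only continuity. This gives a product rule
in which one factor, such as `|∇v|²`, has no time derivative at hand. Domination comes from the mean
value inequality on a compact time interval. -/
theorem tendsto_integral_slope_mul {ψ : ℝ → E3 → ℝ} (hf : TimeC1 T f ft) (hψ : JointCont T ψ)
    {t : ℝ} (ht : t ∈ Ioo 0 T) :
    Tendsto (fun s => ∫ x, slope (fun r => f r x) t s * ψ s x ∂torusMeasure) (𝓝[≠] t)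
      (𝓝 (∫ x, ft t x * ψ t x ∂torusMeasure)) := by
  set a := t / 2 with ha
  set b := (t + T) / 2 with hb
  have hab : Icc a b ⊆ Ioo 0 T := fun s hs => by
    have := hs.1; have := hs.2; have := ht.1; have := ht.2
    constructor <;> linarith
  have hab' : Icc a b ⊆ Ioc 0 T := hab.trans Ioo_subset_Ioc_self
  have htab : t ∈ Ioo a b := by
    have := ht.1; have := ht.2
    constructor <;> linarith
  obtain ⟨A, hA⟩ := hf.cont_deriv.exists_bound (isCompact_Icc (a := a) (b := b)) hab' 2
  obtain ⟨B, hB⟩ := hψ.exists_bound (isCompact_Icc (a := a) (b := b)) hab' 2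
  have hev : ∀ᶠ s in 𝓝[≠] t, s ∈ Ioo a b :=
    eventually_nhdsWithin_of_eventually_nhds (Ioo_mem_nhds htab.1 htab.2)
  refine tendsto_integral_filter_of_dominated_convergence (fun _ => A * B) ?_ ?_
    (integrable_const _) ?_
  · filter_upwards [hev] with s hs
    have c1 := hf.cont.slice (hab' (Ioo_subset_Icc_self hs))
    have c2 := hf.cont.slice (hab' (Ioo_subset_Icc_self htab))
    have c3 := hψ.slice (hab' (Ioo_subset_Icc_self hs))
    simp only [slope, vsub_eq_sub, smul_eq_mul]
    exact Continuous.aestronglyMeasurable (by fun_prop)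
  · filter_upwards [hev, self_mem_nhdsWithin] with s hs hne
    filter_upwards [ae_restrict_mem measurableSet_unitCell] with x hx
    have hx2 := norm_le_two_of_mem_unitCell hx
    have h1 := (convex_Icc a b).norm_image_sub_le_of_norm_hasDerivWithin_le
      (f := fun r => f r x) (f' := fun r => ft r x) (C := A) (x := t) (y := s)
      (fun r hr => (hf.hasDerivAt r (hab hr) x).hasDerivWithinAt)
      (fun r hr => hA r hr x hx2) (Ioo_subset_Icc_self htab) (Ioo_subset_Icc_self hs)
    have hpos : 0 < |s - t| := abs_pos.2 (sub_ne_zero.2 hne)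
    have h2 : |slope (fun r => f r x) t s| ≤ A := by
      rw [slope_def_field, abs_div, div_le_iff₀ hpos]
      exact h1
    rw [norm_mul]
    exact mul_le_mul h2 (hB s (Ioo_subset_Icc_self hs) x hx2) (norm_nonneg _)
      ((abs_nonneg _).trans h2)
  · refine Eventually.of_forall fun x => (hf.hasDerivAt t ht x).tendsto_slope.mul ?_
    have h1 := hψ.time_slice x t ⟨ht.1, ht.2.le⟩
    have h2 : Ioc 0 T ∈ 𝓝 t := Ioc_mem_nhds ht.1 ht.2
    exact (h1.continuousAt h2).tendsto.mono_left nhdsWithin_le_nhds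

theorem hasDerivAt_integral (hf : TimeC1 T f ft) {t : ℝ} (ht : t ∈ Ioo 0 T) :
    HasDerivAt (fun s => ∫ x, f s x ∂torusMeasure) (∫ x, ft t x ∂torusMeasure) t := by
  rw [hasDerivAt_iff_tendsto_slope]
  have h := hf.tendsto_integral_slope_mul (JointCont.const 1) ht
  simp only [mul_one] at h
  refine h.congr' ?_
  have hev : ∀ᶠ s in 𝓝[≠] t, s ∈ Ioo 0 T :=
    eventually_nhdsWithin_of_eventually_nhds (Ioo_mem_nhds ht.1 ht.2)
  filter_upwards [hev] with s hs
  have c1 := hf.cont.slice (Ioo_subset_Ioc_self hs)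
  have c2 := hf.cont.slice (Ioo_subset_Ioc_self ht)
  simp only [slope, vsub_eq_sub, smul_eq_mul]
  rw [integral_const_mul, integral_torus_sub c1 c2]

end TimeC1

theorem IsC21.timeC1 {T : ℝ} {f : ℝ → E3 → ℝ} (hf : IsC21 T f) : TimeC1 T f (timeDeriv T f) :=
  ⟨hf.cont, hf.cont_time, fun t ht x =>
    (hf.diff_time t ⟨ht.1, ht.2.le⟩ x).hasDerivWithinAt.hasDerivAt (Icc_mem_nhds ht.1 ht.2)⟩

theorem antitoneOn_Ioo_of_hasDerivAt_nonpos {T : ℝ} {g g' : ℝ → ℝ}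
    (hd : ∀ t ∈ Ioo 0 T, HasDerivAt g (g' t) t) (hle : ∀ t ∈ Ioo 0 T, g' t ≤ 0) :
    AntitoneOn g (Ioo 0 T) := by
  refine antitoneOn_of_deriv_nonpos (convex_Ioo 0 T)
    (fun t ht => (hd t ht).continuousAt.continuousWithinAt) ?_ ?_
  · rw [interior_Ioo]
    exact fun t ht => (hd t ht).differentiableAt.differentiableWithinAt
  · rw [interior_Ioo]
    exact fun t ht => by rw [(hd t ht).deriv]; exact hle t ht

theorem sub_le_integral_of_hasDerivAt_le {T : ℝ} {g g' φ : ℝ → ℝ}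
    (hc : ContinuousOn g (Ioc 0 T)) (hd : ∀ t ∈ Ioo 0 T, HasDerivAt g (g' t) t)
    (hφ : ContinuousOn φ (Ioc 0 T)) (hle : ∀ t ∈ Ioo 0 T, g' t ≤ φ t) {s t : ℝ}
    (hs : 0 < s) (hst : s ≤ t) (ht : t ≤ T) : g t - g s ≤ ∫ r in s..t, φ r := by
  have hsub : Icc s t ⊆ Ioc 0 T := fun r hr => ⟨hs.trans_le hr.1, hr.2.trans ht⟩
  have hsub' : Ioo s t ⊆ Ioo 0 T := fun r hr => ⟨hs.trans hr.1, hr.2.trans_le ht⟩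
  exact intervalIntegral.sub_le_integral_of_hasDeriv_right_of_le hst (hc.mono hsub)
    (fun r hr => (hd r (hsub' hr)).hasDerivWithinAt)
    ((hφ.mono hsub).integrableOn_compact isCompact_Icc) fun r hr => hle r (hsub' hr)

/-! ### Minimum principle for the temperature -/

/-- An exponent of at least two removes the corner at zero. The barrier functional is built on the
cube of the positive part, so that its derivative, a square, is still `C¹` and may enter an
integration by parts. -/
theorem hasDerivAt_max_zero_pow (n : ℕ) (r : ℝ) :
    HasDerivAt (fun r : ℝ => max r 0 ^ (n + 2)) ((n + 2) * max r 0 ^ (n + 1)) r := by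
  rcases lt_trichotomy r 0 with h | rfl | h
  · rw [max_eq_right h.le]
    have : (fun r : ℝ => max r 0 ^ (n + 2)) =ᶠ[𝓝 r] fun _ => 0 := by
      filter_upwards [gt_mem_nhds h] with s hs
      rw [max_eq_right hs.le]
      simp
    simpa using (hasDerivAt_const r (0 : ℝ)).congr_of_eventuallyEq this
  · rw [hasDerivAt_iff_tendsto_slope]
    have h1 : Tendsto (fun r : ℝ => max r 0 ^ (n + 1)) (𝓝[≠] 0) (𝓝 (max 0 0 ^ (n + 1))) :=
      (Continuous.tendsto (by fun_prop) 0).mono_left nhdsWithin_le_nhds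
    simp only [max_self, ne_eq, Nat.add_eq_zero_iff, one_ne_zero, and_false, not_false_eq_true,
      zero_pow, mul_zero] at h1 ⊢
    refine h1.congr' ?_
    filter_upwards [self_mem_nhdsWithin] with s hs
    have hs : s ≠ 0 := hs
    simp only [slope_def_field, max_self, sub_zero, ne_eq, Nat.add_eq_zero_iff, OfNat.ofNat_ne_zero,
      and_false, not_false_eq_true, zero_pow]
    rw [eq_div_iff hs]
    rcases le_total s 0 with h | h
    · simp [max_eq_right h]
    · rw [max_eq_left h]; ring
  · rw [max_eq_left h.le]
    have : (fun r : ℝ => max r 0 ^ (n + 2)) =ᶠ[𝓝 r] fun s => s ^ (n + 2) := by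
      filter_upwards [lt_mem_nhds h] with s hs
      rw [max_eq_left hs.le]
    have h2 := (hasDerivAt_pow (n + 2) r).congr_of_eventuallyEq this
    have e : ((n : ℝ) + 2) * r ^ (n + 1) = ((n + 2 : ℕ) : ℝ) * r ^ (n + 2 - 1) := by
      push_cast
      rfl
    rw [e]
    exact h2

theorem contDiff_max_zero_pow (n : ℕ) : ContDiff ℝ 1 (fun r : ℝ => max r 0 ^ (n + 2)) := by
  rw [contDiff_one_iff_deriv]
  refine ⟨fun r => (hasDerivAt_max_zero_pow n r).differentiableAt, ?_⟩
  rw [funext fun r => (hasDerivAt_max_zero_pow n r).deriv]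
  fun_prop

theorem eq_zero_of_integral_torus_eq_zero {f : E3 → ℝ} (hf : Continuous f) (hp : IsPeriodic3 f)
    (h0 : ∀ x, 0 ≤ f x) (hi : ∫ x, f x ∂torusMeasure = 0) (x : E3) : f x = 0 := by
  -- The point is moved to the centre of the cell, around which a whole neighbourhood lies in the
  -- cell; the original point may sit on its boundary.
  set c : E3 := WithLp.toLp 2 fun _ => 1 / 2 with hc
  set g : E3 → ℝ := fun y => f (y + (x - c)) with hg
  have gc : Continuous g := by fun_prop
  have gi : ∫ y, g y ∂torusMeasure = 0 := by rw [hg, integral_torus_translate hp, hi]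
  have gae := (integral_eq_zero_iff_of_nonneg (fun y => h0 _) (integrable_torus gc)).1 gi
  by_contra hne
  have hopen : IsOpen ({y : E3 | ∀ i, y i ∈ Ioo (0 : ℝ) 1} ∩ {y | g y ≠ 0}) := by
    refine IsOpen.inter ?_ (isOpen_ne_fun gc continuous_const)
    have : {y : E3 | ∀ i, y i ∈ Ioo (0 : ℝ) 1} = ⋂ i, (fun y : E3 => y i) ⁻¹' Ioo 0 1 := by
      ext; simp
    rw [this]
    exact isOpen_iInter_of_finite fun i => isOpen_Ioo.preimage (by fun_prop)
  have hmem : c ∈ {y : E3 | ∀ i, y i ∈ Ioo (0 : ℝ) 1} ∩ {y | g y ≠ 0} := by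
    refine ⟨fun i => ?_, ?_⟩
    · simp only [hc, one_div, mem_Ioo]
      norm_num
    · simpa [hg] using hne
  have hpos := hopen.measure_pos (volume : Measure E3) ⟨c, hmem⟩
  have hz : torusMeasure {y | g y ≠ 0} = 0 := gae
  rw [torusMeasure, Measure.restrict_apply (isOpen_ne_fun gc continuous_const).measurableSet] at hz
  refine hpos.ne' (measure_mono_null ?_ hz)
  exact fun y hy => ⟨hy.2, fun i => Ioo_subset_Ico_self (hy.1 i)⟩

theorem IsPeriodic3.exists_mem_unitCell {α : Type*} {f : E3 → α} (hf : IsPeriodic3 f) (x : E3) :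
    ∃ y ∈ unitCell, f y = f x := by
  refine ⟨ZSpan.fract (EuclideanSpace.basisFun (Fin 3) ℝ).toBasis x, ?_, ?_⟩
  · rw [unitCell_eq_fundamentalDomain]
    exact ZSpan.fract_mem_fundamentalDomain _ x
  · rw [ZSpan.fract_apply, sub_eq_add_neg]
    exact hf.add_mem_span (neg_mem (SetLike.coe_mem _)) x

/-- Cauchy-Schwarz for the trace in dimension three. It serves for `div v` against `|∇v|²` and for
`Δvⱼ` against the Hessian of `vⱼ`. -/
theorem sq_sum_three_diag_le (G : Fin 3 → Fin 3 → ℝ) : (∑ i, G i i) ^ 2 ≤ 3 * frobSq G := by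
  simp only [frobSq, Fin.sum_univ_three]
  nlinarith [sq_nonneg (G 0 0 - G 1 1), sq_nonneg (G 0 0 - G 2 2), sq_nonneg (G 1 1 - G 2 2),
    sq_nonneg (G 0 1), sq_nonneg (G 0 2), sq_nonneg (G 1 0), sq_nonneg (G 1 2),
    sq_nonneg (G 2 0), sq_nonneg (G 2 1)]

theorem frobSq_nonneg (G : Fin 3 → Fin 3 → ℝ) : 0 ≤ frobSq G :=
  Finset.sum_nonneg fun _ _ => Finset.sum_nonneg fun _ _ => sq_nonneg _

/-- The system solved by the velocity components `v j` and the root temperature `θ` at positive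
times, without reference to initial data. -/
structure ThermalFlow (ν κ γ T : ℝ) (v : Fin 3 → ℝ → E3 → ℝ) (θ : ℝ → E3 → ℝ) : Prop where
  regular_v : ∀ j, IsC21 T (v j)
  regular_θ : IsC21 T θ
  momentum : ∀ t ∈ Set.Ioc 0 T, ∀ x, ∀ j,
    timeDeriv T (v j) t x
      + ∑ i, v i t x * pd i (v j t) x
      + 1 / γ * (v j t x * ∑ i, pd i (v i t) x)
      - ν * ∑ i, pd i (fun y => θ t y * pd i (v j t) y) x = 0
  heat : ∀ t ∈ Set.Ioc 0 T, ∀ x,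
    timeDeriv T (fun s y => θ s y ^ 2) t x
      + ∑ i, pd i (fun y => v i t y * θ t y ^ 2) x
      - κ * ∑ i, pd i (fun y => θ t y * pd i (fun z => θ t z ^ 2) y) x
      = ν * θ t x * frobSq (fun i j => pd i (v j t) x)

theorem IsClassicalSolution.thermalFlow {ν κ γ T : ℝ} {u0 : E3 → E3}
    {G0 : E3 → Fin 3 → Fin 3 → ℝ} {θ0 : E3 → ℝ} {u : ℝ → E3 → E3} {θ : ℝ → E3 → ℝ}
    (h : IsClassicalSolution ν κ γ T u0 G0 θ0 u θ) :
    ThermalFlow ν κ γ T (fun j t x => u t x j) θ :=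
  ⟨h.regular_u, h.regular_θ, h.momentum, h.heat⟩

namespace ThermalFlow

variable {ν κ γ T : ℝ} {v : Fin 3 → ℝ → E3 → ℝ} {θ : ℝ → E3 → ℝ}

theorem timeDeriv_velocity (h : ThermalFlow ν κ γ T v θ) {t : ℝ} (ht : t ∈ Ioc 0 T) (x : E3)
    (j : Fin 3) :
    timeDeriv T (v j) t x
      = ν * (∑ i, θ t x * pd i (pd i (v j t)) x + ∑ i, pd i (θ t) x * pd i (v j t) x)
        - (∑ i, v i t x * pd i (v j t) x + 1 / γ * (v j t x * ∑ i, pd i (v i t) x)) := by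
  have hm := h.momentum t ht x j
  have hθ := (h.regular_θ.contDiff_space t ht).differentiable (by norm_num) x
  have hv : ∀ i, DifferentiableAt ℝ (pd i (v j t)) x := fun i =>
    (((h.regular_v j).contDiff_space t ht).pd (m := 1) (by norm_num) i).differentiable
      (by norm_num) x
  have e : ∀ i, pd i (fun y => θ t y * pd i (v j t) y) x
      = θ t x * pd i (pd i (v j t)) x + pd i (θ t) x * pd i (v j t) x := fun i => by
    rw [pd_mul hθ (hv i)]; ring
  simp only [e, Finset.sum_add_distrib] at hm
  linarith

/-- The heat equation is one for `θ²`; solving it for `∂ₜθ` divides by `2θ`, hence the positivity.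
The division leaves the viscous heating with the constant coefficient `ν/2`. -/
theorem timeDeriv_temperature (h : ThermalFlow ν κ γ T v θ) {t : ℝ} (ht : t ∈ Ioc 0 T) {x : E3}
    (hpos : 0 < θ t x) :
    timeDeriv T θ t x
      = κ * (θ t x * ∑ i, pd i (pd i (θ t)) x + 2 * ∑ i, pd i (θ t) x ^ 2)
        + ν / 2 * frobSq (fun i j => pd i (v j t) x)
        - (∑ i, v i t x * pd i (θ t) x + 1 / 2 * (θ t x * ∑ i, pd i (v i t) x)) := by
  have hh := h.heat t ht x
  have hT : 0 < T := ht.1.trans_le ht.2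
  have hC2 := h.regular_θ.contDiff_space t ht
  have hθ : Differentiable ℝ (θ t) := hC2.differentiable (by norm_num)
  have hθ2 : Differentiable ℝ fun y => θ t y ^ 2 := hθ.pow 2
  have hpd : ∀ i, Differentiable ℝ (pd i (θ t)) := fun i =>
    (hC2.pd (m := 1) (by norm_num) i).differentiable (by norm_num)
  have hv : ∀ i, Differentiable ℝ (v i t) := fun i =>
    ((h.regular_v i).contDiff_space t ht).differentiable (by norm_num)
  have e1 : timeDeriv T (fun s y => θ s y ^ 2) t x = 2 * θ t x * timeDeriv T θ t x := by
    have hd := (h.regular_θ.diff_time t ht x).hasDerivWithinAt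
    have := (hd.pow 2).derivWithin (uniqueDiffOn_Icc hT t ⟨ht.1.le, ht.2⟩)
    simp only [timeDeriv]
    refine Eq.trans this ?_
    simp
  have e2 : ∀ i, pd i (fun y => v i t y * θ t y ^ 2) x
      = θ t x ^ 2 * pd i (v i t) x + 2 * θ t x * (v i t x * pd i (θ t) x) := fun i => by
    rw [pd_mul (hv i x) (hθ2 x), pd_sq (hθ x)]; ring
  have e3 : ∀ i, pd i (fun y => θ t y * pd i (fun z => θ t z ^ 2) y) x
      = 4 * θ t x * pd i (θ t) x ^ 2 + 2 * θ t x ^ 2 * pd i (pd i (θ t)) x := fun i => by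
    have : ∀ y, θ t y * pd i (fun z => θ t z ^ 2) y
        = 2 * (θ t y ^ 2 * pd i (θ t) y) := fun y => by
      rw [pd_sq (hθ y)]; ring
    simp only [this]
    have hprod : DifferentiableAt ℝ (fun y => θ t y ^ 2 * pd i (θ t) y) x :=
      (hθ2 x).mul (hpd i x)
    rw [pd_const_mul hprod, pd_mul (hθ2 x) (hpd i x), pd_sq (hθ x)]
    ring
  simp only [e1, e2, e3, Finset.sum_add_distrib, ← Finset.mul_sum] at hh
  have h2 : 2 * θ t x ≠ 0 := by positivity
  refine mul_left_cancel₀ h2 ?_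
  linear_combination hh

/-- The static form of the minimum principle: the integrand is the time derivative of
`(m(t) - θ)₊³` when `m' = - 3 m² / (8 ν)`. -/
theorem integral_barrier_nonpos (h : ThermalFlow ν κ γ T v θ) (hν : 0 < ν) (hκ : 0 ≤ κ)
    {t : ℝ} (ht : t ∈ Ioc 0 T) (hpos : ∀ x, 0 < θ t x) (m : ℝ) :
    ∫ x, max (m - θ t x) 0 ^ 2 * (-(3 / (8 * ν) * m ^ 2) - timeDeriv T θ t x) ∂torusMeasure
      ≤ 0 := by
  have hC2 := h.regular_θ.contDiff_space t ht
  have hC1 : ContDiff ℝ 1 (θ t) := hC2.of_le (by norm_num)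
  have hθ : Differentiable ℝ (θ t) := hC2.differentiable (by norm_num)
  have hpθ := h.regular_θ.periodic t ht
  have hdC : ∀ i, ContDiff ℝ 1 (pd i (θ t)) := fun i => hC2.pd (by norm_num) i
  have hvC : ∀ i, ContDiff ℝ 1 (v i t) := fun i =>
    ((h.regular_v i).contDiff_space t ht).of_le (by norm_num)
  have hsub : ContDiff ℝ 1 fun x => m - θ t x := contDiff_const.sub hC1
  have hr2 : ContDiff ℝ 1 fun x => max (m - θ t x) 0 ^ 2 := (contDiff_max_zero_pow 0).comp hsub
  have hr3 : ContDiff ℝ 1 fun x => max (m - θ t x) 0 ^ 3 := (contDiff_max_zero_pow 1).comp hsub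
  have pr2 : IsPeriodic3 fun x => max (m - θ t x) 0 ^ 2 := hpθ.comp fun r => max (m - r) 0 ^ 2
  have pr3 : IsPeriodic3 fun x => max (m - θ t x) 0 ^ 3 := hpθ.comp fun r => max (m - r) 0 ^ 3
  have pdm : ∀ i x, pd i (fun x => m - θ t x) x = - pd i (θ t) x := fun i x => by
    rw [pd_sub (by fun_prop) (hθ x)]
    simp [pd]
  have pd2 : ∀ i x, pd i (fun x => max (m - θ t x) 0 ^ 2) x
      = -(2 * max (m - θ t x) 0 * pd i (θ t) x) := fun i x => by
    have h1 := hasDerivAt_max_zero_pow 0 (m - θ t x)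
    rw [pd_comp (φ := fun r => max r 0 ^ 2) (f := fun x => m - θ t x) h1
      (hsub.differentiable (by norm_num) x), pdm]
    simp
  have pd3 : ∀ i x, pd i (fun x => max (m - θ t x) 0 ^ 3) x
      = -(3 * max (m - θ t x) 0 ^ 2 * pd i (θ t) x) := fun i x => by
    have h1 := hasDerivAt_max_zero_pow 1 (m - θ t x)
    rw [pd_comp (φ := fun r => max r 0 ^ 3) (f := fun x => m - θ t x) h1
      (hsub.differentiable (by norm_num) x), pdm]
    push_cast
    ring
  -- With `ρ = (m - θ)₊`, the first flux carries the diffusion and the second the transport, through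
  -- `ρ² v·∇θ = (ρ³ div v - div(ρ³ v)) / 3`.
  set D1 : Fin 3 → E3 → ℝ := fun i y => max (m - θ t y) 0 ^ 2 * (θ t y * pd i (θ t) y) with hD1
  set D2 : Fin 3 → E3 → ℝ := fun i y => max (m - θ t y) 0 ^ 3 * v i t y with hD2
  have C1 : ∀ i, ContDiff ℝ 1 (D1 i) := fun i => hr2.mul (hC1.mul (hdC i))
  have C2 : ∀ i, ContDiff ℝ 1 (D2 i) := fun i => hr3.mul (hvC i)
  have P1 : ∀ i, IsPeriodic3 (D1 i) := fun i => pr2.mul (hpθ.mul (hpθ.pd i))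
  have P2 : ∀ i, IsPeriodic3 (D2 i) := fun i => pr3.mul ((h.regular_v i).periodic t ht)
  have c1 : ∀ i, Continuous (pd i (D1 i)) := fun i => (C1 i).continuous_pd i
  have c2 : ∀ i, Continuous (pd i (D2 i)) := fun i => (C2 i).continuous_pd i
  have e1 : ∀ i x, pd i (D1 i) x = max (m - θ t x) 0 ^ 2 * pd i (θ t) x ^ 2
      + max (m - θ t x) 0 ^ 2 * θ t x * pd i (pd i (θ t)) x
      - 2 * max (m - θ t x) 0 * θ t x * pd i (θ t) x ^ 2 := fun i x => by
    rw [hD1]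
    dsimp only
    rw [pd_mul (g := fun y => θ t y * pd i (θ t) y) (hr2.differentiable (by norm_num) x)
      ((hθ x).mul ((hdC i).differentiable (by norm_num) x)), pd2,
      pd_mul (hθ x) ((hdC i).differentiable (by norm_num) x)]
    ring
  have e2 : ∀ i x, pd i (D2 i) x = max (m - θ t x) 0 ^ 3 * pd i (v i t) x
      - 3 * max (m - θ t x) 0 ^ 2 * (v i t x * pd i (θ t) x) := fun i x => by
    rw [hD2]
    dsimp only
    rw [pd_mul (hr3.differentiable (by norm_num) x) ((hvC i).differentiable (by norm_num) x), pd3]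
    ring
  have ctd : Continuous (timeDeriv T θ t) := h.regular_θ.timeC1.cont_deriv.slice ht
  have cθ := hC1.continuous
  have hle : ∀ x, max (m - θ t x) 0 ^ 2 * (-(3 / (8 * ν) * m ^ 2) - timeDeriv T θ t x)
      ≤ (-κ) * ∑ i, pd i (D1 i) x + (-(1 / 3)) * ∑ i, pd i (D2 i) x := fun x => by
    rw [h.timeDeriv_temperature ht (hpos x)]
    simp only [e1, e2, Finset.sum_add_distrib, Finset.sum_sub_distrib, ← Finset.mul_sum]
    have hd := sq_sum_three_diag_le fun i j => pd i (v j t) x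
    set d := ∑ i, pd i (v i t) x
    set g := frobSq fun i j => pd i (v j t) x
    set q := ∑ i, pd i (θ t) x ^ 2
    have hq : 0 ≤ q := Finset.sum_nonneg fun _ _ => sq_nonneg _
    set L := ∑ i, pd i (pd i (θ t)) x
    set vθ := ∑ i, v i t x * pd i (θ t) x
    have hp := hpos x
    rcases le_or_gt m (θ t x) with hm | hm
    · rw [max_eq_right (by linarith)]
      simp
    rw [max_eq_left (by linarith)]
    set ρ := m - θ t x with hρ
    have hρ0 : 0 < ρ := by linarith
    -- Origin of the barrier equation: since `ρ + θ = m` the factor of `d` is at most `m/2`, the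
    -- heating is at least `ν d²/6`, and the maximum of `m|d|/2 - ν d²/6` over `|d|` is `3m²/(8ν)`.
    have key : (ρ / 3 + θ t x / 2) * d ≤ 3 / (8 * ν) * m ^ 2 + ν / 2 * g := by
      have h1 : (ρ / 3 + θ t x / 2) * d ≤ m / 2 * |d| := by
        refine (mul_le_mul_of_nonneg_left (le_abs_self d) (by positivity)).trans ?_
        exact mul_le_mul_of_nonneg_right (by linarith) (abs_nonneg d)
      have h2 : m / 2 * |d| ≤ 3 / (8 * ν) * m ^ 2 + ν / 6 * |d| ^ 2 := by
        have : 3 / (8 * ν) * m ^ 2 + ν / 6 * |d| ^ 2 - m / 2 * |d|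
            = (1 / (24 * ν)) * (3 * m - 2 * ν * |d|) ^ 2 := by
          field_simp
          ring
        have h3 : 0 ≤ (1 / (24 * ν)) * (3 * m - 2 * ν * |d|) ^ 2 := by positivity
        linarith
      rw [sq_abs] at h2
      nlinarith
    have h3 : 0 ≤ ρ ^ 2 * (3 / (8 * ν) * m ^ 2 + ν / 2 * g - (ρ / 3 + θ t x / 2) * d) :=
      mul_nonneg (sq_nonneg _) (by linarith)
    have h4 : 0 ≤ κ * ρ ^ 2 * q := by positivity
    have h5 : 0 ≤ κ * (ρ * θ t x * q) := by positivity
    nlinarith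
  refine (integral_torus_mono (by fun_prop) (by fun_prop) hle).trans ?_
  rw [integral_torus_add (by fun_prop) (by fun_prop), integral_const_mul, integral_const_mul,
    integral_torus_sum _ fun i _ => c1 i, integral_torus_sum _ fun i _ => c2 i]
  simp [integral_pd_eq_zero (C1 _) (P1 _), integral_pd_eq_zero (C2 _) (P2 _)]

/-- The functional `∫ (m - θ)₊³` is nonincreasing and tends to zero at the initial time. Indeed `m ≤
1 ≤ θ0` gives `(m - θ)₊ ≤ |θ - θ0|`, and since `m - θ ≤ 1` the cube is at most the square, so
attainment of the data in `L²` is enough. -/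
theorem lower_barrier_of_pos (h : ThermalFlow ν κ γ T v θ) (hν : 0 < ν) (hκ : 0 ≤ κ)
    {θ0 : E3 → ℝ} (hθ0 : ∀ᵐ x ∂torusMeasure, 1 ≤ θ0 x) (hmem : MemLp θ0 2 torusMeasure)
    (htend : Tendsto (fun t => ∫ x, (θ t x - θ0 x) ^ 2 ∂torusMeasure) (𝓝[>] 0) (𝓝 0))
    {S : ℝ} (hS0 : 0 < S) (hS : S ≤ T) (hpos : ∀ t ∈ Ioo 0 S, ∀ x, 0 < θ t x) :
    ∀ t ∈ Ioo 0 S, ∀ x, 1 / (1 + 3 / (8 * ν) * t) ≤ θ t x := by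
  set c := 3 / (8 * ν) with hc
  have hc0 : 0 < c := by positivity
  set m : ℝ → ℝ := fun t => 1 / (1 + c * t) with hm
  have hden : ∀ t, 0 < t → 0 < 1 + c * t := fun t ht => by positivity
  have hmd : ∀ t, 0 < t → HasDerivAt m (-(c * m t ^ 2)) t := fun t ht => by
    have h1 : HasDerivAt (fun t => 1 + c * t) c t := by
      simpa using ((hasDerivAt_id t).const_mul c).const_add 1
    have h2 := h1.inv (hden t ht).ne'
    have e : m = (fun t => 1 + c * t)⁻¹ := by
      ext t; simp [hm]
    have e2 : -(c * m t ^ 2) = -c / (1 + c * t) ^ 2 := by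
      simp only [hm]; field_simp
    rw [e2, e]
    exact h2
  have hmc : ContinuousOn m (Ioc 0 T) := fun t ht => (hmd t ht.1).continuousAt.continuousWithinAt
  have hT1 : TimeC1 T (fun t _ => m t) (fun t _ => -(c * m t ^ 2)) :=
    TimeC1.of_time hmc (by fun_prop) fun t ht => hmd t ht.1
  have hJ := (hT1.sub h.regular_θ.timeC1).comp (S := univ)
    (fun r _ => hasDerivAt_max_zero_pow 1 r) (by fun_prop) fun _ _ _ => mem_univ _
  have hJd := fun t (ht : t ∈ Ioo 0 S) => hJ.hasDerivAt_integral ⟨ht.1, ht.2.trans_le hS⟩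
  have hanti := antitoneOn_Ioo_of_hasDerivAt_nonpos hJd fun t ht => by
    have h1 := h.integral_barrier_nonpos hν hκ ⟨ht.1, ht.2.le.trans hS⟩ (hpos t ht) (m t)
    have h2 : ∀ x, (((1 : ℕ) : ℝ) + 2) * max (m t - θ t x) 0 ^ (1 + 1)
        * (-(c * m t ^ 2) - timeDeriv T θ t x)
        = 3 * (max (m t - θ t x) 0 ^ 2 * (-(c * m t ^ 2) - timeDeriv T θ t x)) := fun x => by
      push_cast
      ring
    simp only [h2, integral_const_mul]
    linarith
  have hsmall : Tendsto (fun t => ∫ x, max (m t - θ t x) 0 ^ (1 + 2) ∂torusMeasure) (𝓝[>] 0)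
      (𝓝 0) := by
    refine squeeze_zero' (Eventually.of_forall fun t => ?_) ?_ htend
    · exact integral_nonneg fun x => pow_nonneg (le_max_right _ _) _
    filter_upwards [Ioo_mem_nhdsGT hS0] with t ht
    have htT : t ∈ Ioc 0 T := ⟨ht.1, ht.2.le.trans hS⟩
    refine integral_mono_ae (integrable_torus (hJ.cont.slice htT)) ?_ ?_
    · exact ((memLp_torus (h.regular_θ.timeC1.cont.slice htT) 2).sub hmem).integrable_sq
    · filter_upwards [hθ0] with x hx
      have hp := hpos t ht x
      have hm1 : m t ≤ 1 := by
        rw [hm]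
        dsimp only
        rw [div_le_one (hden t ht.1)]
        have := mul_pos hc0 ht.1
        linarith
      rcases le_total (m t - θ t x) 0 with h0 | h0
      · rw [max_eq_right h0]
        simp
        positivity
      · rw [max_eq_left h0]
        have h3 : (m t - θ t x) ^ (1 + 2) ≤ (m t - θ t x) ^ 2 :=
          pow_le_pow_of_le_one h0 (by linarith) (by norm_num)
        nlinarith
  intro t ht x
  have htT : t ∈ Ioc 0 T := ⟨ht.1, ht.2.le.trans hS⟩
  have hJ0 : ∫ x, max (m t - θ t x) 0 ^ (1 + 2) ∂torusMeasure ≤ 0 := by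
    refine ge_of_tendsto hsmall ?_
    filter_upwards [Ioo_mem_nhdsGT ht.1] with s hs
    exact hanti ⟨hs.1, hs.2.trans ht.2⟩ ht hs.2.le
  have hz := eq_zero_of_integral_torus_eq_zero (hJ.cont.slice htT)
    ((h.regular_θ.periodic t htT).comp fun r => max (m t - r) 0 ^ (1 + 2))
    (fun x => pow_nonneg (le_max_right _ _) _)
    (le_antisymm hJ0 (integral_nonneg fun x => pow_nonneg (le_max_right _ _) _)) x
  have h4 : max (m t - θ t x) 0 = 0 := by simpa using hz
  have h5 := le_max_left (m t - θ t x) 0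
  rw [h4] at h5
  linarith

/-- Positivity at all times comes from a first-time argument. Periodicity and positivity at small
times confine a representative of every bad point to a compact set, so a nonpositive value would
have a first time. The barrier holds before that time and, by continuity, at it, where it
contradicts nonpositivity. -/
theorem minimum_principle (h : ThermalFlow ν κ γ T v θ) (hν : 0 < ν) (hκ : 0 ≤ κ)
    {θ0 : E3 → ℝ} (hθ0 : ∀ᵐ x ∂torusMeasure, 1 ≤ θ0 x) (hmem : MemLp θ0 2 torusMeasure)
    (htend : Tendsto (fun t => ∫ x, (θ t x - θ0 x) ^ 2 ∂torusMeasure) (𝓝[>] 0) (𝓝 0))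
    (hpos : ∀ᶠ t in 𝓝[>] (0 : ℝ), ∀ x, 0 < θ t x) :
    ∀ t ∈ Ioc 0 T, ∀ x, 1 / (1 + 3 / (8 * ν) * t) ≤ θ t x := by
  have hext : ∀ S, 0 < S → S ≤ T → (∀ t ∈ Ioo 0 S, ∀ x, 0 < θ t x) →
      ∀ x, 1 / (1 + 3 / (8 * ν) * S) ≤ θ S x := fun S hS0 hS hp x => by
    have hlow := h.lower_barrier_of_pos hν hκ hθ0 hmem htend hS0 hS hp
    have hc1 : Tendsto (fun t => θ t x) (𝓝[<] S) (𝓝 (θ S x)) := by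
      have h1 := h.regular_θ.timeC1.cont.time_slice x S ⟨hS0, hS⟩
      refine h1.tendsto.mono_left ?_
      rw [← nhdsWithin_Ioo_eq_nhdsLT hS0]
      exact nhdsWithin_mono _ fun r hr => ⟨hr.1, hr.2.le.trans hS⟩
    have hne : 1 + 3 / (8 * ν) * S ≠ 0 := by positivity
    have hc2 : Tendsto (fun t => 1 / (1 + 3 / (8 * ν) * t)) (𝓝[<] S)
        (𝓝 (1 / (1 + 3 / (8 * ν) * S))) := by
      have : ContinuousAt (fun t => 1 / (1 + 3 / (8 * ν) * t)) S := by fun_prop (disch := exact hne)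
      exact this.tendsto.mono_left nhdsWithin_le_nhds
    refine le_of_tendsto_of_tendsto hc2 hc1 ?_
    filter_upwards [Ioo_mem_nhdsLT hS0] with t ht using hlow t ht x
  have hall : ∀ t ∈ Ioc 0 T, ∀ x, 0 < θ t x := by
    by_contra! hbad
    obtain ⟨t1, ht1, x1, hx1⟩ := hbad
    obtain ⟨δ, hδ, hδpos⟩ := mem_nhdsGT_iff_exists_Ioo_subset.1 hpos
    have hδ : 0 < δ := hδ
    set t0 := min (δ / 2) (T / 2) with ht0
    have hT : 0 < T := ht1.1.trans_le ht1.2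
    have ht00 : 0 < t0 := lt_min (by linarith) (by linarith)
    set B : Set (ℝ × E3) := (Icc t0 T ×ˢ Metric.closedBall (0 : E3) 2)
      ∩ (fun p : ℝ × E3 => θ p.1 p.2) ⁻¹' Iic 0 with hB
    have hBc : IsCompact B := by
      have hK : IsCompact (Icc t0 T ×ˢ Metric.closedBall (0 : E3) 2) :=
        isCompact_Icc.prod (isCompact_closedBall _ _)
      have hcon : ContinuousOn (fun p : ℝ × E3 => θ p.1 p.2)
          (Icc t0 T ×ˢ Metric.closedBall (0 : E3) 2) :=
        ContinuousOn.mono h.regular_θ.timeC1.cont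
          (prod_mono (fun r hr => ⟨ht00.trans_le hr.1, hr.2⟩) (subset_univ _))
      exact hK.of_isClosed_subset (hcon.preimage_isClosed_of_isClosed hK.isClosed isClosed_Iic)
        inter_subset_left
    have hmemB : ∀ t ∈ Ioc 0 T, ∀ x, θ t x ≤ 0 → ∃ y, (t, y) ∈ B := fun t ht x hx => by
      obtain ⟨y, hy, hyx⟩ := (h.regular_θ.periodic t ht).exists_mem_unitCell x
      refine ⟨y, ⟨⟨?_, ht.2⟩, by simpa using norm_le_two_of_mem_unitCell hy⟩, ?_⟩
      · by_contra! hlt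
        have : t ∈ Ioo 0 δ := ⟨ht.1, hlt.trans ((min_le_left _ _).trans_lt (by linarith))⟩
        exact absurd (hδpos this x) (not_lt.2 hx)
      · simpa [hyx] using hx
    obtain ⟨y1, hy1⟩ := hmemB t1 ht1 x1 hx1
    obtain ⟨s, ⟨⟨s', y⟩, hsB, rfl⟩, hsmin⟩ :=
      (hBc.image continuous_fst).exists_isLeast ⟨t1, (t1, y1), hy1, rfl⟩
    have hs : s' ∈ Ioc 0 T := ⟨ht00.trans_le hsB.1.1.1, hsB.1.1.2⟩
    have hle : θ s' y ≤ 0 := hsB.2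
    have hlow := hext s' hs.1 hs.2 (fun t ht x => by
      by_contra! hle'
      obtain ⟨z, hz⟩ := hmemB t ⟨ht.1, ht.2.le.trans hs.2⟩ x hle'
      exact absurd (hsmin ⟨(t, z), hz, rfl⟩) (not_le.2 ht.2)) y
    have hp : 0 < 1 / (1 + 3 / (8 * ν) * s') := by
      have := hs.1
      positivity
    linarith
  exact fun t ht x => hext t ht.1 ht.2 (fun s hs x => hall s ⟨hs.1, hs.2.le.trans ht.2⟩ x) x

end ThermalFlow

/-! ### Mean-square convergence and the Sobolev inequality on the torus -/

theorem tendsto_integral_sq_of_tendsto_eLpNorm {ι : Type*} {l : Filter ι} {f : ι → E3 → ℝ}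
    (hf : ∀ᶠ t in l, MemLp (f t) 2 torusMeasure)
    (h : Tendsto (fun t => eLpNorm (f t) 2 torusMeasure) l (𝓝 0)) :
    Tendsto (fun t => ∫ x, f t x ^ 2 ∂torusMeasure) l (𝓝 0) := by
  have h1 : Tendsto (fun t => (eLpNorm (f t) 2 torusMeasure).toReal ^ 2) l (𝓝 0) := by
    have := ((ENNReal.tendsto_toReal ENNReal.zero_ne_top).comp h).pow 2
    simpa using this
  refine h1.congr' ?_
  filter_upwards [hf] with t ht
  have h2 := ht.eLpNorm_eq_integral_rpow_norm (by norm_num) (by norm_num)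
  have h3 : 0 ≤ ∫ x, f t x ^ 2 ∂torusMeasure := integral_nonneg fun x => sq_nonneg _
  rw [h2]
  simp only [ENNReal.toReal_ofNat, Real.rpow_ofNat, Real.norm_eq_abs, sq_abs]
  rw [ENNReal.toReal_ofReal (by positivity), ← Real.rpow_natCast, ← Real.rpow_mul h3]
  norm_num

theorem setLIntegral_translate_unitCell {f : E3 → ENNReal} (hf : IsPeriodic3 f) {z : E3}
    (hz : z ∈ Submodule.span ℤ (Set.range (EuclideanSpace.basisFun (Fin 3) ℝ).toBasis)) :
    ∫⁻ x in (fun x => x + z) '' unitCell, f x = ∫⁻ x, f x ∂torusMeasure := by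
  rw [torusMeasure, ← (measurePreserving_add_right (volume : Measure E3)
    z).setLIntegral_comp_emb (measurableEmbedding_addRight z) f unitCell]
  simp only [hf.add_mem_span hz]

/-- The ball lies in `[-4,4)³`, which consists of `8³ = 512` integer translates of the cell. -/
theorem setLIntegral_closedBall_le {f : E3 → ENNReal} (hf : IsPeriodic3 f) :
    ∫⁻ x in Metric.closedBall (0 : E3) 3, f x ≤ 512 * ∫⁻ x, f x ∂torusMeasure := by
  set z : (Fin 3 → Fin 8) → E3 := fun k => ∑ i, ((k i : ℤ) - 4) • EuclideanSpace.single i (1 : ℝ)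
    with hz
  have hzi : ∀ k i, z k i = ((k i : ℕ) : ℝ) - 4 := fun k i => by
    simp only [hz, Fin.sum_univ_three]
    fin_cases i <;> simp
  have hzmem : ∀ k, z k ∈ Submodule.span ℤ
      (Set.range (EuclideanSpace.basisFun (Fin 3) ℝ).toBasis) := fun k => by
    refine Submodule.sum_mem _ fun i _ => Submodule.smul_mem _ _ (Submodule.subset_span ⟨i, ?_⟩)
    simp
  have hcover : Metric.closedBall (0 : E3) 3 ⊆ ⋃ k, (fun x => x + z k) '' unitCell := by
    intro x hx
    have hx3 : ∀ i, |x i| ≤ 3 := fun i => by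
      have := (EuclideanSpace.norm_eq x ▸ Real.abs_le_sqrt (x := x i) (y := ∑ i, ‖x i‖ ^ 2) (by
        simp only [Real.norm_eq_abs, sq_abs]
        exact Finset.single_le_sum (f := fun i => x i ^ 2) (fun _ _ => sq_nonneg _)
          (Finset.mem_univ i)) : |x i| ≤ ‖x‖)
      exact this.trans (by simpa using hx)
    have hfl : ∀ i, -3 ≤ ⌊x i⌋ ∧ ⌊x i⌋ ≤ 3 := fun i => by
      have := abs_le.1 (hx3 i)
      refine ⟨Int.le_floor.2 (by push_cast; linarith), ?_⟩
      have h2 : (⌊x i⌋ : ℝ) ≤ ((3 : ℤ) : ℝ) := by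
        push_cast
        exact (Int.floor_le (x i)).trans this.2
      exact Int.cast_le.1 h2
    have hk : ∀ i, ∃ k : Fin 8, ((k : ℕ) : ℤ) = ⌊x i⌋ + 4 := fun i => by
      have := hfl i
      refine ⟨⟨(⌊x i⌋ + 4).toNat, by omega⟩, ?_⟩
      simp only
      omega
    choose k hk using hk
    refine mem_iUnion.2 ⟨k, x - z k, fun i => ?_, by simp⟩
    have h1 : ((k i : ℕ) : ℝ) = ⌊x i⌋ + 4 := by exact_mod_cast hk i
    have : (x - z k) i = Int.fract (x i) := by
      rw [PiLp.sub_apply, hzi, h1, Int.fract]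
      ring
    rw [this]
    exact ⟨Int.fract_nonneg _, Int.fract_lt_one _⟩
  refine (lintegral_mono_set hcover).trans ((lintegral_iUnion_le _ _).trans ?_)
  simp only [setLIntegral_translate_unitCell hf (hzmem _)]
  rw [tsum_fintype]
  simp

theorem norm_sq_le_sum_sq (L : E3 →L[ℝ] ℝ) :
    ‖L‖ ^ 2 ≤ ∑ i, L (EuclideanSpace.single i 1) ^ 2 := by
  have h : ‖L‖ ≤ √(∑ i, L (EuclideanSpace.single i 1) ^ 2) := by
    refine L.opNorm_le_bound (Real.sqrt_nonneg _) fun x => ?_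
    have hx : L x = ∑ i, x i * L (EuclideanSpace.single i 1) := by
      conv_lhs => rw [← (EuclideanSpace.basisFun (Fin 3) ℝ).sum_repr x]
      simp
    rw [hx, EuclideanSpace.norm_eq, mul_comm, ← Real.sqrt_mul' _ (by positivity)]
    refine Real.abs_le_sqrt ?_
    simp only [Real.norm_eq_abs, sq_abs]
    exact Finset.sum_mul_sq_le_sq_mul_sq _ _ _
  calc _ ≤ √(∑ i, L (EuclideanSpace.single i 1) ^ 2) ^ 2 := by gcongr
    _ = _ := Real.sq_sqrt (by positivity)

theorem norm_fderiv_sq_le_gradSq (f : E3 → ℝ) (x : E3) : ‖fderiv ℝ f x‖ ^ 2 ≤ gradSq f x :=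
  norm_sq_le_sum_sq _

theorem ContDiff.continuous_gradSq {f : E3 → ℝ} (hf : ContDiff ℝ 1 f) : Continuous (gradSq f) := by
  have := hf.continuous_pd
  unfold gradSq
  fun_prop

theorem IsPeriodic3.gradSq {f : E3 → ℝ} (hf : IsPeriodic3 f) : IsPeriodic3 (gradSq f) :=
  IsPeriodic3.sum (f := fun i x => _root_.pd i f x ^ 2) fun i _ => (hf.pd i).comp fun r => r ^ 2

theorem gradSq_nonneg (f : E3 → ℝ) (x : E3) : 0 ≤ gradSq f x :=
  Finset.sum_nonneg fun _ _ => sq_nonneg _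

/-- The Sobolev inequality `‖f‖₆² ≤ C ‖f‖²_{H¹}` on the torus. -/
theorem exists_sobolev_torus : ∃ C : ℝ, 0 < C ∧ ∀ f : E3 → ℝ, ContDiff ℝ 1 f → IsPeriodic3 f →
    ∫ x, f x ^ 6 ∂torusMeasure
      ≤ (C * (∫ x, gradSq f x ∂torusMeasure + ∫ x, f x ^ 2 ∂torusMeasure)) ^ 3 := by
  -- The cutoff is one on the ball of radius 2, which contains the cell, and is supported in the
  -- ball of radius 3. The whole-space Gagliardo-Nirenberg-Sobolev inequality is applied to `χ f`,
  -- and periodicity brings the gradient integral back to one cell.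
  let χ : ContDiffBump (0 : E3) := ⟨2, 3, by norm_num, by norm_num⟩
  have χC : ContDiff ℝ 1 χ := χ.contDiff
  obtain ⟨B, hB⟩ := (isCompact_closedBall (0 : E3) 3).exists_bound_of_continuousOn
    (χC.continuous_fderiv (by norm_num)).continuousOn
  set C0 := SNormLESNormFDerivOfEqConst ℝ (volume : Measure E3) 2 with hC0
  refine ⟨(C0 : ℝ) ^ 2 * (512 * (2 + 2 * B ^ 2)) + 1, by positivity, fun f hf hp => ?_⟩
  set S := ∫ x, gradSq f x ∂torusMeasure + ∫ x, f x ^ 2 ∂torusMeasure with hS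
  have hfc := hf.continuous
  have hgc := hf.continuous_gradSq
  have hS0 : 0 ≤ S := add_nonneg (integral_nonneg fun x => gradSq_nonneg f x)
    (integral_nonneg fun x => sq_nonneg _)
  have hA0 : 0 ≤ 2 + 2 * B ^ 2 := by positivity
  set w : E3 → ℝ := fun x => χ x * f x with hw
  have wC : ContDiff ℝ 1 w := χC.mul hf
  have wS : HasCompactSupport w := χ.hasCompactSupport.mul_right
  have gns := eLpNorm_le_eLpNorm_fderiv_of_eq (volume : Measure E3) wC wS (p := 2) (p' := 6)
    (by norm_num) (by simp) (by simp; norm_num)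
  rw [eLpNorm_eq_lintegral_rpow_enorm_toReal (by norm_num) (by norm_num),
    eLpNorm_eq_lintegral_rpow_enorm_toReal (by norm_num) (by norm_num)] at gns
  have h1 : ∫⁻ x, ENNReal.ofReal (f x ^ 6) ∂torusMeasure ≤ ∫⁻ x, ‖w x‖ₑ ^ (6 : ℝ) := by
    rw [torusMeasure]
    refine (setLIntegral_mono' measurableSet_unitCell fun x hx => ?_).trans
      (setLIntegral_le_lintegral unitCell _)
    have : χ x = 1 := χ.one_of_mem_closedBall (by simpa using norm_le_two_of_mem_unitCell hx)
    rw [hw]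
    dsimp only
    rw [this, one_mul, Real.enorm_eq_ofReal_abs,
      ENNReal.ofReal_rpow_of_nonneg (abs_nonneg _) (by norm_num)]
    refine ENNReal.ofReal_le_ofReal (le_of_eq ?_)
    rw [show (6 : ℝ) = ((6 : ℕ) : ℝ) by norm_num, Real.rpow_natCast, ← abs_pow,
      abs_of_nonneg (by positivity)]
  have hD : ∀ x, ‖fderiv ℝ w x‖ₑ ^ (2 : ℝ) ≤ (Metric.closedBall (0 : E3) 3).indicator
      (fun x => ENNReal.ofReal ((2 + 2 * B ^ 2) * (gradSq f x + f x ^ 2))) x := fun x => by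
    by_cases hx : x ∈ Metric.closedBall (0 : E3) 3
    · rw [indicator_of_mem hx, ← ofReal_norm,
        ENNReal.ofReal_rpow_of_nonneg (norm_nonneg _) (by norm_num)]
      refine ENNReal.ofReal_le_ofReal ?_
      rw [Real.rpow_two]
      have hd : fderiv ℝ w x = χ x • fderiv ℝ f x + f x • fderiv ℝ χ x :=
        fderiv_fun_mul (χC.differentiable (by norm_num) x) (hf.differentiable (by norm_num) x)
      have hn : ‖fderiv ℝ w x‖ ≤ ‖fderiv ℝ f x‖ + |f x| * B := by
        rw [hd]
        refine (norm_add_le _ _).trans (add_le_add ?_ ?_)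
        · rw [norm_smul, Real.norm_eq_abs, abs_of_nonneg χ.nonneg]
          exact mul_le_of_le_one_left (norm_nonneg _) χ.le_one
        · rw [norm_smul, Real.norm_eq_abs]
          exact mul_le_mul_of_nonneg_left (hB x hx) (abs_nonneg _)
      have hg := norm_fderiv_sq_le_gradSq f x
      have hsq := sq_abs (f x)
      have h3 : ‖fderiv ℝ w x‖ ^ 2 ≤ (‖fderiv ℝ f x‖ + |f x| * B) ^ 2 := by gcongr
      have h4 : (‖fderiv ℝ f x‖ + |f x| * B) ^ 2
          ≤ 2 * ‖fderiv ℝ f x‖ ^ 2 + 2 * (|f x| ^ 2 * B ^ 2) := by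
        nlinarith [sq_nonneg (‖fderiv ℝ f x‖ - |f x| * B)]
      rw [hsq] at h4
      have h5 : 0 ≤ B ^ 2 * gradSq f x := mul_nonneg (sq_nonneg _) (gradSq_nonneg _ _)
      nlinarith [sq_nonneg (f x)]
    · rw [indicator_of_notMem hx]
      have hz : fderiv ℝ w x = 0 := by
        refine image_eq_zero_of_notMem_tsupport fun hmem => hx ?_
        have h6 := tsupport_fderiv_subset ℝ hmem
        have h7 : tsupport w ⊆ tsupport χ := closure_mono fun y hy => by
          simp only [hw, Function.mem_support] at hy ⊢
          exact left_ne_zero_of_mul hy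
        have h8 := h7 h6
        rwa [χ.tsupport_eq] at h8
      have hn0 : ‖fderiv ℝ w x‖ = 0 := by
        rw [hz]
        exact norm_zero
      rw [← ofReal_norm, hn0, ENNReal.ofReal_zero, ENNReal.zero_rpow_of_pos (by norm_num)]
  have h2 : ∫⁻ x, ‖fderiv ℝ w x‖ₑ ^ (2 : ℝ)
      ≤ ENNReal.ofReal (512 * (2 + 2 * B ^ 2) * S) := by
    refine (lintegral_mono hD).trans ?_
    rw [lintegral_indicator Metric.isClosed_closedBall.measurableSet]
    refine (setLIntegral_closedBall_le ?_).trans (le_of_eq ?_)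
    · exact (hp.gradSq.add (hp.comp fun r => r ^ 2)).comp
        fun r => ENNReal.ofReal ((2 + 2 * B ^ 2) * r)
    · rw [← ofReal_integral_eq_lintegral_ofReal (integrable_torus (by fun_prop))
        (Eventually.of_forall fun x => mul_nonneg hA0
          (add_nonneg (gradSq_nonneg f x) (sq_nonneg _))), integral_const_mul,
        integral_torus_add hgc (by fun_prop), ← hS, mul_assoc 512,
        ENNReal.ofReal_mul (by norm_num : (0 : ℝ) ≤ 512), ENNReal.ofReal_ofNat]
  have h3 : ∫⁻ x, ‖w x‖ₑ ^ (6 : ℝ) ≤ (C0 : ENNReal) ^ 6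
      * (ENNReal.ofReal (512 * (2 + 2 * B ^ 2) * S)) ^ 3 := by
    have h4 : (∫⁻ x, ‖w x‖ₑ ^ (6 : ℝ)) ^ (1 / (6 : ℝ))
        ≤ C0 * (ENNReal.ofReal (512 * (2 + 2 * B ^ 2) * S)) ^ (1 / (2 : ℝ)) := by
      refine le_trans (by simpa using gns) ?_
      gcongr
      simpa using ENNReal.rpow_le_rpow h2 (by norm_num : (0 : ℝ) ≤ 1 / 2)
    have h5 := ENNReal.rpow_le_rpow h4 (by norm_num : (0 : ℝ) ≤ 6)
    rw [← ENNReal.rpow_mul, ENNReal.mul_rpow_of_nonneg _ _ (by norm_num), ← ENNReal.rpow_mul] at h5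
    rw [show 1 / (6 : ℝ) * 6 = 1 by norm_num, ENNReal.rpow_one,
      show 1 / (2 : ℝ) * 6 = ((3 : ℕ) : ℝ) by norm_num, ENNReal.rpow_natCast,
      show (6 : ℝ) = ((6 : ℕ) : ℝ) by norm_num, ENNReal.rpow_natCast] at h5
    exact h5
  have h6 := h1.trans h3
  rw [← ofReal_integral_eq_lintegral_ofReal (integrable_torus (by fun_prop))
    (Eventually.of_forall fun x => by positivity), ← ENNReal.ofReal_pow (by positivity),
    ← ENNReal.ofReal_coe_nnreal, ← ENNReal.ofReal_pow (by positivity),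
    ← ENNReal.ofReal_mul (by positivity),
    ENNReal.ofReal_le_ofReal_iff (by positivity)] at h6
  refine h6.trans ?_
  have e : (C0 : ℝ) ^ 6 * (512 * (2 + 2 * B ^ 2) * S) ^ 3
      = ((C0 : ℝ) ^ 2 * (512 * (2 + 2 * B ^ 2)) * S) ^ 3 := by ring
  rw [e]
  gcongr
  linarith

/-- Hölder with exponents `3/2` and `3` bounds the left side by `‖k‖₃² ‖f‖₆²`; the Sobolev
inequality bounds the second factor. -/
theorem integral_sq_mul_sq_le {C : ℝ} (hC : ∀ f : E3 → ℝ, ContDiff ℝ 1 f → IsPeriodic3 f →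
    ∫ x, f x ^ 6 ∂torusMeasure
      ≤ (C * (∫ x, gradSq f x ∂torusMeasure + ∫ x, f x ^ 2 ∂torusMeasure)) ^ 3) (hC0 : 0 < C)
    {k f : E3 → ℝ} (hk : Continuous k) (hk0 : ∀ x, 0 ≤ k x) (hf : ContDiff ℝ 1 f)
    (hp : IsPeriodic3 f) {R : ℝ} (hR : 0 ≤ R) (hkR : ∫ x, k x ^ 3 ∂torusMeasure ≤ R ^ 3) :
    ∫ x, k x ^ 2 * f x ^ 2 ∂torusMeasure
      ≤ R ^ 2 * (C * (∫ x, gradSq f x ∂torusMeasure + ∫ x, f x ^ 2 ∂torusMeasure)) := by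
  set S := ∫ x, gradSq f x ∂torusMeasure + ∫ x, f x ^ 2 ∂torusMeasure with hS
  have hS0 : 0 ≤ S := add_nonneg (integral_nonneg fun x => gradSq_nonneg f x)
    (integral_nonneg fun x => sq_nonneg _)
  have hfc := hf.continuous
  have hh := integral_mul_le_Lp_mul_Lq_of_nonneg (μ := torusMeasure)
    (p := 3 / 2) (q := 3) ⟨by norm_num, by norm_num, by norm_num⟩
    (f := fun x => k x ^ 2) (g := fun x => f x ^ 2)
    (Eventually.of_forall fun x => sq_nonneg _) (Eventually.of_forall fun x => sq_nonneg _)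
    (memLp_torus (by fun_prop) _) (memLp_torus (by fun_prop) _)
  have e1 : ∀ x, (k x ^ 2) ^ (3 / 2 : ℝ) = k x ^ 3 := fun x => by
    rw [← Real.rpow_natCast, ← Real.rpow_mul (hk0 x), ← Real.rpow_natCast]
    norm_num
  have e2 : ∀ x, (f x ^ 2) ^ (3 : ℝ) = f x ^ 6 := fun x => by
    rw [show (3 : ℝ) = ((3 : ℕ) : ℝ) by norm_num, Real.rpow_natCast]
    ring
  simp only [e1, e2] at hh
  refine hh.trans ?_
  have h3 : ∀ a b : ℝ, 0 ≤ a → 0 ≤ b → a ≤ b ^ 3 → a ^ (1 / 3 : ℝ) ≤ b := fun a b ha hb hab => by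
    calc a ^ (1 / 3 : ℝ) ≤ (b ^ 3) ^ (1 / 3 : ℝ) := Real.rpow_le_rpow ha hab (by norm_num)
      _ = b := by
        rw [← Real.rpow_natCast, ← Real.rpow_mul hb]
        norm_num
  have hk3 : 0 ≤ ∫ x, k x ^ 3 ∂torusMeasure := integral_nonneg fun x => pow_nonneg (hk0 x) 3
  have hf6 : 0 ≤ ∫ x, f x ^ 6 ∂torusMeasure :=
    integral_nonneg fun x => (by positivity : 0 ≤ f x ^ 6)
  have e3 : (∫ x, k x ^ 3 ∂torusMeasure) ^ (1 / (3 / 2) : ℝ)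
      = ((∫ x, k x ^ 3 ∂torusMeasure) ^ (1 / 3 : ℝ)) ^ 2 := by
    rw [← Real.rpow_natCast, ← Real.rpow_mul hk3]
    norm_num
  rw [e3]
  have h4 := h3 _ _ hk3 hR hkR
  have h5 := h3 _ _ hf6 (by positivity) (hC f hf hp)
  gcongr

/-! ### Convex entropies of the speed -/

theorem contDiff_one_comp {φ φ' : ℝ → ℝ} {S : Set ℝ} (hS : IsOpen S)
    (hφ : ∀ r ∈ S, HasDerivAt φ (φ' r) r) (hφ' : ContinuousOn φ' S) {f : E3 → ℝ}
    (hf : ContDiff ℝ 1 f) (hfS : ∀ x, f x ∈ S) : ContDiff ℝ 1 fun x => φ (f x) := by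
  have h1 : ContDiffOn ℝ 1 φ S := by
    rw [show (1 : WithTop ℕ∞) = 0 + 1 by norm_num, contDiffOn_succ_iff_deriv_of_isOpen hS]
    refine ⟨fun r hr => (hφ r hr).differentiableAt.differentiableWithinAt, by simp, ?_⟩
    rw [contDiffOn_zero]
    exact hφ'.congr fun r hr => (hφ r hr).deriv
  exact h1.comp_contDiff hf hfS

/-- `1 + |v|²`. -/
def speedWeight (v : Fin 3 → ℝ → E3 → ℝ) (t : ℝ) (x : E3) : ℝ := 1 + ∑ j, v j t x ^ 2

/-- `|∇v|²`. -/
noncomputable def velGradSq (v : Fin 3 → ℝ → E3 → ℝ) (t : ℝ) (x : E3) : ℝ :=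
  frobSq fun i j => pd i (v j t) x

/-- `div v`. -/
noncomputable def velDiv (v : Fin 3 → ℝ → E3 → ℝ) (t : ℝ) (x : E3) : ℝ := ∑ i, pd i (v i t) x

theorem one_le_speedWeight (v : Fin 3 → ℝ → E3 → ℝ) (t : ℝ) (x : E3) : 1 ≤ speedWeight v t x :=
  le_add_of_nonneg_right (Finset.sum_nonneg fun _ _ => sq_nonneg _)

theorem velGradSq_nonneg (v : Fin 3 → ℝ → E3 → ℝ) (t : ℝ) (x : E3) : 0 ≤ velGradSq v t x :=
  frobSq_nonneg _

theorem velDiv_sq_le (v : Fin 3 → ℝ → E3 → ℝ) (t : ℝ) (x : E3) :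
    velDiv v t x ^ 2 ≤ 3 * velGradSq v t x :=
  sq_sum_three_diag_le fun i j => pd i (v j t) x

theorem IsC21.jointCont_pd {T : ℝ} {f : ℝ → E3 → ℝ} (hf : IsC21 T f) (i : Fin 3) :
    JointCont T fun t => pd i (f t) := hf.cont_pd i

theorem IsC21.jointCont_pd_pd {T : ℝ} {f : ℝ → E3 → ℝ} (hf : IsC21 T f) (i k : Fin 3) :
    JointCont T fun t => pd i (pd k (f t)) := hf.cont_pd_pd i k

namespace ThermalFlow

variable {ν κ γ T : ℝ} {v : Fin 3 → ℝ → E3 → ℝ} {θ : ℝ → E3 → ℝ}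

theorem jointCont_velGradSq (h : ThermalFlow ν κ γ T v θ) : JointCont T (velGradSq v) :=
  JointCont.sum (s := .univ) fun i _ => JointCont.sum (s := .univ) fun j _ =>
    ((h.regular_v j).jointCont_pd i).pow 2

theorem jointCont_velDiv (h : ThermalFlow ν κ γ T v θ) : JointCont T (velDiv v) :=
  .sum fun i _ => (h.regular_v i).jointCont_pd i

theorem timeC1_speedWeight (h : ThermalFlow ν κ γ T v θ) :
    TimeC1 T (speedWeight v) (fun t x => ∑ j, 2 * v j t x * timeDeriv T (v j) t x) := by
  have h1 := fun j => (h.regular_v j).timeC1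
  refine ⟨(JointCont.const 1).add (.sum fun j _ => (h1 j).cont.pow 2),
    .sum fun j _ => ((JointCont.const 2).mul (h1 j).cont).mul (h1 j).cont_deriv,
    fun t ht x => ?_⟩
  refine HasDerivAt.const_add 1 (HasDerivAt.fun_sum fun j _ => ?_)
  have := ((h1 j).hasDerivAt t ht x).fun_pow 2
  simp only [Nat.cast_ofNat, Nat.add_one_sub_one, pow_one] at this
  exact this

theorem contDiff_velocity (h : ThermalFlow ν κ γ T v θ) {t : ℝ} (ht : t ∈ Ioc 0 T) (j : Fin 3) :
    ContDiff ℝ 2 (v j t) := (h.regular_v j).contDiff_space t ht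

theorem contDiff_speedWeight (h : ThermalFlow ν κ γ T v θ) {t : ℝ} (ht : t ∈ Ioc 0 T) :
    ContDiff ℝ 2 (speedWeight v t) :=
  contDiff_const.add (ContDiff.sum fun j _ => (h.contDiff_velocity ht j).pow 2)

theorem periodic_speedWeight (h : ThermalFlow ν κ γ T v θ) {t : ℝ} (ht : t ∈ Ioc 0 T) :
    IsPeriodic3 (speedWeight v t) := fun x i => by
  simp only [speedWeight, (h.regular_v _).periodic t ht x i]

theorem pd_speedWeight (h : ThermalFlow ν κ γ T v θ) {t : ℝ} (ht : t ∈ Ioc 0 T) (i : Fin 3)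
    (x : E3) : pd i (speedWeight v t) x = 2 * ∑ j, v j t x * pd i (v j t) x := by
  have hd := fun j => (h.contDiff_velocity ht j).differentiable (by norm_num)
  have hd2 : ∀ j, DifferentiableAt ℝ (fun y => v j t y ^ 2) x := fun j => (hd j x).pow 2
  have e : speedWeight v t = fun y => 1 + ∑ j, v j t y ^ 2 := rfl
  rw [e, pd_add (f := fun _ => 1) (by fun_prop) (DifferentiableAt.fun_sum fun j _ => hd2 j),
    pd_sum _ fun j _ => hd2 j]
  simp only [pd_sq (hd _ x), Finset.mul_sum]
  simp [pd, mul_assoc]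

theorem gradSq_speedWeight_le (h : ThermalFlow ν κ γ T v θ) {t : ℝ} (ht : t ∈ Ioc 0 T) (x : E3) :
    gradSq (speedWeight v t) x ≤ 4 * speedWeight v t x * velGradSq v t x := by
  have h1 : ∀ i, pd i (speedWeight v t) x ^ 2
      ≤ 4 * speedWeight v t x * ∑ j, pd i (v j t) x ^ 2 := fun i => by
    rw [h.pd_speedWeight ht]
    have h2 := Finset.sum_mul_sq_le_sq_mul_sq Finset.univ (fun j => v j t x)
      (fun j => pd i (v j t) x)
    have h3 : ∑ j, v j t x ^ 2 ≤ speedWeight v t x := le_add_of_nonneg_left zero_le_one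
    have h4 : 0 ≤ ∑ j, pd i (v j t) x ^ 2 := Finset.sum_nonneg fun _ _ => sq_nonneg _
    nlinarith [mul_le_mul_of_nonneg_right h3 h4]
  refine (Finset.sum_le_sum fun i _ => h1 i).trans (le_of_eq ?_)
  rw [← Finset.mul_sum]
  rfl

/-- The entropy inequality for a convex function `Ψ` of `1 + |v|²`, with `X = Ψ'`. -/
theorem integral_entropy_rate_le (h : ThermalFlow ν κ γ T v θ) (hν : 0 < ν) {t : ℝ}
    (ht : t ∈ Ioc 0 T) (hpos : ∀ x, 0 < θ t x) {Ψ X X1 : ℝ → ℝ}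
    (hΨ : ∀ r ∈ Ioi (0 : ℝ), HasDerivAt Ψ (X r) r) (hX : ∀ r ∈ Ioi (0 : ℝ), HasDerivAt X (X1 r) r)
    (hX1c : ContinuousOn X1 (Ioi 0)) (hX1 : ∀ r ∈ Ioi (0 : ℝ), 0 ≤ X1 r) :
    ∫ x, X (speedWeight v t x) * ∑ j, 2 * v j t x * timeDeriv T (v j) t x ∂torusMeasure
      ≤ ∫ x, ((Ψ (speedWeight v t x)
          - 2 / γ * ((speedWeight v t x - 1) * X (speedWeight v t x))) * velDiv v t x
        - 2 * ν * (θ t x * X (speedWeight v t x) * velGradSq v t x)) ∂torusMeasure := by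
  set W := speedWeight v t with hW
  have hWpos : ∀ x, W x ∈ Ioi (0 : ℝ) := fun x => zero_lt_one.trans_le (one_le_speedWeight v t x)
  have WC : ContDiff ℝ 1 W := (h.contDiff_speedWeight ht).of_le (by norm_num)
  have Wp := h.periodic_speedWeight ht
  have Wd : Differentiable ℝ W := WC.differentiable (by norm_num)
  have hXc : ContinuousOn X (Ioi 0) := fun r hr => (hX r hr).continuousAt.continuousWithinAt
  have ΨC : ContDiff ℝ 1 fun x => Ψ (W x) := contDiff_one_comp isOpen_Ioi hΨ hXc WC hWpos
  have XC : ContDiff ℝ 1 fun x => X (W x) := contDiff_one_comp isOpen_Ioi hX hX1c WC hWpos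
  have hθC2 := h.regular_θ.contDiff_space t ht
  have hθC : ContDiff ℝ 1 (θ t) := hθC2.of_le (by norm_num)
  have hθp := h.regular_θ.periodic t ht
  have hvC : ∀ j, ContDiff ℝ 1 (v j t) := fun j => (h.contDiff_velocity ht j).of_le (by norm_num)
  have hvp : ∀ j, IsPeriodic3 (v j t) := fun j => (h.regular_v j).periodic t ht
  have hdC : ∀ i j, ContDiff ℝ 1 (pd i (v j t)) := fun i j =>
    (h.contDiff_velocity ht j).pd (by norm_num) i
  have dθ : Differentiable ℝ (θ t) := hθC.differentiable (by norm_num)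
  have dv : ∀ j, Differentiable ℝ (v j t) := fun j => (hvC j).differentiable (by norm_num)
  have ddv : ∀ i j, Differentiable ℝ (pd i (v j t)) := fun i j =>
    (hdC i j).differentiable (by norm_num)
  have dX : Differentiable ℝ fun x => X (W x) := XC.differentiable (by norm_num)
  have dΨ : Differentiable ℝ fun x => Ψ (W x) := ΨC.differentiable (by norm_num)
  -- The two divergences remove second derivatives and transport: `X(W) v·∇W = div(Ψ(W) v) - Ψ(W)
  -- div v`. Convexity is used to drop the term `4ν X1(W) θ ∑ᵢ (∑ⱼ vⱼ ∂ᵢvⱼ)²`.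
  set D1 : Fin 3 → Fin 3 → E3 → ℝ := fun i j y => X (W y) * (v j t y * (θ t y * pd i (v j t) y))
    with hD1
  set D2 : Fin 3 → E3 → ℝ := fun i y => Ψ (W y) * v i t y with hD2
  have C1 : ∀ i j, ContDiff ℝ 1 (D1 i j) := fun i j =>
    XC.mul ((hvC j).mul (hθC.mul (hdC i j)))
  have C2 : ∀ i, ContDiff ℝ 1 (D2 i) := fun i => ΨC.mul (hvC i)
  have P1 : ∀ i j, IsPeriodic3 (D1 i j) := fun i j =>
    (Wp.comp X).mul ((hvp j).mul (hθp.mul ((hvp j).pd i)))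
  have P2 : ∀ i, IsPeriodic3 (D2 i) := fun i => (Wp.comp Ψ).mul (hvp i)
  have c1 : ∀ i j, Continuous (pd i (D1 i j)) := fun i j => (C1 i j).continuous_pd i
  have c2 : ∀ i, Continuous (pd i (D2 i)) := fun i => (C2 i).continuous_pd i
  have e1 : ∀ i j x, pd i (D1 i j) x
      = X1 (W x) * (2 * ∑ k, v k t x * pd i (v k t) x) * (v j t x * (θ t x * pd i (v j t) x))
        + X (W x) * (θ t x * pd i (v j t) x ^ 2
          + v j t x * (θ t x * pd i (pd i (v j t)) x + pd i (θ t) x * pd i (v j t) x)) :=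
    fun i j x => by
      rw [hD1]
      dsimp only
      rw [pd_mul (g := fun y => v j t y * (θ t y * pd i (v j t) y)) (dX x)
          ((dv j x).mul ((dθ x).mul (ddv i j x))),
        pd_mul (g := fun y => θ t y * pd i (v j t) y) (dv j x) ((dθ x).mul (ddv i j x)),
        pd_mul (dθ x) (ddv i j x), pd_comp (hX _ (hWpos x)) (Wd x), h.pd_speedWeight ht]
      ring
  have e2 : ∀ i x, pd i (D2 i) x = X (W x) * (2 * ∑ k, v k t x * pd i (v k t) x) * v i t x
      + Ψ (W x) * pd i (v i t) x := fun i x => by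
    rw [hD2]
    dsimp only
    rw [pd_mul (dΨ x) (dv i x), pd_comp (hΨ _ (hWpos x)) (Wd x), h.pd_speedWeight ht]
  obtain ⟨XW, hXW⟩ : ∃ f : E3 → ℝ, ∀ x, f x = X (W x) := ⟨_, fun _ => rfl⟩
  obtain ⟨ΨW, hΨW⟩ : ∃ f : E3 → ℝ, ∀ x, f x = Ψ (W x) := ⟨_, fun _ => rfl⟩
  have cX : Continuous XW := by rw [funext hXW]; exact XC.continuous
  have cΨ : Continuous ΨW := by rw [funext hΨW]; exact ΨC.continuous
  have cθ := hθC.continuous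
  have cv := fun j => (hvC j).continuous
  have cvt : ∀ j, Continuous (timeDeriv T (v j) t) := fun j =>
    (h.regular_v j).timeC1.cont_deriv.slice ht
  have cW := WC.continuous
  have cg : Continuous (velGradSq v t) := h.jointCont_velGradSq.slice ht
  have cd : Continuous (velDiv v t) := h.jointCont_velDiv.slice ht
  simp only [← hXW, ← hΨW]
  have hle : ∀ x, XW x * ∑ j, 2 * v j t x * timeDeriv T (v j) t x
      ≤ (((ΨW x - 2 / γ * ((W x - 1) * XW x)) * velDiv v t x
        - 2 * ν * (θ t x * XW x * velGradSq v t x)))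
        + (2 * ν * (∑ i, ∑ j, pd i (D1 i j) x) + (-1) * ∑ i, pd i (D2 i) x) := fun x => by
    simp only [h.timeDeriv_velocity ht, hXW, hΨW]
    have hX1p := hX1 _ (hWpos x)
    have hq : 0 ≤ 4 * ν * (X1 (W x) * θ t x * ∑ i, (∑ j, v j t x * pd i (v j t) x) ^ 2) := by
      have h1 : 0 ≤ ∑ i, (∑ j, v j t x * pd i (v j t) x) ^ 2 :=
        Finset.sum_nonneg fun _ _ => sq_nonneg _
      have := hpos x
      positivity
    have hWx : W x = 1 + ∑ j, v j t x ^ 2 := rfl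
    have hW1 : W x - 1 = ∑ j, v j t x ^ 2 := by rw [hWx]; ring
    rw [hW1]
    simp only [e1, e2]
    generalize X (W x) = A at *
    generalize X1 (W x) = A1 at *
    generalize Ψ (W x) = B at *
    simp only [velDiv, velGradSq, frobSq, Fin.sum_univ_three] at *
    refine le_of_sub_nonneg (hq.trans (le_of_eq ?_))
    ring
  refine (integral_torus_mono (by fun_prop) (by fun_prop) hle).trans (le_of_eq ?_)
  rw [integral_torus_add (by fun_prop) (by fun_prop),
    integral_torus_add (by fun_prop) (by fun_prop), integral_const_mul, integral_const_mul,
    integral_torus_sum _ fun i _ => by fun_prop, integral_torus_sum _ fun i _ => c2 i]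
  have z1 : ∀ i, ∫ x, ∑ j, pd i (D1 i j) x ∂torusMeasure = 0 := fun i => by
    rw [integral_torus_sum _ fun j _ => c1 i j]
    simp [integral_pd_eq_zero (C1 i _) (P1 i _)]
  simp [z1, integral_pd_eq_zero (C2 _) (P2 _)]

end ThermalFlow

/-! ### Truncated entropies and the moment bound at short times -/

/-- The Sobolev inequality with constant `C` on the torus. -/
def SobolevConst (C : ℝ) : Prop :=
  0 < C ∧ ∀ f : E3 → ℝ, ContDiff ℝ 1 f → IsPeriodic3 f → ∫ x, f x ^ 6 ∂torusMeasure
    ≤ (C * (∫ x, gradSq f x ∂torusMeasure + ∫ x, f x ^ 2 ∂torusMeasure)) ^ 3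

/-- `Ψ` is a convex entropy with `Ψ 1 = 0`, derivative `X` and second derivative `X1`, growing at
most like the power `p + 1`. -/
structure IsEntropy (p : ℝ) (Ψ X X1 : ℝ → ℝ) : Prop where
  hasDerivAt : ∀ r ∈ Ioi (0 : ℝ), HasDerivAt Ψ (X r) r
  hasDerivAt' : ∀ r ∈ Ioi (0 : ℝ), HasDerivAt X (X1 r) r
  continuousOn : ContinuousOn X1 (Ioi 0)
  pos : ∀ r ∈ Ioi (0 : ℝ), 0 < X r
  nonneg : ∀ r ∈ Ioi (0 : ℝ), 0 ≤ X1 r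
  growth : ∀ r ∈ Ioi (0 : ℝ), r * X1 r ≤ p * X r
  zero : Ψ 1 = 0
  one : X 1 ≤ 1

theorem le_of_hasDerivAt_nonneg_Ici {f f' : ℝ → ℝ} (hf : ∀ r, 1 ≤ r → HasDerivAt f (f' r) r)
    (h0 : ∀ r, 1 ≤ r → 0 ≤ f' r) {r : ℝ} (hr : 1 ≤ r) : f 1 ≤ f r := by
  refine monotoneOn_of_deriv_nonneg (convex_Ici 1)
    (fun r hr => (hf r hr).continuousAt.continuousWithinAt) ?_ ?_ (mem_Ici.2 le_rfl) hr hr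
  · rw [interior_Ici]
    exact fun r hr => (hf r (le_of_lt hr)).differentiableAt.differentiableWithinAt
  · rw [interior_Ici]
    exact fun r hr => by rw [(hf r (le_of_lt hr)).deriv]; exact h0 r (le_of_lt hr)

namespace IsEntropy

variable {p : ℝ} {Ψ X X1 : ℝ → ℝ}

theorem apply_nonneg (h : IsEntropy p Ψ X X1) {r : ℝ} (hr : 1 ≤ r) : 0 ≤ Ψ r := by
  have := le_of_hasDerivAt_nonneg_Ici
    (fun r hr => h.hasDerivAt r (zero_lt_one.trans_le hr))
    (fun r hr => (h.pos r (zero_lt_one.trans_le hr)).le) hr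
  rwa [h.zero] at this

/-- Convexity: the tangent at `r` lies below the graph at 1, where the entropy vanishes. -/
theorem apply_le (h : IsEntropy p Ψ X X1) {r : ℝ} (hr : 1 ≤ r) : Ψ r ≤ (r - 1) * X r := by
  have := le_of_hasDerivAt_nonneg_Ici (f := fun r => (r - 1) * X r - Ψ r)
    (f' := fun r => 1 * X r + (r - 1) * X1 r - X r)
    (fun r hr => (((hasDerivAt_id r).sub_const 1).mul
      (h.hasDerivAt' r (zero_lt_one.trans_le hr))).sub (h.hasDerivAt r (zero_lt_one.trans_le hr)))
    (fun r hr => by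
      have := mul_nonneg (sub_nonneg.2 hr) (h.nonneg r (zero_lt_one.trans_le hr))
      linarith) hr
  simp only [sub_self, zero_mul, h.zero] at this
  linarith

/-- By the growth condition `(1 + p) Ψ - r X` is nondecreasing, and at 1 it equals `-X 1 ≥ -1`. The
rate can thus be estimated by the entropy itself, uniformly over all entropies of the same order. -/
theorem mul_le (h : IsEntropy p Ψ X X1) {r : ℝ} (hr : 1 ≤ r) :
    r * X r ≤ (1 + p) * Ψ r + 1 := by
  have := le_of_hasDerivAt_nonneg_Ici (f := fun r => (1 + p) * Ψ r - r * X r)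
    (f' := fun r => (1 + p) * X r - (1 * X r + r * X1 r))
    (fun r hr => ((h.hasDerivAt r (zero_lt_one.trans_le hr)).const_mul (1 + p)).sub
      ((hasDerivAt_id r).mul (h.hasDerivAt' r (zero_lt_one.trans_le hr))))
    (fun r hr => by
      have := h.growth r (zero_lt_one.trans_le hr)
      linarith) hr
  simp only [h.zero] at this
  linarith [h.one]

end IsEntropy

/-- Truncation of the power `r ^ p` at height `1 / δ`. -/
noncomputable def truncPow (p δ r : ℝ) : ℝ := (r / (1 + δ * r)) ^ p

theorem truncPow_continuousOn (p : ℝ) {δ : ℝ} (hδ : 0 < δ) :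
    ContinuousOn (truncPow p δ) (Ioi 0) := by
  intro r hr
  have hr : 0 < r := hr
  have h1 : 1 + δ * r ≠ 0 := by positivity
  have h2 : ContinuousAt (fun r => r / (1 + δ * r)) r := by fun_prop (disch := exact h1)
  exact (h2.rpow_const (Or.inl (by positivity))).continuousWithinAt

/-- Truncation multiplies the logarithmic derivative `p / r` by `1 / (1 + δ r) ≤ 1`, so the order
stays `p` whatever `δ` is. -/
theorem isEntropy_truncPow {p δ : ℝ} (hp : 0 ≤ p) (hδ : 0 < δ) :
    IsEntropy p (fun r => ∫ s in (1 : ℝ)..r, truncPow p δ s) (truncPow p δ)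
      (fun r => 1 / (1 + δ * r) ^ 2 * p * (r / (1 + δ * r)) ^ (p - 1)) := by
  have hc := truncPow_continuousOn p hδ
  have hden : ∀ r, 0 < r → 0 < 1 + δ * r := fun r hr => by positivity
  constructor
  · intro r hr
    have hr : 0 < r := hr
    have hsub : uIcc 1 r ⊆ Ioi 0 := fun s hs => by
      have := (mem_uIcc.1 hs)
      rcases this with h | h
      · exact zero_lt_one.trans_le h.1
      · exact hr.trans_le h.1
    exact intervalIntegral.integral_hasDerivAt_right (hc.mono hsub).intervalIntegrable
      (hc.stronglyMeasurableAtFilter isOpen_Ioi r hr) (hc.continuousAt (Ioi_mem_nhds hr))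
  · intro r hr
    have hr : 0 < r := hr
    have h1 : HasDerivAt (fun r => 1 + δ * r) δ r := by
      simpa using ((hasDerivAt_id r).const_mul δ).const_add 1
    have h2 := (hasDerivAt_id r).fun_div h1 (hden r hr).ne'
    have h3 := h2.rpow_const (p := p) (Or.inl (div_pos hr (hden r hr)).ne')
    have e : (1 * (1 + δ * r) - id r * δ) / (1 + δ * r) ^ 2 = 1 / (1 + δ * r) ^ 2 := by
      simp only [id]
      ring
    rw [e] at h3
    exact h3
  · intro r hr
    have hr : 0 < r := hr
    have h1 : 1 + δ * r ≠ 0 := (hden r hr).ne'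
    have h2 : ContinuousAt (fun r => r / (1 + δ * r)) r := by fun_prop (disch := exact h1)
    have h3 := h2.rpow_const (p := p - 1) (Or.inl (div_pos hr (hden r hr)).ne')
    have h4 : ContinuousAt (fun r => 1 / (1 + δ * r) ^ 2 * p) r := by
      fun_prop (disch := positivity)
    exact (h4.mul h3).continuousWithinAt
  · intro r hr
    exact Real.rpow_pos_of_pos (div_pos hr (hden r hr)) p
  · intro r hr
    have hr : 0 < r := hr
    have := hden r hr
    positivity
  · intro r hr
    have hr : 0 < r := hr
    have hd := hden r hr
    have hq : 0 < r / (1 + δ * r) := div_pos hr hd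
    rw [Real.rpow_sub_one hq.ne', truncPow]
    have hX : 0 < (r / (1 + δ * r)) ^ p := Real.rpow_pos_of_pos hq p
    have e : r * (1 / (1 + δ * r) ^ 2 * p * ((r / (1 + δ * r)) ^ p / (r / (1 + δ * r))))
        = p * (r / (1 + δ * r)) ^ p * (1 / (1 + δ * r)) := by
      generalize (r / (1 + δ * r)) ^ p = A
      field_simp
    rw [e]
    refine mul_le_of_le_one_right (by positivity) ?_
    rw [div_le_one hd]
    have := mul_pos hδ hr
    linarith
  · simp
  · refine Real.rpow_le_one (div_pos one_pos (hden 1 one_pos)).le ?_ hp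
    rw [div_le_one (hden 1 one_pos)]
    linarith

theorem truncPow_le_rpow {p δ r : ℝ} (hp : 0 ≤ p) (hδ : 0 < δ) (hr : 0 < r) :
    truncPow p δ r ≤ r ^ p := by
  have : 0 < δ * r := mul_pos hδ hr
  exact Real.rpow_le_rpow (by positivity) (div_le_self hr.le (by linarith)) hp

theorem truncPow_le_const {p δ r : ℝ} (hp : 0 ≤ p) (hδ : 0 < δ) (hr : 0 < r) :
    truncPow p δ r ≤ (1 / δ) ^ p := by
  have h1 : 0 < δ * r := mul_pos hδ hr
  refine Real.rpow_le_rpow (by positivity) ?_ hp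
  rw [div_le_div_iff₀ (by positivity) hδ]
  linarith

/-- Below the height `B` the denominator `1 + r/B` is at most 2, so truncation there costs only `2 ^
p`. -/
theorem rpow_le_truncPow {p B r : ℝ} (hp : 0 ≤ p) (hr : 0 < r) (hB : r ≤ B) :
    r ^ p ≤ 2 ^ p * truncPow p (1 / B) r := by
  have hB0 : 0 < B := hr.trans_le hB
  rw [truncPow, ← Real.mul_rpow (by norm_num) (by positivity)]
  refine Real.rpow_le_rpow hr.le ?_ hp
  have h1 : 1 / B * r ≤ 1 := by
    rw [one_div_mul_eq_div, div_le_one hB0]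
    exact hB
  rw [← mul_div_assoc, le_div_iff₀ (by positivity)]
  nlinarith

/-- Here `z = Ψ(w)`, `y = X(w)`, `q = θ`, `d = div v`, `g = |∇v|²`. The bracket multiplying `d` has
modulus at most `w y`, and half of the viscous term absorbs `d` at the price of `w² y`. Splitting `w
≤ η w² + 1/(4η)` turns this price into `w²` times `w y`, which Hölder and Sobolev can handle, plus a
multiple of `w y`. -/
theorem entropy_rate_pointwise {ν μ γ η z y w g d q : ℝ} (hν : 0 < ν) (hμ : 0 < μ) (hγ : 2 ≤ γ)
    (hη0 : 0 < η) (a1 : 0 ≤ z) (a2 : z ≤ (w - 1) * y) (a3 : 0 < y) (a4 : d ^ 2 ≤ 3 * g)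
    (a5 : 0 ≤ g) (a6 : μ ≤ q) (a7 : 1 ≤ w) :
    (z - 2 / γ * ((w - 1) * y)) * d - 2 * ν * (q * y * g)
      ≤ -(ν * μ) * (y * g) + (3 / (4 * (ν * μ)) * η * (w ^ 2 * (w * y))
        + 3 / (4 * (ν * μ)) / (4 * η) * (w * y)) := by
  set c := 3 / (4 * (ν * μ)) with hc
  have hc0 : 0 < c := by positivity
  have hγ1 : 2 / γ ≤ 1 := by rw [div_le_one (by linarith)]; exact hγ
  have hγ0 : 0 < 2 / γ := by positivity
  have b1 : |z - 2 / γ * ((w - 1) * y)| ≤ w * y := by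
    have : 0 ≤ (w - 1) * y := mul_nonneg (by linarith) a3.le
    have b2 : 2 / γ * ((w - 1) * y) ≤ (w - 1) * y := mul_le_of_le_one_left this hγ1
    have b3 : 0 ≤ 2 / γ * ((w - 1) * y) := by positivity
    rw [abs_le]
    constructor <;> nlinarith
  have b4 : (z - 2 / γ * ((w - 1) * y)) * d ≤ w * y * |d| := by
    refine (le_abs_self _).trans ?_
    rw [abs_mul]
    gcongr
  have b5 : w * |d| ≤ ν * μ * g + c * w ^ 2 := by
    have : w * |d| ≤ ν * μ / 3 * |d| ^ 2 + c * w ^ 2 := by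
      have e : ν * μ / 3 * |d| ^ 2 + c * w ^ 2 - w * |d|
          = (1 / (12 * (ν * μ))) * (2 * (ν * μ) * |d| - 3 * w) ^ 2 := by
        rw [hc]; field_simp; ring
      have : 0 ≤ (1 / (12 * (ν * μ))) * (2 * (ν * μ) * |d| - 3 * w) ^ 2 := by positivity
      linarith
    rw [sq_abs] at this
    have h5 : ν * μ / 3 * d ^ 2 ≤ ν * μ / 3 * (3 * g) := by gcongr
    linarith
  have b6 : w ≤ η * w ^ 2 + 1 / (4 * η) := by
    have e : η * w ^ 2 + 1 / (4 * η) - w = (1 / (4 * η)) * (2 * η * w - 1) ^ 2 := by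
      field_simp; ring
    have : 0 ≤ (1 / (4 * η)) * (2 * η * w - 1) ^ 2 := by positivity
    linarith
  have b7 : c * w ^ 2 * y ≤ c * η * (w ^ 2 * (w * y)) + c / (4 * η) * (w * y) := by
    have : 0 ≤ c * (w * y) := by positivity
    have := mul_le_mul_of_nonneg_left b6 this
    calc c * w ^ 2 * y = c * (w * y) * w := by ring
      _ ≤ _ := this
      _ = _ := by ring
  have b8 : ν * μ * (y * g) ≤ ν * (q * y * g) := by
    have : 0 ≤ ν * (y * g) := by positivity
    nlinarith
  have b9 := mul_le_mul_of_nonneg_left b5 a3.le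
  nlinarith

namespace ThermalFlow

variable {ν κ γ T : ℝ} {v : Fin 3 → ℝ → E3 → ℝ} {θ : ℝ → E3 → ℝ}

theorem gradSq_comp_speedWeight (h : ThermalFlow ν κ γ T v θ) {t : ℝ} (ht : t ∈ Ioc 0 T)
    {φ φ' : ℝ → ℝ} (hφ : ∀ r ∈ Ioi (0 : ℝ), HasDerivAt φ (φ' r) r) (x : E3) :
    gradSq (fun x => φ (speedWeight v t x)) x
      ≤ φ' (speedWeight v t x) ^ 2 * (4 * speedWeight v t x * velGradSq v t x) := by
  have hW : 0 < speedWeight v t x := zero_lt_one.trans_le (one_le_speedWeight v t x)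
  have h1 : gradSq (fun x => φ (speedWeight v t x)) x
      = φ' (speedWeight v t x) ^ 2 * gradSq (speedWeight v t) x := by
    simp only [gradSq, Finset.mul_sum]
    refine Finset.sum_congr rfl fun i _ => ?_
    rw [pd_comp (hφ _ hW) ((h.contDiff_speedWeight ht).differentiable (by norm_num) x), mul_pow]
  rw [h1]
  exact mul_le_mul_of_nonneg_left (h.gradSq_speedWeight_le ht x) (sq_nonneg _)

/-- The growth rate of an entropy is linear, with a constant depending on the entropy only through
its order `p`. -/
theorem exists_entropy_rate_le (h : ThermalFlow ν κ γ T v θ) (hν : 0 < ν) (hγ : 2 ≤ γ) {p : ℝ}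
    (hp : 0 ≤ p) {C : ℝ} (hC : SobolevConst C) {μ R S : ℝ} (hμ : 0 < μ) (hR : 0 ≤ R) (hS : S ≤ T)
    (hlow : ∀ t ∈ Ioc 0 S, ∀ x, μ ≤ θ t x)
    (hWR : ∀ t ∈ Ioc 0 S, ∫ x, speedWeight v t x ^ 3 ∂torusMeasure ≤ R ^ 3) :
    ∃ A, 0 < A ∧ ∀ Ψ X X1, IsEntropy p Ψ X X1 → ∀ t ∈ Ioc 0 S,
      ∫ x, X (speedWeight v t x) * ∑ j, 2 * v j t x * timeDeriv T (v j) t x ∂torusMeasure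
        ≤ A * (∫ x, Ψ (speedWeight v t x) ∂torusMeasure + 1) := by
  obtain ⟨hC0, hC⟩ := hC
  set c := 3 / (4 * (ν * μ)) with hc
  have hc0 : 0 < c := by positivity
  -- Chosen so that the gradient part of the Sobolev bound, `c η R² C (1+p)² Z`, is at most the
  -- available dissipation `ν μ Z`; the `+ 1` covers `R = 0`.
  set η := ν * μ / (c * C * (1 + p) ^ 2 * (R ^ 2 + 1)) with hη
  have hη0 : 0 < η := by positivity
  set A1 := c * η * (R ^ 2 * C) + c / (4 * η) with hA1
  have hA10 : 0 < A1 := by positivity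
  refine ⟨A1 * (1 + p), by positivity, fun Ψ X X1 hE t htS => ?_⟩
  have ht : t ∈ Ioc 0 T := ⟨htS.1, htS.2.trans hS⟩
  have hθpos : ∀ x, 0 < θ t x := fun x => hμ.trans_le (hlow t htS x)
  have h1 := h.integral_entropy_rate_le hν ht hθpos hE.hasDerivAt hE.hasDerivAt' hE.continuousOn
    hE.nonneg
  set W := speedWeight v t with hW
  have hW1 : ∀ x, 1 ≤ W x := one_le_speedWeight v t
  have hWpos : ∀ x, W x ∈ Ioi (0 : ℝ) := fun x => zero_lt_one.trans_le (hW1 x)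
  have WC : ContDiff ℝ 1 W := (h.contDiff_speedWeight ht).of_le (by norm_num)
  have Wp := h.periodic_speedWeight ht
  have hXc : ContinuousOn X (Ioi 0) := fun r hr =>
    (hE.hasDerivAt' r hr).continuousAt.continuousWithinAt
  set φ' : ℝ → ℝ := fun r => (1 * X r + r * X1 r) / (2 * √(r * X r)) with hφ'
  have hφ : ∀ r ∈ Ioi (0 : ℝ), HasDerivAt (fun r => √(r * X r)) (φ' r) r := fun r hr =>
    ((hasDerivAt_id r).mul (hE.hasDerivAt' r hr)).sqrt (mul_pos hr (hE.pos r hr)).ne'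
  have hφ'c : ContinuousOn φ' (Ioi 0) := by
    have h1 : ContinuousOn (fun r => √(r * X r)) (Ioi 0) := fun r hr =>
      (hφ r hr).continuousAt.continuousWithinAt
    refine ContinuousOn.div ?_ (continuousOn_const.mul h1) fun r hr => ?_
    · exact (continuousOn_const.mul hXc).add (continuousOn_id.mul hE.continuousOn)
    · have := Real.sqrt_pos.2 (mul_pos hr (hE.pos r hr))
      positivity
  -- The square of this function is the density `W X(W)`, and by the growth condition its squared
  -- gradient is at most `(1+p)² X(W) |∇v|²`, which is the entropy dissipation.
  set f : E3 → ℝ := fun x => √(W x * X (W x)) with hf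
  have fC : ContDiff ℝ 1 f := contDiff_one_comp isOpen_Ioi hφ hφ'c WC hWpos
  have fp : IsPeriodic3 f := Wp.comp fun r => √(r * X r)
  have fsq : ∀ x, f x ^ 2 = W x * X (W x) := fun x =>
    Real.sq_sqrt (mul_pos (hWpos x) (hE.pos _ (hWpos x))).le
  have fgrad : ∀ x, gradSq f x ≤ (1 + p) ^ 2 * (X (W x) * velGradSq v t x) := fun x => by
    refine (h.gradSq_comp_speedWeight ht hφ x).trans ?_
    have hr := hWpos x
    have hX := hE.pos _ hr
    have hg := hE.growth _ hr
    have hn := hE.nonneg _ hr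
    have hgr := velGradSq_nonneg v t x
    rw [← hW]
    generalize W x = r at *
    have hr : 0 < r := hr
    simp only [hφ', div_pow, mul_pow, Real.sq_sqrt (mul_pos hr hX).le]
    have h2 : (1 * X r + r * X1 r) ^ 2 ≤ ((1 + p) * X r) ^ 2 := by
      refine pow_le_pow_left₀ (by positivity) (by linarith) 2
    calc _ = (1 * X r + r * X1 r) ^ 2 / X r * velGradSq v t x := by
          field_simp
          ring
      _ ≤ ((1 + p) * X r) ^ 2 / X r * velGradSq v t x := by gcongr
      _ = _ := by field_simp
  have cW := WC.continuous
  have cf := fC.continuous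
  obtain ⟨XW, hXW⟩ : ∃ f : E3 → ℝ, ∀ x, f x = X (W x) := ⟨_, fun _ => rfl⟩
  obtain ⟨ΨW, hΨW⟩ : ∃ f : E3 → ℝ, ∀ x, f x = Ψ (W x) := ⟨_, fun _ => rfl⟩
  have cX : Continuous XW := by rw [funext hXW]; exact hXc.comp_continuous cW hWpos
  have cΨ : Continuous ΨW := by
    rw [funext hΨW]
    exact ContinuousOn.comp_continuous (g := Ψ) (s := Ioi 0)
      (fun r hr => (hE.hasDerivAt r hr).continuousAt.continuousWithinAt) cW hWpos
  have cg : Continuous (velGradSq v t) := h.jointCont_velGradSq.slice ht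
  have cd : Continuous (velDiv v t) := h.jointCont_velDiv.slice ht
  have cθ : Continuous (θ t) := h.regular_θ.timeC1.cont.slice ht
  have cgf := fC.continuous_gradSq
  simp only [← hXW, ← hΨW] at h1 fgrad fsq ⊢
  set Z := ∫ x, XW x * velGradSq v t x ∂torusMeasure with hZ
  set Q := ∫ x, f x ^ 2 ∂torusMeasure with hQ
  have hZ0 : 0 ≤ Z := integral_nonneg fun x => by
    have := hE.pos _ (hWpos x)
    rw [hXW]
    exact mul_nonneg this.le (velGradSq_nonneg v t x)
  have hQ0 : 0 ≤ Q := integral_nonneg fun x => sq_nonneg _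
  have h2 : ∀ x, (ΨW x - 2 / γ * ((W x - 1) * XW x)) * velDiv v t x
        - 2 * ν * (θ t x * XW x * velGradSq v t x)
      ≤ -(ν * μ) * (XW x * velGradSq v t x)
        + (c * η * (W x ^ 2 * f x ^ 2) + c / (4 * η) * f x ^ 2) := fun x => by
    have a1 := hE.apply_nonneg (hW1 x)
    have a2 := hE.apply_le (hW1 x)
    have a3 := hE.pos _ (hWpos x)
    rw [← hΨW, ← hXW] at a2
    rw [← hΨW] at a1
    rw [← hXW] at a3
    rw [fsq]
    have a4 := velDiv_sq_le v t x
    have a5 := velGradSq_nonneg v t x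
    have a6 := hlow t htS x
    have a7 := hW1 x
    generalize velGradSq v t x = g at *
    generalize velDiv v t x = d at *
    generalize XW x = y at *
    generalize ΨW x = z at *
    generalize W x = w at *
    generalize θ t x = q at *
    exact entropy_rate_pointwise hν hμ hγ hη0 a1 a2 a3 a4 a5 a6 a7
  have h3 := h1.trans (integral_torus_mono (by fun_prop) (by fun_prop) h2)
  rw [integral_torus_add (by fun_prop) (by fun_prop),
    integral_torus_add (by fun_prop) (by fun_prop), integral_const_mul, integral_const_mul,
    integral_const_mul, ← hZ, ← hQ] at h3
  have h4 := integral_sq_mul_sq_le hC hC0 cW (fun x => (zero_le_one.trans (hW1 x))) fC fp hR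
    (hWR t htS)
  rw [← hQ] at h4
  have h5 : ∫ x, gradSq f x ∂torusMeasure ≤ (1 + p) ^ 2 * Z := by
    rw [hZ, ← integral_const_mul]
    exact integral_torus_mono cgf (by fun_prop) fgrad
  have h6 : Q ≤ (1 + p) * ∫ x, ΨW x ∂torusMeasure + 1 := by
    have : ∀ x, f x ^ 2 ≤ (1 + p) * ΨW x + 1 := fun x => by
      rw [fsq, hXW, hΨW]
      exact hE.mul_le (hW1 x)
    refine (integral_torus_mono (by fun_prop) (by fun_prop) this).trans (le_of_eq ?_)
    rw [integral_torus_add (by fun_prop) (by fun_prop), integral_const_mul]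
    simp
  have h7 : c * η * (R ^ 2 * (C * ((1 + p) ^ 2 * Z))) ≤ ν * μ * Z := by
    have e : c * η * (R ^ 2 * (C * ((1 + p) ^ 2 * Z))) = ν * μ * Z * (R ^ 2 / (R ^ 2 + 1)) := by
      rw [hη]; field_simp
    rw [e]
    refine mul_le_of_le_one_right (by positivity) ?_
    rw [div_le_one (by positivity)]
    linarith
  have h8 : ∫ x, W x ^ 2 * f x ^ 2 ∂torusMeasure ≤ R ^ 2 * (C * ((1 + p) ^ 2 * Z + Q)) :=
    h4.trans (by gcongr)
  have h9 : c * η * ∫ x, W x ^ 2 * f x ^ 2 ∂torusMeasure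
      ≤ c * η * (R ^ 2 * (C * ((1 + p) ^ 2 * Z + Q))) := by gcongr
  have h10 : A1 * Q ≤ A1 * ((1 + p) * ∫ x, ΨW x ∂torusMeasure + 1) := by gcongr
  have h11 : 0 ≤ A1 * p := by positivity
  calc _ ≤ _ := h3
    _ ≤ A1 * Q := by rw [hA1]; linarith
    _ ≤ _ := h10
    _ ≤ _ := by linarith

end ThermalFlow

namespace ThermalFlow

variable {ν κ γ T : ℝ} {v : Fin 3 → ℝ → E3 → ℝ} {θ : ℝ → E3 → ℝ}

theorem continuous_comp_speedWeight (h : ThermalFlow ν κ γ T v θ) {t : ℝ} (ht : t ∈ Ioc 0 T)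
    {φ : ℝ → ℝ} (hφ : ContinuousOn φ (Ioi 0)) : Continuous fun x => φ (speedWeight v t x) :=
  hφ.comp_continuous (h.timeC1_speedWeight.cont.slice ht)
    fun x => zero_lt_one.trans_le (one_le_speedWeight v t x)

theorem entropy_le_of_lt (h : ThermalFlow ν κ γ T v θ) {p S A : ℝ} (hS : S ≤ T) {Ψ X X1 : ℝ → ℝ}
    (hE : IsEntropy p Ψ X X1) (hrate : ∀ t ∈ Ioc 0 S,
      ∫ x, X (speedWeight v t x) * ∑ j, 2 * v j t x * timeDeriv T (v j) t x ∂torusMeasure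
        ≤ A * (∫ x, Ψ (speedWeight v t x) ∂torusMeasure + 1)) {s t : ℝ} (hs : 0 < s) (hst : s ≤ t)
    (ht : t < S) :
    ∫ x, Ψ (speedWeight v t x) ∂torusMeasure + 1
      ≤ Real.exp (A * (t - s)) * (∫ x, Ψ (speedWeight v s x) ∂torusMeasure + 1) := by
  have hXc : ContinuousOn X (Ioi 0) := fun r hr =>
    (hE.hasDerivAt' r hr).continuousAt.continuousWithinAt
  have hTC := (h.timeC1_speedWeight.mono hS).comp (S := Ioi 0) hE.hasDerivAt hXc
    fun t _ x => zero_lt_one.trans_le (one_le_speedWeight v t x)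
  set G : ℝ → ℝ := fun t => ∫ x, Ψ (speedWeight v t x) ∂torusMeasure with hG
  have hd : ∀ t ∈ Ioo 0 S, HasDerivAt (fun t => Real.exp (-(A * t)) * (G t + 1))
      (Real.exp (-(A * t)) * (-(A * 1)) * (G t + 1) + Real.exp (-(A * t))
        * ∫ x, X (speedWeight v t x) * ∑ j, 2 * v j t x * timeDeriv T (v j) t x ∂torusMeasure)
      t := fun t ht =>
    (((hasDerivAt_id t).const_mul A).neg.exp).mul ((hTC.hasDerivAt_integral ht).add_const 1)
  have hanti := antitoneOn_Ioo_of_hasDerivAt_nonpos hd fun t ht => by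
    have h1 := hrate t ⟨ht.1, ht.2.le⟩
    have h2 := mul_le_mul_of_nonneg_left h1 (Real.exp_pos (-(A * t))).le
    have h3 : G t = ∫ x, Ψ (speedWeight v t x) ∂torusMeasure := rfl
    rw [← h3] at h2
    nlinarith
  have h4 := hanti ⟨hs, hst.trans_lt ht⟩ ⟨hs.trans_le hst, ht⟩ hst
  dsimp only at h4
  have h5 := mul_le_mul_of_nonneg_left h4 (Real.exp_pos (A * t)).le
  rw [← mul_assoc, ← Real.exp_add, ← mul_assoc, ← Real.exp_add] at h5
  simp only [add_neg_cancel, Real.exp_zero, one_mul] at h5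
  rw [mul_sub, sub_eq_add_neg]
  exact h5

/-- Near the initial time the `L^γ` norm is bounded by the one of the initial velocity, although
the data are only attained in `H¹`. -/
theorem exists_short_time_bound (h : ThermalFlow ν κ γ T v θ) (hν : 0 < ν) (hγ : 2 ≤ γ)
    {C : ℝ} (hC : SobolevConst C) {μ R S : ℝ} (hμ : 0 < μ) (hR : 0 ≤ R) (hS0 : 0 < S) (hS : S ≤ T)
    (hlow : ∀ t ∈ Ioc 0 S, ∀ x, μ ≤ θ t x)
    (hWR : ∀ t ∈ Ioc 0 S, ∫ x, speedWeight v t x ^ 3 ∂torusMeasure ≤ R ^ 3)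
    {W0 : E3 → ℝ} (hW0 : ∀ x, 1 ≤ W0 x) (hW0i : Integrable W0 torusMeasure)
    (hW0γ : Integrable (fun x => W0 x ^ (γ / 2)) torusMeasure)
    (htend : Tendsto (fun t => ∫ x, |speedWeight v t x - W0 x| ∂torusMeasure) (𝓝[>] 0) (𝓝 0)) :
    ∃ s0, 0 < s0 ∧ s0 ≤ S ∧ ∀ t ∈ Ioo 0 s0, ∫ x, speedWeight v t x ^ (γ / 2) ∂torusMeasure
      ≤ 2 ^ (γ / 2) * (γ / 2) * (∫ x, W0 x ^ (γ / 2) ∂torusMeasure + 1) := by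
  set p := γ / 2 - 1 with hp
  have hp0 : 0 ≤ p := by rw [hp]; linarith
  obtain ⟨A, hA, hrate⟩ := h.exists_entropy_rate_le hν hγ hp0 hC hμ hR hS hlow hWR
  have hlog : 0 < Real.log 2 := Real.log_pos (by norm_num)
  -- Up to this time the Grönwall factor is at most 2. The rate `A` depends on the solution but
  -- affects only the length of the interval, not the bound obtained on it.
  refine ⟨min S (Real.log 2 / A), lt_min hS0 (by positivity), min_le_left _ _, fun t ht => ?_⟩
  have htS : t < S := ht.2.trans_le (min_le_left _ _)
  have htT : t ∈ Ioc 0 T := ⟨ht.1, htS.le.trans hS⟩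
  have htA : A * t ≤ Real.log 2 := by
    have := (ht.2.trans_le (min_le_right _ _)).le
    rw [le_div_iff₀ hA] at this
    linarith
  obtain ⟨B, hB⟩ := h.timeC1_speedWeight.cont.exists_bound (isCompact_singleton (x := t))
    (singleton_subset_iff.2 htT) 2
  have hWB : ∀ x, speedWeight v t x ≤ B := fun x => by
    obtain ⟨y, hy, hyx⟩ := (h.periodic_speedWeight htT).exists_mem_unitCell x
    rw [← hyx]
    exact (le_abs_self _).trans (hB t rfl y (norm_le_two_of_mem_unitCell hy))
  have hB0 : 0 < B := zero_lt_one.trans_le ((one_le_speedWeight v t 0).trans (hWB 0))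
  -- The truncation height is a bound for `1 + |v|²` at the single time `t`: there the truncated
  -- power is comparable to the full one. The truncated derivative is bounded, so the entropy is
  -- Lipschitz and `L¹` convergence of `1 + |v|²` controls it near time zero. As `A` ignores the
  -- truncation, the height may vary with `t`.
  have hδ : 0 < 1 / B := by positivity
  have hE := isEntropy_truncPow hp0 hδ
  set X := truncPow p (1 / B) with hX
  set Ψ : ℝ → ℝ := fun r => ∫ s in (1 : ℝ)..r, X s with hΨ
  have hΨc : ContinuousOn Ψ (Ioi 0) := fun r hr =>
    (hE.hasDerivAt r hr).continuousAt.continuousWithinAt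
  set L := (1 / (1 / B)) ^ p with hL
  have hLip : ∀ a b, 1 ≤ a → 1 ≤ b → Ψ a ≤ Ψ b + L * |a - b| := fun a b ha hb => by
    have := Convex.norm_image_sub_le_of_norm_hasDerivWithin_le (s := Ici (1 : ℝ)) (f := Ψ) (f' := X)
      (C := L) (x := b) (y := a)
      (fun r hr => (hE.hasDerivAt r (zero_lt_one.trans_le (mem_Ici.1 hr))).hasDerivWithinAt)
      (fun r hr => by
        have hr : (1 : ℝ) ≤ r := hr
        rw [Real.norm_eq_abs, abs_of_pos (hE.pos r (zero_lt_one.trans_le hr))]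
        exact truncPow_le_const hp0 hδ (zero_lt_one.trans_le hr)) (convex_Ici 1) (mem_Ici.2 hb)
      (mem_Ici.2 ha)
    have h2 := (le_abs_self _).trans this
    rw [Real.norm_eq_abs] at h2
    linarith
  have hΨW0 : ∀ x, Ψ (W0 x) ≤ W0 x ^ (γ / 2) := fun x => by
    have h1 := hE.apply_le (hW0 x)
    have h0 : 0 < W0 x := zero_lt_one.trans_le (hW0 x)
    have h2 := truncPow_le_rpow hp0 hδ h0
    have h3 : W0 x ^ (γ / 2) = W0 x * W0 x ^ p := by
      rw [hp, Real.rpow_sub_one h0.ne']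
      field_simp
    have h4 := hE.pos _ h0
    rw [h3]
    calc Ψ (W0 x) ≤ (W0 x - 1) * X (W0 x) := h1
      _ ≤ W0 x * X (W0 x) := by nlinarith
      _ ≤ _ := by gcongr
  set F0 := ∫ x, W0 x ^ (γ / 2) ∂torusMeasure with hF0
  have hGs : ∀ s ∈ Ioo 0 t, ∫ x, Ψ (speedWeight v t x) ∂torusMeasure + 1
      ≤ 2 * (F0 + L * ∫ x, |speedWeight v s x - W0 x| ∂torusMeasure + 1) := fun s hs => by
    have hsT : s ∈ Ioc 0 T := ⟨hs.1, hs.2.le.trans htT.2⟩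
    have h1 := h.entropy_le_of_lt hS hE (hrate _ _ _ hE) hs.1 hs.2.le htS
    have hi : Integrable (fun x => |speedWeight v s x - W0 x|) torusMeasure :=
      ((integrable_torus (h.timeC1_speedWeight.cont.slice hsT)).sub hW0i).abs
    have h2 : ∫ x, Ψ (speedWeight v s x) ∂torusMeasure
        ≤ F0 + L * ∫ x, |speedWeight v s x - W0 x| ∂torusMeasure := by
      rw [hF0, ← integral_const_mul, ← integral_add hW0γ (hi.const_mul L)]
      refine integral_mono (integrable_torus (h.continuous_comp_speedWeight hsT hΨc))
        (hW0γ.add (hi.const_mul L)) fun x => ?_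
      have := hLip _ _ (one_le_speedWeight v s x) (hW0 x)
      have := hΨW0 x
      dsimp only
      linarith
    have h3 : Real.exp (A * (t - s)) ≤ 2 := by
      rw [← Real.exp_log (by norm_num : (0 : ℝ) < 2)]
      refine Real.exp_le_exp.2 (le_trans ?_ htA)
      nlinarith [hs.1]
    have h4 : 0 ≤ ∫ x, Ψ (speedWeight v s x) ∂torusMeasure :=
      integral_nonneg fun x => hE.apply_nonneg (one_le_speedWeight v s x)
    calc _ ≤ _ := h1
      _ ≤ 2 * (∫ x, Ψ (speedWeight v s x) ∂torusMeasure + 1) := by gcongr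
      _ ≤ _ := by gcongr
  have hGt : ∫ x, Ψ (speedWeight v t x) ∂torusMeasure + 1 ≤ 2 * (F0 + L * 0 + 1) := by
    refine ge_of_tendsto ((((htend.const_mul L).const_add F0).add_const 1).const_mul 2) ?_
    filter_upwards [Ioo_mem_nhdsGT ht.1] with s hs using hGs s hs
  have hpt : ∀ x, speedWeight v t x ^ (γ / 2)
      ≤ 2 ^ p * ((1 + p) * Ψ (speedWeight v t x) + 1) := fun x => by
    have h1 := one_le_speedWeight v t x
    have h0 : 0 < speedWeight v t x := zero_lt_one.trans_le h1
    have h2 := rpow_le_truncPow hp0 h0 (hWB x)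
    have h3 := hE.mul_le h1
    have h4 : speedWeight v t x ^ (γ / 2) = speedWeight v t x * speedWeight v t x ^ p := by
      rw [hp, Real.rpow_sub_one h0.ne']
      field_simp
    rw [h4]
    calc _ ≤ speedWeight v t x * (2 ^ p * X (speedWeight v t x)) := by gcongr
      _ = 2 ^ p * (speedWeight v t x * X (speedWeight v t x)) := by ring
      _ ≤ _ := by gcongr
  have cΨ := h.continuous_comp_speedWeight htT hΨc
  have cP : Continuous fun x => speedWeight v t x ^ (γ / 2) :=
    h.continuous_comp_speedWeight htT (φ := fun r => r ^ (γ / 2)) fun r hr =>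
      (Real.continuousAt_rpow_const r _ (Or.inl (ne_of_gt hr))).continuousWithinAt
  have h5 := integral_torus_mono cP
    (continuous_const.mul ((continuous_const.mul cΨ).add continuous_const)) hpt
  have h6 : ∫ x, 2 ^ p * ((1 + p) * Ψ (speedWeight v t x) + 1) ∂torusMeasure
      = 2 ^ p * ((1 + p) * ∫ x, Ψ (speedWeight v t x) ∂torusMeasure + 1) := by
    rw [integral_const_mul, integral_add ((integrable_torus cΨ).const_mul _)
      (integrable_const 1), integral_const_mul]
    simp
  have h7 : (2 : ℝ) ^ (γ / 2) = 2 ^ p * 2 := by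
    rw [hp, Real.rpow_sub_one (by norm_num)]
    field_simp
  have h8 : γ / 2 = 1 + p := by rw [hp]; ring
  have h9 : (0 : ℝ) < 2 ^ p := by positivity
  calc _ ≤ 2 ^ p * ((1 + p) * ∫ x, Ψ (speedWeight v t x) ∂torusMeasure + 1) := h5.trans h6.le
    _ ≤ 2 ^ p * ((1 + p) * (∫ x, Ψ (speedWeight v t x) ∂torusMeasure + 1)) := by
        gcongr
        nlinarith
    _ ≤ 2 ^ p * ((1 + p) * (2 * (F0 + L * 0 + 1))) := by gcongr
    _ = _ := by rw [h7, ← h8]; ring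

end ThermalFlow

/-! ### Polynomial growth of the `L^γ` moment -/

theorem hasDerivAt_rpow_const_of_pos (p : ℝ) {r : ℝ} (hr : r ∈ Ioi (0 : ℝ)) :
    HasDerivAt (fun r : ℝ => r ^ p) (p * r ^ (p - 1)) r :=
  Real.hasDerivAt_rpow_const (Or.inl (ne_of_gt hr))

theorem continuousOn_rpow_const_Ioi (p : ℝ) : ContinuousOn (fun r : ℝ => r ^ p) (Ioi 0) :=
  fun _ hr => (Real.continuousAt_rpow_const _ _ (Or.inl (ne_of_gt hr))).continuousWithinAt

namespace ThermalFlow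

variable {ν κ γ T : ℝ} {v : Fin 3 → ℝ → E3 → ℝ} {θ : ℝ → E3 → ℝ}

/-- `θ` lies above the solution `1 / (1 + 3 t / (8 ν))` of the comparison equation. -/
def AboveBarrier (ν T : ℝ) (θ : ℝ → E3 → ℝ) : Prop :=
  ∀ t ∈ Ioc 0 T, ∀ x, 1 / (1 + 3 / (8 * ν) * t) ≤ θ t x

theorem AboveBarrier.pos (hb : AboveBarrier ν T θ) (hν : 0 < ν) {t : ℝ} (ht : t ∈ Ioc 0 T)
    (x : E3) : 0 < θ t x := by
  have := ht.1
  exact (by positivity : 0 < 1 / (1 + 3 / (8 * ν) * t)).trans_le (hb t ht x)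

theorem hasDerivAt_integral_rpow (h : ThermalFlow ν κ γ T v θ) {t : ℝ} (ht : t ∈ Ioo 0 T) :
    HasDerivAt (fun t => ∫ x, speedWeight v t x ^ (γ / 2) ∂torusMeasure)
      (∫ x, γ / 2 * speedWeight v t x ^ (γ / 2 - 1)
        * ∑ j, 2 * v j t x * timeDeriv T (v j) t x ∂torusMeasure) t :=
  (h.timeC1_speedWeight.comp (S := Ioi 0) (fun _ hr => hasDerivAt_rpow_const_of_pos (γ / 2) hr)
    (continuousOn_const.mul (continuousOn_rpow_const_Ioi _))
    fun t _ x => zero_lt_one.trans_le (one_le_speedWeight v t x)).hasDerivAt_integral ht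

/-- For `Ψ(r) = r^{γ/2}` the bracket `Ψ - (2/γ)(r - 1)Ψ'` collapses to `r^{γ/2-1}`; this is the role
of the coefficient `1/γ` in the momentum equation. The remaining factor `div v` is absorbed by one
unit of viscosity at the price of `1/θ`, which the barrier bounds. Since the viscous term comes with
a factor `γ ≥ 2`, one unit is left over. -/
theorem rpow_energy_rate_le (h : ThermalFlow ν κ γ T v θ) (hν : 0 < ν) (hγ : 2 ≤ γ)
    (hb : AboveBarrier ν T θ) {t : ℝ} (ht : t ∈ Ioc 0 T) :
    ∫ x, γ / 2 * speedWeight v t x ^ (γ / 2 - 1)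
        * ∑ j, 2 * v j t x * timeDeriv T (v j) t x ∂torusMeasure
      ≤ -ν * (∫ x, θ t x * velGradSq v t x ∂torusMeasure)
        + 3 / (4 * ν) * (1 + 3 / (8 * ν) * t)
          * ∫ x, speedWeight v t x ^ (γ / 2 - 1) ∂torusMeasure := by
  set p := γ / 2 - 1 with hp
  have hp0 : 0 ≤ p := by rw [hp]; linarith
  have hθ := hb.pos hν ht
  have h1 := h.integral_entropy_rate_le hν ht hθ (Ψ := fun r => r ^ (γ / 2))
    (X := fun r => γ / 2 * r ^ p) (X1 := fun r => γ / 2 * (p * r ^ (p - 1)))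
    (fun r hr => hasDerivAt_rpow_const_of_pos (γ / 2) hr)
    (fun r hr => (hasDerivAt_rpow_const_of_pos p hr).const_mul (γ / 2))
    (continuousOn_const.mul (continuousOn_const.mul (continuousOn_rpow_const_Ioi _)))
    (fun r hr => by
      have hr : 0 < r := hr
      positivity)
  refine h1.trans ?_
  have cP := h.continuous_comp_speedWeight ht (continuousOn_rpow_const_Ioi p)
  have cP2 := h.continuous_comp_speedWeight ht (continuousOn_rpow_const_Ioi (γ / 2))
  obtain ⟨P, hP⟩ : ∃ f : E3 → ℝ, ∀ x, f x = speedWeight v t x ^ p := ⟨_, fun _ => rfl⟩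
  obtain ⟨P2, hP2⟩ : ∃ f : E3 → ℝ, ∀ x, f x = speedWeight v t x ^ (γ / 2) := ⟨_, fun _ => rfl⟩
  have cP : Continuous P := by rw [funext hP]; exact cP
  have cP2 : Continuous P2 := by rw [funext hP2]; exact cP2
  have cg : Continuous (velGradSq v t) := h.jointCont_velGradSq.slice ht
  have cd : Continuous (velDiv v t) := h.jointCont_velDiv.slice ht
  have cθ : Continuous (θ t) := h.regular_θ.timeC1.cont.slice ht
  have cW : Continuous (speedWeight v t) := h.timeC1_speedWeight.cont.slice ht
  simp only [← hP, ← hP2]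
  have hle : ∀ x, (P2 x - 2 / γ * ((speedWeight v t x - 1) * (γ / 2 * P x))) * velDiv v t x
      - 2 * ν * (θ t x * (γ / 2 * P x) * velGradSq v t x)
      ≤ -ν * (θ t x * velGradSq v t x) + 3 / (4 * ν) * (1 + 3 / (8 * ν) * t) * P x := fun x => by
    have a1 := one_le_speedWeight v t x
    have a2 := velDiv_sq_le v t x
    have a3 := velGradSq_nonneg v t x
    have a4 := hb t ht x
    have a5 := hθ x
    have a6 : P2 x = speedWeight v t x * P x := by
      rw [hP, hP2, hp, Real.rpow_sub_one (by positivity)]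
      field_simp
    have a7 : 1 ≤ P x := by
      rw [hP]
      exact Real.one_le_rpow a1 hp0
    rw [a6]
    have a8 : 1 / θ t x ≤ 1 + 3 / (8 * ν) * t := by
      have := ht.1
      rw [div_le_comm₀ a5 (by positivity)]
      exact a4
    generalize speedWeight v t x = w at *
    generalize velDiv v t x = d at *
    generalize velGradSq v t x = g at *
    generalize θ t x = q at *
    generalize P x = y at *
    have e : (w * y - 2 / γ * ((w - 1) * (γ / 2 * y))) = y := by
      field_simp
      ring
    rw [e]
    have b1 : d ≤ ν * q * g + 3 / (4 * ν) * (1 / q) := by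
      have e2 : ν * q / 3 * d ^ 2 + 3 / (4 * ν) * (1 / q) - d
          = (1 / (12 * (ν * q))) * (2 * (ν * q) * d - 3) ^ 2 := by
        field_simp
        ring
      have : 0 ≤ (1 / (12 * (ν * q))) * (2 * (ν * q) * d - 3) ^ 2 := by positivity
      have h5 : ν * q / 3 * d ^ 2 ≤ ν * q / 3 * (3 * g) := by gcongr
      linarith
    have b2 : 3 / (4 * ν) * (1 / q) ≤ 3 / (4 * ν) * (1 + 3 / (8 * ν) * t) := by gcongr
    have b3 : y * d ≤ y * (ν * q * g + 3 / (4 * ν) * (1 + 3 / (8 * ν) * t)) := by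
      gcongr
      linarith
    have b4 : 0 ≤ ν * q * g := by positivity
    have b5 : 2 * (y * (ν * q * g)) ≤ γ * (y * (ν * q * g)) := by gcongr
    have b6 : 1 * (ν * q * g) ≤ y * (ν * q * g) := by gcongr
    nlinarith
  refine (integral_torus_mono (by fun_prop) (by fun_prop) hle).trans (le_of_eq ?_)
  rw [integral_torus_add (by fun_prop) (by fun_prop), integral_const_mul, integral_const_mul]

theorem integral_rpow_le (h : ThermalFlow ν κ γ T v θ) (hγ : 2 ≤ γ) {t : ℝ} (ht : t ∈ Ioc 0 T) :
    1 ≤ ∫ x, speedWeight v t x ^ (γ / 2) ∂torusMeasure ∧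
    ∫ x, speedWeight v t x ^ (γ / 2 - 1) ∂torusMeasure
      ≤ ∫ x, speedWeight v t x ^ (γ / 2) ∂torusMeasure ∧
    ∫ x, speedWeight v t x ^ (γ / 2 - 1) ∂torusMeasure
      ≤ 2 * (∫ x, speedWeight v t x ^ (γ / 2) ∂torusMeasure) ^ (1 - 2 / γ) := by
  have cP := h.continuous_comp_speedWeight ht (continuousOn_rpow_const_Ioi (γ / 2 - 1))
  have cP2 := h.continuous_comp_speedWeight ht (continuousOn_rpow_const_Ioi (γ / 2))
  set F := ∫ x, speedWeight v t x ^ (γ / 2) ∂torusMeasure with hF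
  have hF1 : 1 ≤ F := by
    have : ∫ _ : E3, (1 : ℝ) ∂torusMeasure ≤ F :=
      integral_torus_mono continuous_const cP2 fun x =>
        Real.one_le_rpow (one_le_speedWeight v t x) (by linarith)
    simpa using this
  have hF0 : 0 < F := by linarith
  refine ⟨hF1, integral_torus_mono cP cP2 fun x =>
    Real.rpow_le_rpow_of_exponent_le (one_le_speedWeight v t x) (by linarith), ?_⟩
  -- Cutting `1 + |v|²` at this level makes the two pieces equal, each contributing `F^{1-2/γ}`;
  -- hence the factor 2.
  set l := F ^ (2 / γ) with hl
  have hl0 : 0 < l := by positivity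
  have hle : ∀ x, speedWeight v t x ^ (γ / 2 - 1)
      ≤ l ^ (γ / 2 - 1) + 1 / l * speedWeight v t x ^ (γ / 2) := fun x => by
    have h0 : 0 < speedWeight v t x := zero_lt_one.trans_le (one_le_speedWeight v t x)
    rcases le_total (speedWeight v t x) l with hc | hc
    · have : speedWeight v t x ^ (γ / 2 - 1) ≤ l ^ (γ / 2 - 1) :=
        Real.rpow_le_rpow h0.le hc (by linarith)
      have h2 : 0 ≤ 1 / l * speedWeight v t x ^ (γ / 2) := by positivity
      linarith
    · rw [Real.rpow_sub_one h0.ne', one_div_mul_eq_div]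
      have h2 : 0 ≤ l ^ (γ / 2 - 1) := by positivity
      have h3 : speedWeight v t x ^ (γ / 2) / speedWeight v t x
          ≤ speedWeight v t x ^ (γ / 2) / l := by gcongr
      linarith
  have hmono := integral_torus_mono cP (continuous_const.add (continuous_const.mul cP2)) hle
  refine hmono.trans (le_of_eq ?_)
  change ∫ x, l ^ (γ / 2 - 1) + 1 / l * speedWeight v t x ^ (γ / 2) ∂torusMeasure = _
  rw [integral_add (integrable_const _) ((integrable_torus cP2).const_mul _), integral_const_mul,
    ← hF]
  have e1 : l ^ (γ / 2 - 1) = F ^ (1 - 2 / γ) := by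
    rw [hl, ← Real.rpow_mul hF0.le]
    congr 1
    field_simp
  have e2 : 1 / l * F = F ^ (1 - 2 / γ) := by
    rw [hl, Real.rpow_sub hF0, Real.rpow_one]
    ring
  rw [e1, e2]
  simp
  ring

/-- The rate of the moment `F` is of order `(1 + t) F^{1-2/γ}`, so `F^{2/γ}` grows at most
quadratically and no exponential appears. With this bound inserted, integrating the same rate
inequality a second time controls the dissipation. -/
theorem exists_energy_bound {ν γ F0 : ℝ} (hν : 0 < ν) (hγ : 2 ≤ γ) (hF0 : 0 ≤ F0) :
    ∃ C, 1 ≤ C ∧ ∀ (κ T : ℝ) (v : Fin 3 → ℝ → E3 → ℝ) (θ : ℝ → E3 → ℝ),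
      ThermalFlow ν κ γ T v θ → AboveBarrier ν T θ →
      (∃ s0, 0 < s0 ∧ ∀ t ∈ Ioo 0 s0, ∫ x, speedWeight v t x ^ (γ / 2) ∂torusMeasure ≤ F0) →
      ∀ t ∈ Ioc 0 T,
        ∫ x, speedWeight v t x ^ (γ / 2) ∂torusMeasure ≤ C * (1 + t) ^ γ ∧
        ∀ s, 0 < s → s ≤ t →
          ∫ r in s..t, (∫ x, θ r x * velGradSq v r x ∂torusMeasure) ≤ C * (1 + t) ^ (γ + 2) := by
  set c1 := 1 + 3 / (8 * ν) with hc1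
  set c2 := F0 ^ (2 / γ) + 3 / (2 * ν) * c1 with hc2
  have hc10 : 0 < c1 := by positivity
  have hc20 : 0 < c2 := by positivity
  set C1 := c2 ^ (γ / 2) with hC1
  have hC10 : 0 < C1 := by positivity
  set C2 := 1 / ν * ((1 + 3 / (4 * ν) * c1) * C1) with hC2
  have hC20 : 0 < C2 := by positivity
  refine ⟨1 + C1 + C2, by linarith, fun κ T v θ h hb hs0 => ?_⟩
  obtain ⟨s0, hs00, hs0⟩ := hs0
  set F : ℝ → ℝ := fun t => ∫ x, speedWeight v t x ^ (γ / 2) ∂torusMeasure with hF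
  set Y : ℝ → ℝ := fun t => ∫ x, θ t x * velGradSq v t x ∂torusMeasure with hY
  have hell : ∀ t, 0 < t → 1 + 3 / (8 * ν) * t ≤ c1 * (1 + t) := fun t ht => by
    have : 0 < 3 / (8 * ν) := by positivity
    rw [hc1]
    nlinarith
  have hFc : ContinuousOn F (Ioc 0 T) :=
    (h.timeC1_speedWeight.cont.comp (continuousOn_rpow_const_Ioi (γ / 2))
      fun t _ x => zero_lt_one.trans_le (one_le_speedWeight v t x)).continuousOn_integral
  have hFbound : ∀ t ∈ Ioc 0 T, F t ≤ C1 * (1 + t) ^ γ := fun t ht => by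
    set s := min (s0 / 2) t with hs
    have hs1 : 0 < s := lt_min (by linarith) ht.1
    have hst : s ≤ t := min_le_right _ _
    have hFs : F s ≤ F0 := hs0 s ⟨hs1, (min_le_left _ _).trans_lt (by linarith)⟩
    have hsub : Ioc 0 t ⊆ Ioc 0 T := Ioc_subset_Ioc_right ht.2
    have hd : ∀ r ∈ Ioo 0 t, HasDerivAt (fun r => F r ^ (2 / γ))
        ((∫ x, γ / 2 * speedWeight v r x ^ (γ / 2 - 1)
          * ∑ j, 2 * v j r x * timeDeriv T (v j) r x ∂torusMeasure)
          * (2 / γ) * F r ^ (2 / γ - 1)) r := fun r hr => by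
      have hrT : r ∈ Ioo 0 T := ⟨hr.1, hr.2.trans_le ht.2⟩
      have h1 := (h.integral_rpow_le hγ (Ioo_subset_Ioc_self hrT)).1
      exact (h.hasDerivAt_integral_rpow hrT).rpow_const (Or.inl (by linarith))
    have hle := sub_le_integral_of_hasDerivAt_le (T := t) (φ := fun _ => 3 / (2 * ν) * (c1 * (1 + t)))
      (ContinuousOn.rpow_const (hFc.mono hsub) fun r hr => Or.inl (by
        have := (h.integral_rpow_le hγ (hsub hr)).1
        exact (zero_lt_one.trans_le this).ne')) hd continuousOn_const (fun r hr => by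
          have hrT : r ∈ Ioc 0 T := ⟨hr.1, hr.2.le.trans ht.2⟩
          have h1 := h.rpow_energy_rate_le hν hγ hb hrT
          obtain ⟨h2, -, h3⟩ := h.integral_rpow_le hγ hrT
          have h4 : 0 ≤ Y r := integral_nonneg fun x =>
            mul_nonneg (hb.pos hν hrT x).le (velGradSq_nonneg v r x)
          have hr0 := hr.1
          have h5 : 1 + 3 / (8 * ν) * r ≤ c1 * (1 + t) :=
            (hell r hr.1).trans (by have := hr.2; gcongr)
          have hF1 : 0 < F r := zero_lt_one.trans_le h2
          have ht0 := ht.1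
          have h6 : 3 / (4 * ν) * (1 + 3 / (8 * ν) * r)
              * ∫ x, speedWeight v r x ^ (γ / 2 - 1) ∂torusMeasure
              ≤ 3 / (4 * ν) * (c1 * (1 + t)) * (2 * F r ^ (1 - 2 / γ)) := by
            have h7 : 0 ≤ ∫ x, speedWeight v r x ^ (γ / 2 - 1) ∂torusMeasure :=
              integral_nonneg fun x => by
                have := one_le_speedWeight v r x
                positivity
            gcongr
          have h8 : 0 ≤ ν * Y r := by positivity
          have h9 := h1.trans (add_le_add (by linarith : -ν * Y r ≤ 0) h6)
          have h10 : 0 ≤ 2 / γ * F r ^ (2 / γ - 1) := by positivity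
          have h11 := mul_le_mul_of_nonneg_right h9 h10
          have h12 : F r ^ (1 - 2 / γ) * F r ^ (2 / γ - 1) = 1 := by
            rw [← Real.rpow_add hF1]
            simp
          have h13 : 2 / γ ≤ 1 := by rw [div_le_one (by linarith)]; exact hγ
          have h14 : 0 ≤ 3 / (2 * ν) * (c1 * (1 + t)) := by
            have := ht.1
            positivity
          calc _ = _ := mul_assoc _ _ _
            _ ≤ _ := h11
            _ = 2 / γ * (3 / (2 * ν) * (c1 * (1 + t)))
                * (F r ^ (1 - 2 / γ) * F r ^ (2 / γ - 1)) := by ring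
            _ ≤ _ := by
              rw [h12, mul_one]
              exact mul_le_of_le_one_left h14 h13) hs1 hst le_rfl
    rw [intervalIntegral.integral_const, smul_eq_mul] at hle
    have ht0 := ht.1
    have h1 : F t ^ (2 / γ) ≤ c2 * (1 + t) ^ 2 := by
      have h2 : F s ^ (2 / γ) ≤ F0 ^ (2 / γ) :=
        Real.rpow_le_rpow (zero_le_one.trans (h.integral_rpow_le hγ ⟨hs1, hst.trans ht.2⟩).1) hFs
          (by positivity)
      have h3 : (t - s) * (3 / (2 * ν) * (c1 * (1 + t))) ≤ (1 + t) * (3 / (2 * ν) * (c1 * (1 + t))) :=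
        by gcongr; linarith
      have h4 : F0 ^ (2 / γ) * 1 ≤ F0 ^ (2 / γ) * (1 + t) ^ 2 := by
        gcongr
        nlinarith
      rw [hc2]
      nlinarith
    have hFt0 : 0 < F t := zero_lt_one.trans_le (h.integral_rpow_le hγ ht).1
    have h5 := Real.rpow_le_rpow (by positivity) h1 (by linarith : 0 ≤ γ / 2)
    rw [← Real.rpow_mul hFt0.le, Real.mul_rpow hc20.le (by positivity), ← Real.rpow_natCast,
      ← Real.rpow_mul (by positivity)] at h5
    have e1 : 2 / γ * (γ / 2) = 1 := by field_simp
    have e2 : ((2 : ℕ) : ℝ) * (γ / 2) = γ := by push_cast; ring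
    rwa [e1, e2, Real.rpow_one] at h5
  intro t ht
  have ht0 := ht.1
  have h1t : (0 : ℝ) < (1 + t) ^ γ := by positivity
  refine ⟨(hFbound t ht).trans (by gcongr; linarith), fun s hs hst => ?_⟩
  have hYc : ContinuousOn Y (Ioc 0 T) :=
    (h.regular_θ.timeC1.cont.mul h.jointCont_velGradSq).continuousOn_integral
  have hsubT : Icc s t ⊆ Ioc 0 T := fun r hr => ⟨hs.trans_le hr.1, hr.2.trans ht.2⟩
  have hsub : Ioc 0 t ⊆ Ioc 0 T := Ioc_subset_Ioc_right ht.2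
  set D := 3 / (4 * ν) * (c1 * (1 + t)) * (C1 * (1 + t) ^ γ) with hD
  have hD0 : 0 ≤ D := by positivity
  have hle := sub_le_integral_of_hasDerivAt_le (T := t) (φ := fun r => -ν * Y r + D)
    (hFc.mono hsub) (fun r hr => h.hasDerivAt_integral_rpow ⟨hr.1, hr.2.trans_le ht.2⟩)
    ((continuousOn_const.mul (hYc.mono hsub)).add continuousOn_const) (fun r hr => by
      have hrT : r ∈ Ioc 0 T := ⟨hr.1, hr.2.le.trans ht.2⟩
      have h1 := h.rpow_energy_rate_le hν hγ hb hrT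
      obtain ⟨h2, h3, -⟩ := h.integral_rpow_le hγ hrT
      have hr0 := hr.1
      refine h1.trans (add_le_add le_rfl ?_)
      have h5 : 1 + 3 / (8 * ν) * r ≤ c1 * (1 + t) :=
        (hell r hr.1).trans (by have := hr.2; gcongr)
      have h6 : ∫ x, speedWeight v r x ^ (γ / 2 - 1) ∂torusMeasure ≤ C1 * (1 + t) ^ γ := by
        refine h3.trans ((hFbound r hrT).trans ?_)
        have := hr.2
        gcongr
      have h7 : 0 ≤ ∫ x, speedWeight v r x ^ (γ / 2 - 1) ∂torusMeasure :=
        integral_nonneg fun x => by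
          have := one_le_speedWeight v r x
          positivity
      rw [hD]
      gcongr) hs hst le_rfl
  have hYi : IntervalIntegrable Y volume s t :=
    (hYc.mono (by rw [uIcc_of_le hst]; exact hsubT)).intervalIntegrable
  rw [intervalIntegral.integral_add (hYi.const_mul _) intervalIntegrable_const,
    intervalIntegral.integral_const_mul, intervalIntegral.integral_const, smul_eq_mul] at hle
  have h8 : F s ≤ C1 * (1 + t) ^ γ :=
    (hFbound s (hsubT ⟨le_rfl, hst⟩)).trans (by gcongr)
  have h9 : 0 < F t := zero_lt_one.trans_le (h.integral_rpow_le hγ ht).1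
  have h10 : (t - s) * D ≤ (1 + t) * D := by gcongr; linarith
  have h11 : ν * ∫ r in s..t, Y r ≤ C1 * (1 + t) ^ γ + (1 + t) * D := by linarith
  have e : (1 + t) ^ (γ + 2) = (1 + t) ^ γ * (1 + t) ^ 2 := by
    rw [Real.rpow_add (by positivity), Real.rpow_two]
  have h12 : C1 * (1 + t) ^ γ + (1 + t) * D ≤ ν * (C2 * (1 + t) ^ (γ + 2)) := by
    have e2 : ν * (C2 * (1 + t) ^ (γ + 2))
        = C1 * (1 + t) ^ γ * (1 + t) ^ 2 + (1 + t) * D := by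
      rw [e, hD, hC2]
      field_simp
    rw [e2]
    have : C1 * (1 + t) ^ γ * 1 ≤ C1 * (1 + t) ^ γ * (1 + t) ^ 2 := by
      gcongr
      nlinarith
    linarith
  have h13 := le_of_mul_le_mul_left (h11.trans h12) hν
  refine h13.trans ?_
  gcongr
  linarith

end ThermalFlow

/-! ### Pointwise dissipation of the weighted gradient -/

theorem pd_comm {f : E3 → ℝ} (hf : ContDiff ℝ 2 f) (i k : Fin 3) (x : E3) :
    pd i (pd k f) x = pd k (pd i f) x := by
  have hd : DifferentiableAt ℝ (fderiv ℝ f) x :=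
    (hf.fderiv_right (m := 1) (by norm_num)).differentiable (by norm_num) x
  have e : ∀ i k, pd i (pd k f) x
      = fderiv ℝ (fderiv ℝ f) x (EuclideanSpace.single i 1) (EuclideanSpace.single k 1) :=
    fun i k => by
      have h1 := (hd.hasFDerivAt.clm_apply
        (hasFDerivAt_const (EuclideanSpace.single k (1 : ℝ) : E3) x)).pd_eq i
      refine Eq.trans h1 ?_
      simp
  have hs : IsSymmSndFDerivAt ℝ f x := hf.contDiffAt.isSymmSndFDerivAt (by simp)
  rw [e, e, hs.eq]

/-- Pointwise dissipation in the weighted gradient estimate. The relation `a κ = ν (1 - a)` makes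
the terms in `X` cancel. -/
theorem weighted_dissipation_pointwise {a ν κ q g τ L X N vth d s : ℝ} {V P c : Fin 3 → ℝ}
    (hν : 0 < ν) (ha : 0 < a) (ha2 : a ≤ 1 / 2) (hκ : a * κ = ν * (1 - a)) (hg : 0 ≤ g)
    (hτ : 0 ≤ τ) (hs : 0 ≤ s) (hV : ∑ j, V j ^ 2 ≤ 3 * N) (hP : ∑ j, P j ^ 2 ≤ τ * g)
    (hc : ∑ j, c j ^ 2 ≤ 4 * (s * g)) (hvth : vth ^ 2 ≤ s * τ) (hd : d ^ 2 ≤ 3 * g) :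
    -a * (κ * (q * L + 2 * τ) + ν / 2 * g - (vth + 1 / 2 * (q * d))) * g
        - 2 * ∑ j, (ν * (V j + P j) - c j) * (V j - a * P j)
        + a * κ * (q * L * g - a * (τ * g) + 2 * (q * X))
        + 2 * ν * (∑ j, (V j ^ 2 + (1 - a) * (P j * V j)) - N - (1 - a) * (q * X))
      ≤ -ν * N - a * ν / 4 * (τ * g) - a * ν / 4 * g ^ 2 + 1 / ν * (q ^ 2 * g)
        + 1682 / (a * ν ^ 3) * s ^ 2 := by
  -- Intended meaning: `q = θ`, `L = Δθ`, `τ = |∇θ|²`, `g = |∇v|²`, `s = |v|²`, `N = θ²|∇²v|²`, `Vⱼ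
  -- = θΔvⱼ`, `Pⱼ = ∇θ·∇vⱼ`, `cⱼ` the transport term, `vth = v·∇θ`, `d = div v`, and `X` the mixed
  -- term. The terms in `L`, `Vⱼ²` and `PⱼVⱼ` cancel identically; the coefficient of `X` vanishes by
  -- the choice of `a`.
  have e : -a * (κ * (q * L + 2 * τ) + ν / 2 * g - (vth + 1 / 2 * (q * d))) * g
        - 2 * ∑ j, (ν * (V j + P j) - c j) * (V j - a * P j)
        + a * κ * (q * L * g - a * (τ * g) + 2 * (q * X))
        + 2 * ν * (∑ j, (V j ^ 2 + (1 - a) * (P j * V j)) - N - (1 - a) * (q * X))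
      = -2 * ν * N + 2 * ν * a * ∑ j, P j ^ 2 - (2 + a) * (a * κ) * (τ * g) - a * ν / 2 * g ^ 2
        + 2 * ∑ j, V j * c j - 2 * a * ∑ j, P j * c j + a * (vth * g) + a / 2 * (q * d * g)
        + 2 * (a * κ - ν * (1 - a)) * (q * X) := by
    simp only [Fin.sum_univ_three]
    ring
  rw [e, hκ]
  have hsg : 0 ≤ s * g := mul_nonneg hs hg
  have hτg : 0 ≤ τ * g := mul_nonneg hτ hg
  have b1 : 2 * ∑ j, V j * c j ≤ ν * N + 12 / ν * (s * g) := by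
    have : ∀ j, 2 * (V j * c j) ≤ ν / 3 * V j ^ 2 + 3 / ν * c j ^ 2 := fun j => by
      have e : ν / 3 * V j ^ 2 + 3 / ν * c j ^ 2 - 2 * (V j * c j)
          = 1 / (3 * ν) * (ν * V j - 3 * c j) ^ 2 := by field_simp; ring
      have : 0 ≤ 1 / (3 * ν) * (ν * V j - 3 * c j) ^ 2 := by positivity
      linarith
    have h1 := Finset.sum_le_sum fun j (_ : j ∈ Finset.univ) => this j
    rw [Finset.sum_add_distrib, ← Finset.mul_sum, ← Finset.mul_sum, ← Finset.mul_sum] at h1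
    have h2 : ν / 3 * ∑ j, V j ^ 2 ≤ ν / 3 * (3 * N) := by gcongr
    have h3 : 3 / ν * ∑ j, c j ^ 2 ≤ 3 / ν * (4 * (s * g)) := by gcongr
    have h4 : 3 / ν * (4 * (s * g)) = 12 / ν * (s * g) := by ring
    linarith
  have b2 : -(2 * ∑ j, P j * c j) ≤ ν / 8 * (τ * g) + 32 / ν * (s * g) := by
    have : ∀ j, -(2 * (P j * c j)) ≤ ν / 8 * P j ^ 2 + 8 / ν * c j ^ 2 := fun j => by
      have e : ν / 8 * P j ^ 2 + 8 / ν * c j ^ 2 + 2 * (P j * c j)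
          = 1 / (8 * ν) * (ν * P j + 8 * c j) ^ 2 := by field_simp; ring
      have : 0 ≤ 1 / (8 * ν) * (ν * P j + 8 * c j) ^ 2 := by positivity
      linarith
    have h1 := Finset.sum_le_sum fun j (_ : j ∈ Finset.univ) => this j
    rw [Finset.sum_add_distrib, ← Finset.mul_sum, ← Finset.mul_sum, Finset.sum_neg_distrib,
      ← Finset.mul_sum] at h1
    have h2 : ν / 8 * ∑ j, P j ^ 2 ≤ ν / 8 * (τ * g) := by gcongr
    have h3 : 8 / ν * ∑ j, c j ^ 2 ≤ 8 / ν * (4 * (s * g)) := by gcongr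
    have h4 : 8 / ν * (4 * (s * g)) = 32 / ν * (s * g) := by ring
    linarith
  have b3 : vth * g ≤ ν / 8 * (τ * g) + 2 / ν * (s * g) := by
    have h1 : vth ≤ ν / 8 * τ + 2 / ν * s := by
      refine abs_le_of_sq_le_sq' ?_ (by positivity) |>.2
      have e : (ν / 8 * τ + 2 / ν * s) ^ 2 - s * τ = (ν / 8 * τ - 2 / ν * s) ^ 2 := by
        field_simp; ring
      nlinarith [sq_nonneg (ν / 8 * τ - 2 / ν * s)]
    have := mul_le_mul_of_nonneg_right h1 hg
    linarith
  have b4 : 1 / 2 * (q * d * g) ≤ ν / 8 * g ^ 2 + 3 / (2 * ν) * (q ^ 2 * g) := by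
    have h1 : q * d ≤ ν / 4 * g + 3 / ν * q ^ 2 := by
      have e : ν / 12 * d ^ 2 + 3 / ν * q ^ 2 - q * d = 1 / (12 * ν) * (ν * d - 6 * q) ^ 2 := by
        field_simp; ring
      have : 0 ≤ 1 / (12 * ν) * (ν * d - 6 * q) ^ 2 := by positivity
      have : ν / 12 * d ^ 2 ≤ ν / 12 * (3 * g) := by gcongr
      linarith
    have := mul_le_mul_of_nonneg_right h1 hg
    have h2 : 3 / (2 * ν) * (q ^ 2 * g) = 1 / 2 * (3 / ν * q ^ 2 * g) := by field_simp
    rw [h2]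
    linarith
  -- The transport terms add up to `12 + 34/2 = 29`, where `34 = 32 + 2` carries a factor `a ≤ 1/2`;
  -- completing the square gives `1682 = 2·29²`.
  have b5 : 29 / ν * (s * g) ≤ a * ν / 8 * g ^ 2 + 1682 / (a * ν ^ 3) * s ^ 2 := by
    have e : a * ν / 8 * g ^ 2 + 1682 / (a * ν ^ 3) * s ^ 2 - 29 / ν * (s * g)
        = 1 / (8 * a * ν ^ 3) * (a * ν ^ 2 * g - 116 * s) ^ 2 := by
      field_simp; ring
    have : 0 ≤ 1 / (8 * a * ν ^ 3) * (a * ν ^ 2 * g - 116 * s) ^ 2 := by positivity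
    linarith
  have c1 := mul_le_mul_of_nonneg_left hP (by positivity : 0 ≤ 2 * ν * a)
  have c2 := mul_le_mul_of_nonneg_left b2 ha.le
  have c3 := mul_le_mul_of_nonneg_left b3 ha.le
  have c4 := mul_le_mul_of_nonneg_left b4 ha.le
  have c5 : a * (34 / ν * (s * g)) ≤ 1 / 2 * (34 / ν * (s * g)) := by gcongr
  have c6 : a * (3 / (2 * ν) * (q ^ 2 * g)) ≤ 1 / ν * (q ^ 2 * g) := by
    have h1 : a * (3 / (2 * ν) * (q ^ 2 * g)) ≤ 1 / 2 * (3 / (2 * ν) * (q ^ 2 * g)) := by gcongr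
    have h2 : 1 / 2 * (3 / (2 * ν) * (q ^ 2 * g)) = 3 / 4 * (1 / ν * (q ^ 2 * g)) := by ring
    have h3 : 0 ≤ 1 / ν * (q ^ 2 * g) := by positivity
    linarith
  -- Collecting all terms in `ν τ g`, including the claimed dissipation, leaves the coefficient `-2
  -- + 7a/2 + a²`, which is nonpositive for `a ≤ 1/2` and zero at `a = 1/2`.
  have c7 : ν * a ^ 2 * (τ * g) ≤ ν * (a * (1 / 2)) * (τ * g) := by
    rw [sq]
    gcongr
  have c8 : ν * a * (τ * g) ≤ ν * (1 / 2) * (τ * g) := by gcongr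
  have e1 : 12 / ν * (s * g) + 1 / 2 * (34 / ν * (s * g)) = 29 / ν * (s * g) := by ring
  have e2 : a * (34 / ν * (s * g)) = a * (32 / ν * (s * g)) + a * (2 / ν * (s * g)) := by ring
  nlinarith

namespace ThermalFlow

variable {ν κ γ T : ℝ} {v : Fin 3 → ℝ → E3 → ℝ} {θ : ℝ → E3 → ℝ}

/-- `|∇²v|²`. -/
noncomputable def velHessSq (v : Fin 3 → ℝ → E3 → ℝ) (t : ℝ) (x : E3) : ℝ :=
  ∑ i, ∑ k, ∑ j, pd i (pd k (v j t)) x ^ 2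

/-- The time derivative of the density `θ^{-a} |∇v|²`, up to divergences. -/
noncomputable def weightedRate (a T : ℝ) (v : Fin 3 → ℝ → E3 → ℝ) (θ : ℝ → E3 → ℝ) (t : ℝ)
    (x : E3) : ℝ :=
  -a * θ t x ^ (-a - 1) * timeDeriv T θ t x * velGradSq v t x
    - ∑ i, ∑ j, timeDeriv T (v j) t x
      * (2 * (-a * θ t x ^ (-a - 1) * pd i (θ t) x * pd i (v j t) x
        + θ t x ^ (-a) * pd i (pd i (v j t)) x))

theorem contDiff_rpow_temperature (h : ThermalFlow ν κ γ T v θ) {t : ℝ} (ht : t ∈ Ioc 0 T)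
    (hpos : ∀ x, 0 < θ t x) (b : ℝ) : ContDiff ℝ 1 fun x => θ t x ^ b :=
  contDiff_one_comp isOpen_Ioi (fun _ hr => hasDerivAt_rpow_const_of_pos b hr)
    (continuousOn_const.mul (continuousOn_rpow_const_Ioi _))
    ((h.regular_θ.contDiff_space t ht).of_le (by norm_num)) hpos

theorem pd_rpow_temperature (h : ThermalFlow ν κ γ T v θ) {t : ℝ} (ht : t ∈ Ioc 0 T)
    (hpos : ∀ x, 0 < θ t x) (b : ℝ) (i : Fin 3) (x : E3) :
    pd i (fun x => θ t x ^ b) x = b * θ t x ^ (b - 1) * pd i (θ t) x :=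
  pd_comp (φ := fun r => r ^ b) (hasDerivAt_rpow_const_of_pos b (hpos x))
    ((h.regular_θ.contDiff_space t ht).differentiable (by norm_num) x) i

theorem contDiff_velGradSq (h : ThermalFlow ν κ γ T v θ) {t : ℝ} (ht : t ∈ Ioc 0 T) :
    ContDiff ℝ 1 (velGradSq v t) :=
  ContDiff.sum (s := .univ) fun i _ => ContDiff.sum (s := .univ) fun j _ =>
    ((h.contDiff_velocity ht j).pd (m := 1) (by norm_num) i).pow 2

theorem pd_velGradSq (h : ThermalFlow ν κ γ T v θ) {t : ℝ} (ht : t ∈ Ioc 0 T) (k : Fin 3)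
    (x : E3) : pd k (velGradSq v t) x
      = 2 * ∑ i, ∑ j, pd i (v j t) x * pd k (pd i (v j t)) x := by
  have hd := fun i j => ((h.contDiff_velocity ht j).pd (m := 1) (by norm_num) i).differentiable
    (by norm_num) x
  have hd2 : ∀ i j, DifferentiableAt ℝ (fun y => pd i (v j t) y ^ 2) x := fun i j =>
    (hd i j).pow 2
  have e : velGradSq v t = fun y => ∑ i, ∑ j, pd i (v j t) y ^ 2 := rfl
  rw [e, pd_sum _ fun i _ => DifferentiableAt.fun_sum fun j _ => hd2 i j]
  simp only [Finset.mul_sum]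
  refine Finset.sum_congr rfl fun i _ => ?_
  rw [pd_sum _ fun j _ => hd2 i j]
  refine Finset.sum_congr rfl fun j _ => ?_
  rw [pd_sq (hd i j), mul_assoc]

theorem periodic_velGradSq (h : ThermalFlow ν κ γ T v θ) {t : ℝ} (ht : t ∈ Ioc 0 T) :
    IsPeriodic3 (velGradSq v t) :=
  IsPeriodic3.sum (s := .univ) fun i _ => IsPeriodic3.sum (s := .univ) fun j _ =>
    (((h.regular_v j).periodic t ht).pd i).comp fun r => r ^ 2

/-- The divergence `∑ₖ ∂ₖ(θ^{-a} |∇v|² ∂ₖθ)`. -/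
noncomputable def heatFlux (a : ℝ) (v : Fin 3 → ℝ → E3 → ℝ) (θ : ℝ → E3 → ℝ) (t : ℝ)
    (x : E3) : ℝ :=
  ∑ k, pd k (fun y => θ t y ^ (-a) * (velGradSq v t y * pd k (θ t) y)) x

/-- The null form `∑ (θ^{1-a} (∂ᵢᵢvⱼ ∂ₖₖvⱼ - ...))` of vanishing integral. -/
noncomputable def hessianFlux (a : ℝ) (v : Fin 3 → ℝ → E3 → ℝ) (θ : ℝ → E3 → ℝ) (t : ℝ)
    (x : E3) : ℝ :=
  ∑ i, ∑ k, ∑ j, (θ t x ^ (1 - a) * pd k (pd k (v j t)) x * pd i (pd i (v j t)) x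
    + pd k (v j t) x * pd k (fun y => θ t y ^ (1 - a)) x * pd i (pd i (v j t)) x
    - pd k (pd i (v j t)) x * pd i (fun y => pd k (v j t) y * θ t y ^ (1 - a)) x)

theorem heatFlux_eq (h : ThermalFlow ν κ γ T v θ) {t : ℝ} (ht : t ∈ Ioc 0 T)
    (hpos : ∀ x, 0 < θ t x) (a : ℝ) (x : E3) :
    heatFlux a v θ t x = θ t x ^ (-a - 1) * (θ t x * (∑ k, pd k (pd k (θ t)) x) * velGradSq v t x
      - a * ((∑ k, pd k (θ t) x ^ 2) * velGradSq v t x)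
      + 2 * (θ t x * ∑ k, ∑ i, ∑ j, pd k (θ t) x * pd i (v j t) x * pd k (pd i (v j t)) x)) := by
  have hθ := hpos x
  have dθ : ∀ k, DifferentiableAt ℝ (pd k (θ t)) x := fun k =>
    ((h.regular_θ.contDiff_space t ht).pd (m := 1) (by norm_num) k).differentiable (by norm_num) x
  have dg : DifferentiableAt ℝ (velGradSq v t) x :=
    (h.contDiff_velGradSq ht).differentiable (by norm_num) x
  have dr : DifferentiableAt ℝ (fun y => θ t y ^ (-a)) x :=
    (h.contDiff_rpow_temperature ht hpos (-a)).differentiable (by norm_num) x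
  have e : ∀ k, pd k (fun y => θ t y ^ (-a) * (velGradSq v t y * pd k (θ t) y)) x
      = θ t x ^ (-a - 1) * (θ t x * pd k (pd k (θ t)) x * velGradSq v t x
        - a * (pd k (θ t) x ^ 2 * velGradSq v t x)
        + 2 * (θ t x * ∑ i, ∑ j, pd k (θ t) x * pd i (v j t) x * pd k (pd i (v j t)) x)) :=
    fun k => by
      have e1 : θ t x ^ (-a) = θ t x ^ (-a - 1) * θ t x := by
        rw [Real.rpow_sub_one hθ.ne']
        field_simp
      rw [pd_mul (g := fun y => velGradSq v t y * pd k (θ t) y) dr (dg.mul (dθ k)),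
        pd_mul dg (dθ k), h.pd_rpow_temperature ht hpos, h.pd_velGradSq ht, e1]
      have e2 : ∑ i, ∑ j, pd k (θ t) x * pd i (v j t) x * pd k (pd i (v j t)) x
          = pd k (θ t) x * ∑ i, ∑ j, pd i (v j t) x * pd k (pd i (v j t)) x := by
        simp only [Finset.mul_sum, mul_assoc]
      rw [e2]
      ring
  simp only [heatFlux, e]
  rw [← Finset.mul_sum, Finset.sum_add_distrib, Finset.sum_sub_distrib]
  simp only [Finset.mul_sum, Finset.sum_mul]

theorem hessianFlux_eq (h : ThermalFlow ν κ γ T v θ) {t : ℝ} (ht : t ∈ Ioc 0 T)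
    (hpos : ∀ x, 0 < θ t x) (a : ℝ) (x : E3) :
    hessianFlux a v θ t x = θ t x ^ (-a - 1)
      * (∑ j, ((∑ i, θ t x * pd i (pd i (v j t)) x) ^ 2
          + (1 - a) * ((∑ i, pd i (θ t) x * pd i (v j t) x)
            * ∑ i, θ t x * pd i (pd i (v j t)) x))
        - θ t x ^ 2 * velHessSq v t x
        - (1 - a) * (θ t x
          * ∑ k, ∑ i, ∑ j, pd k (θ t) x * pd i (v j t) x * pd k (pd i (v j t)) x)) := by
  have hθ := hpos x
  have dv : ∀ k j, DifferentiableAt ℝ (pd k (v j t)) x := fun k j =>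
    ((h.contDiff_velocity ht j).pd (m := 1) (by norm_num) k).differentiable (by norm_num) x
  have dr : DifferentiableAt ℝ (fun y => θ t y ^ (1 - a)) x :=
    (h.contDiff_rpow_temperature ht hpos (1 - a)).differentiable (by norm_num) x
  have e0 : θ t x ^ (-a) = θ t x ^ (-a - 1) * θ t x := by
    rw [Real.rpow_sub_one hθ.ne']
    field_simp
  have e1 : θ t x ^ (1 - a) = θ t x ^ (-a - 1) * θ t x ^ 2 := by
    rw [show 1 - a = -a + 1 by ring, Real.rpow_add_one hθ.ne', e0]
    ring
  have e2 : ∀ k, pd k (fun y => θ t y ^ (1 - a)) x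
      = (1 - a) * (θ t x ^ (-a - 1) * θ t x) * pd k (θ t) x := fun k => by
    rw [h.pd_rpow_temperature ht hpos, ← e0]
    congr 3
    ring
  have e3 : ∀ i k j, pd i (fun y => pd k (v j t) y * θ t y ^ (1 - a)) x
      = θ t x ^ (-a - 1) * (pd i (pd k (v j t)) x * θ t x ^ 2
        + (1 - a) * (θ t x * (pd k (v j t) x * pd i (θ t) x))) := fun i k j => by
    rw [pd_mul (dv k j) dr, e2, e1]
    ring
  simp only [hessianFlux, e1, e2, e3]
  have hc := fun i k j => pd_comm (h.contDiff_velocity ht j) i k x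
  simp only [velHessSq, Fin.sum_univ_three, hc 1 0, hc 2 0, hc 2 1]
  ring

theorem integral_heatFlux (h : ThermalFlow ν κ γ T v θ) {t : ℝ} (ht : t ∈ Ioc 0 T)
    (hpos : ∀ x, 0 < θ t x) (a : ℝ) : ∫ x, heatFlux a v θ t x ∂torusMeasure = 0 := by
  have hC2 := h.regular_θ.contDiff_space t ht
  have hp := h.regular_θ.periodic t ht
  have C : ∀ k, ContDiff ℝ 1 fun y => θ t y ^ (-a) * (velGradSq v t y * pd k (θ t) y) := fun k =>
    (h.contDiff_rpow_temperature ht hpos (-a)).mul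
      ((h.contDiff_velGradSq ht).mul (hC2.pd (by norm_num) k))
  have P : ∀ k, IsPeriodic3 fun y => θ t y ^ (-a) * (velGradSq v t y * pd k (θ t) y) := fun k =>
    (hp.comp fun r => r ^ (-a)).mul ((h.periodic_velGradSq ht).mul (hp.pd k))
  simp only [heatFlux]
  rw [integral_torus_sum _ fun k _ => (C k).continuous_pd k]
  simp [integral_pd_eq_zero (C _) (P _)]

/-- Each summand vanishes separately: it is `integral_mul_pd_mul_pd` with `w = θ^{1-a}`, `q = ∂ₖvⱼ`,
`p = ∂ᵢvⱼ`. The sum trades `|Δv|²` for `|∇²v|²` under a weight without using third derivatives. -/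
theorem integral_hessianFlux (h : ThermalFlow ν κ γ T v θ) {t : ℝ} (ht : t ∈ Ioc 0 T)
    (hpos : ∀ x, 0 < θ t x) (a : ℝ) : ∫ x, hessianFlux a v θ t x ∂torusMeasure = 0 := by
  have wC := h.contDiff_rpow_temperature ht hpos (1 - a)
  have wP : IsPeriodic3 fun y => θ t y ^ (1 - a) :=
    (h.regular_θ.periodic t ht).comp fun r => r ^ (1 - a)
  have pC : ∀ k j, ContDiff ℝ 1 (pd k (v j t)) := fun k j =>
    (h.contDiff_velocity ht j).pd (by norm_num) k
  have pP : ∀ k j, IsPeriodic3 (pd k (v j t)) := fun k j => ((h.regular_v j).periodic t ht).pd k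
  have c1 : ∀ i k j, Continuous (pd i (pd k (v j t))) := fun i k j => (pC k j).continuous_pd i
  have c2 : ∀ k j, Continuous (pd k (v j t)) := fun k j => (pC k j).continuous
  have c3 := wC.continuous
  have c4 : ∀ k, Continuous (pd k fun y => θ t y ^ (1 - a)) := fun k => wC.continuous_pd k
  have c5 : ∀ i k j, Continuous (pd i fun y => pd k (v j t) y * θ t y ^ (1 - a)) := fun i k j =>
    ((pC k j).mul wC).continuous_pd i
  simp only [hessianFlux]
  rw [integral_torus_sum _ fun i _ => by fun_prop]
  refine Finset.sum_eq_zero fun i _ => ?_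
  rw [integral_torus_sum _ fun k _ => by fun_prop]
  refine Finset.sum_eq_zero fun k _ => ?_
  rw [integral_torus_sum _ fun j _ => by fun_prop]
  refine Finset.sum_eq_zero fun j _ => ?_
  rw [integral_torus_sub (by fun_prop) (by fun_prop), integral_torus_add (by fun_prop) (by fun_prop),
    integral_mul_pd_mul_pd (pC i j) (pC k j) wC (pP i j) (pP k j) wP i k]
  ring

end ThermalFlow

/-- The transport term in the momentum equation is controlled by `|v|² |∇v|²`. -/
theorem sum_transport_sq_le {γ : ℝ} (hγ : 2 ≤ γ) (w : Fin 3 → ℝ) (G : Fin 3 → Fin 3 → ℝ) :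
    ∑ j, (∑ i, w i * G i j + 1 / γ * (w j * ∑ i, G i i)) ^ 2
      ≤ 4 * ((∑ i, w i ^ 2) * frobSq G) := by
  set s := ∑ i, w i ^ 2 with hs
  set d := ∑ i, G i i with hd
  have hs0 : 0 ≤ s := Finset.sum_nonneg fun _ _ => sq_nonneg _
  have hdd : d ^ 2 ≤ 3 * frobSq G := sq_sum_three_diag_le G
  have h1 : ∀ j, (∑ i, w i * G i j + 1 / γ * (w j * d)) ^ 2
      ≤ 2 * (s * ∑ i, G i j ^ 2) + 1 / 2 * (w j ^ 2 * d ^ 2) := fun j => by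
    have h2 := Finset.sum_mul_sq_le_sq_mul_sq Finset.univ w (fun i => G i j)
    have h3 := add_sq_le (a := ∑ i, w i * G i j) (b := 1 / γ * (w j * d))
    have h4 : (1 / γ) ^ 2 ≤ 1 / 4 := by
      rw [div_pow, one_pow, div_le_div_iff₀ (by positivity) (by norm_num)]
      nlinarith
    have h5 : (1 / γ * (w j * d)) ^ 2 ≤ 1 / 4 * (w j ^ 2 * d ^ 2) := by
      rw [mul_pow, mul_pow]
      gcongr
    linarith
  refine (Finset.sum_le_sum fun j _ => h1 j).trans ?_
  have e : ∑ j, ∑ i, G i j ^ 2 = frobSq G := Finset.sum_comm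
  rw [Finset.sum_add_distrib, ← Finset.mul_sum, ← Finset.mul_sum, ← Finset.mul_sum,
    ← Finset.sum_mul, e, ← hs]
  have := mul_le_mul_of_nonneg_left hdd hs0
  have h0 : 0 ≤ s * frobSq G := mul_nonneg hs0 (frobSq_nonneg G)
  linarith

/-- In use, `q = θ`, `p = θ^{a+1}` and `w = 1/p`, and the two alternatives for `p` correspond to `θ
≤ 1` and `θ ≥ 1`. If `q` is large against `y`, the term `q g` wins; if `g` is large against `y p`,
the quartic term wins. Otherwise `g` and `p` are bounded by powers of `y`, and `y⁶` absorbs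
everything. -/
theorem interpolation_pointwise {η l y g q p w : ℝ} (hη : 0 < η) (hl : 0 < l) (hy : 1 ≤ y)
    (hg : 0 ≤ g) (hq : 0 < q) (hp : 0 < p) (hpq : p ≤ q ∨ p ≤ q ^ 2) (hw : w * p = 1) :
    2 * l * (y * g) ≤ η * (w * g ^ 2) + 1 / 4 * y ^ 6 + (32 * l ^ 3 / η + 2 * l) * (q * g) := by
  have hy0 : 0 < y := by linarith
  have hw0 : 0 < w := pos_of_mul_pos_left (by rw [hw]; exact one_pos) hp.le
  have t1 : 0 ≤ η * (w * g ^ 2) := by positivity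
  have t2 : 0 ≤ 1 / 4 * y ^ 6 := by positivity
  have t3 : 0 ≤ 32 * l ^ 3 / η * (q * g) := by positivity
  have t4 : 0 ≤ 2 * l * (q * g) := by positivity
  rw [add_mul]
  rcases le_total y q with c1 | c1
  · have : 2 * l * (y * g) ≤ 2 * l * (q * g) := by gcongr
    linarith
  rcases le_total (2 * l * y * p) (η * g) with c2 | c2
  · have h1 : 2 * l * y * p * (w * g) ≤ η * g * (w * g) := by gcongr
    have e1 : 2 * l * y * p * (w * g) = 2 * l * (y * g) * (w * p) := by ring
    rw [e1, hw] at h1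
    linarith
  rcases le_total (η * y) (16 * l ^ 2 * q) with c3 | c3
  · have h1 : η * y * (2 * l * g) ≤ 16 * l ^ 2 * q * (2 * l * g) := by gcongr
    have h2 : 2 * l * (y * g) ≤ 32 * l ^ 3 / η * (q * g) := by
      rw [div_mul_eq_mul_div, le_div_iff₀ hη]
      linarith
    linarith
  · have hy1 : y ≤ y ^ 3 := le_self_pow₀ hy (by norm_num)
    have h3 : 16 * l ^ 2 * p ≤ η * y ^ 4 := by
      rcases hpq with c4 | c4
      · have : 16 * l ^ 2 * p ≤ 16 * l ^ 2 * q := by gcongr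
        have : η * y ≤ η * y ^ 4 := by
          gcongr
          exact le_self_pow₀ hy (by norm_num)
        linarith
      · have h5 : 16 * l ^ 2 * p ≤ 16 * l ^ 2 * q * q := by
          have : 16 * l ^ 2 * p ≤ 16 * l ^ 2 * q ^ 2 := by gcongr
          linarith
        have h6 : 16 * l ^ 2 * q * q ≤ η * y * y := by gcongr
        have h7 : η * y * y ≤ η * y ^ 4 := by
          have : y * y ≤ y ^ 4 := by nlinarith [one_le_pow₀ (n := 2) hy]
          nlinarith
        linarith
    have h4 : 2 * l * (y * g) * η ≤ 1 / 4 * y ^ 6 * η := by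
      have h5 : 2 * l * y * (η * g) ≤ 2 * l * y * (2 * l * y * p) := by gcongr
      have h6 : y ^ 2 / 4 * (16 * l ^ 2 * p) ≤ y ^ 2 / 4 * (η * y ^ 4) := by gcongr
      linarith
    have := le_of_mul_le_mul_right h4 hη
    linarith

namespace ThermalFlow

variable {ν κ γ T : ℝ} {v : Fin 3 → ℝ → E3 → ℝ} {θ : ℝ → E3 → ℝ}

theorem weightedRate_eq (h : ThermalFlow ν κ γ T v θ) {t : ℝ} (ht : t ∈ Ioc 0 T)
    (hpos : ∀ x, 0 < θ t x) (a : ℝ) (x : E3) :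
    weightedRate a T v θ t x = θ t x ^ (-a - 1)
      * (-a * (κ * (θ t x * (∑ k, pd k (pd k (θ t)) x) + 2 * ∑ k, pd k (θ t) x ^ 2)
          + ν / 2 * velGradSq v t x
          - (∑ i, v i t x * pd i (θ t) x + 1 / 2 * (θ t x * velDiv v t x))) * velGradSq v t x
        - 2 * ∑ j, (ν * (∑ i, θ t x * pd i (pd i (v j t)) x + ∑ i, pd i (θ t) x * pd i (v j t) x)
            - (∑ i, v i t x * pd i (v j t) x + 1 / γ * (v j t x * velDiv v t x)))
          * (∑ i, θ t x * pd i (pd i (v j t)) x - a * ∑ i, pd i (θ t) x * pd i (v j t) x)) := by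
  have e1 : θ t x ^ (-a) = θ t x ^ (-a - 1) * θ t x := by
    rw [Real.rpow_sub_one (hpos x).ne', div_mul_cancel₀ _ (hpos x).ne']
  have e2 : timeDeriv T θ t x = κ * (θ t x * (∑ k, pd k (pd k (θ t)) x)
      + 2 * ∑ k, pd k (θ t) x ^ 2) + ν / 2 * velGradSq v t x
      - (∑ i, v i t x * pd i (θ t) x + 1 / 2 * (θ t x * velDiv v t x)) :=
    h.timeDeriv_temperature ht (hpos x)
  have e3 : ∀ j, timeDeriv T (v j) t x
      = ν * (∑ i, θ t x * pd i (pd i (v j t)) x + ∑ i, pd i (θ t) x * pd i (v j t) x)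
        - (∑ i, v i t x * pd i (v j t) x + 1 / γ * (v j t x * velDiv v t x)) :=
    fun j => h.timeDeriv_velocity ht x j
  have e4 : ∑ i, ∑ j, timeDeriv T (v j) t x
      * (2 * (-a * θ t x ^ (-a - 1) * pd i (θ t) x * pd i (v j t) x
        + θ t x ^ (-a) * pd i (pd i (v j t)) x))
      = θ t x ^ (-a - 1) * (2 * ∑ j, timeDeriv T (v j) t x
        * (∑ i, θ t x * pd i (pd i (v j t)) x - a * ∑ i, pd i (θ t) x * pd i (v j t) x)) := by
    rw [e1]
    simp only [Fin.sum_univ_three]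
    ring
  rw [weightedRate, e4, e2]
  simp only [e3]
  ring

/-- The weights of the fluxes are forced: `a κ` removes `Δθ`, and `2ν` removes the squares of `Δvⱼ`.
All densities share the factor `θ^{-a-1}`, after which the claim is
`weighted_dissipation_pointwise`. -/
theorem weightedRate_add_flux_le (h : ThermalFlow ν κ γ T v θ) (hν : 0 < ν) (hγ : 2 ≤ γ) {a : ℝ}
    (ha : 0 < a) (ha2 : a ≤ 1 / 2) (hκ : a * κ = ν * (1 - a)) {t : ℝ} (ht : t ∈ Ioc 0 T)
    (hpos : ∀ x, 0 < θ t x) (x : E3) :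
    weightedRate a T v θ t x + a * κ * heatFlux a v θ t x + 2 * ν * hessianFlux a v θ t x
      ≤ θ t x ^ (-a - 1) * (-ν * (θ t x ^ 2 * velHessSq v t x)
        - a * ν / 4 * (gradSq (θ t) x * velGradSq v t x) - a * ν / 4 * velGradSq v t x ^ 2
        + 1 / ν * (θ t x ^ 2 * velGradSq v t x)
        + 1682 / (a * ν ^ 3) * (∑ j, v j t x ^ 2) ^ 2) := by
  rw [h.weightedRate_eq ht hpos, h.heatFlux_eq ht hpos, h.hessianFlux_eq ht hpos]
  have hω : 0 < θ t x ^ (-a - 1) := Real.rpow_pos_of_pos (hpos x) _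
  have hV : ∑ j, (∑ i, θ t x * pd i (pd i (v j t)) x) ^ 2
      ≤ 3 * (θ t x ^ 2 * velHessSq v t x) := by
    have h1 : ∀ j, (∑ i, θ t x * pd i (pd i (v j t)) x) ^ 2
        ≤ 3 * (θ t x ^ 2 * ∑ i, ∑ k, pd i (pd k (v j t)) x ^ 2) := fun j => by
      have h2 := sq_sum_three_diag_le fun i k => pd i (pd k (v j t)) x
      rw [← Finset.mul_sum, mul_pow]
      have := mul_le_mul_of_nonneg_left h2 (sq_nonneg (θ t x))
      rw [frobSq] at this
      linarith
    refine (Finset.sum_le_sum fun j _ => h1 j).trans (le_of_eq ?_)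
    simp only [velHessSq, Fin.sum_univ_three]
    ring
  have hP : ∑ j, (∑ i, pd i (θ t) x * pd i (v j t) x) ^ 2
      ≤ gradSq (θ t) x * velGradSq v t x := by
    have h1 : ∀ j, (∑ i, pd i (θ t) x * pd i (v j t) x) ^ 2
        ≤ gradSq (θ t) x * ∑ i, pd i (v j t) x ^ 2 := fun j =>
      Finset.sum_mul_sq_le_sq_mul_sq Finset.univ (fun i => pd i (θ t) x) fun i => pd i (v j t) x
    refine (Finset.sum_le_sum fun j _ => h1 j).trans (le_of_eq ?_)
    rw [← Finset.mul_sum, Finset.sum_comm]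
    rfl
  have hc : ∑ j, (∑ i, v i t x * pd i (v j t) x + 1 / γ * (v j t x * velDiv v t x)) ^ 2
      ≤ 4 * ((∑ j, v j t x ^ 2) * velGradSq v t x) :=
    sum_transport_sq_le hγ (fun i => v i t x) fun i j => pd i (v j t) x
  have hvth : (∑ i, v i t x * pd i (θ t) x) ^ 2 ≤ (∑ j, v j t x ^ 2) * gradSq (θ t) x :=
    Finset.sum_mul_sq_le_sq_mul_sq Finset.univ (fun i => v i t x) fun i => pd i (θ t) x
  have hmain := weighted_dissipation_pointwise (q := θ t x) (L := ∑ k, pd k (pd k (θ t)) x)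
    (X := ∑ k, ∑ i, ∑ j, pd k (θ t) x * pd i (v j t) x * pd k (pd i (v j t)) x)
    hν ha ha2 hκ (velGradSq_nonneg v t x) (gradSq_nonneg (θ t) x)
    (Finset.sum_nonneg fun j _ => sq_nonneg (v j t x)) hV hP hc hvth (velDiv_sq_le v t x)
  refine le_trans (le_of_eq ?_) (mul_le_mul_of_nonneg_left hmain hω.le)
  have e : ∑ k, pd k (θ t) x ^ 2 = gradSq (θ t) x := rfl
  rw [e]
  ring

end ThermalFlow

/-! ### Integrated dissipation and interpolation of the quartic moment -/

namespace ThermalFlow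

variable {ν κ γ T : ℝ} {v : Fin 3 → ℝ → E3 → ℝ} {θ : ℝ → E3 → ℝ}

theorem jointCont_velHessSq (h : ThermalFlow ν κ γ T v θ) : JointCont T (velHessSq v) :=
  JointCont.sum (s := .univ) fun i _ => JointCont.sum (s := .univ) fun k _ =>
    JointCont.sum (s := .univ) fun j _ => ((h.regular_v j).jointCont_pd_pd i k).pow 2

theorem jointCont_gradSq_temperature (h : ThermalFlow ν κ γ T v θ) :
    JointCont T fun t => gradSq (θ t) :=
  JointCont.sum (s := .univ) fun i _ => (h.regular_θ.jointCont_pd i).pow 2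

theorem jointCont_rpow_temperature (h : ThermalFlow ν κ γ T v θ)
    (hpos : ∀ t ∈ Ioc 0 T, ∀ x, 0 < θ t x) (b : ℝ) : JointCont T fun t x => θ t x ^ b :=
  h.regular_θ.timeC1.cont.comp (continuousOn_rpow_const_Ioi b) hpos

theorem velHessSq_nonneg (v : Fin 3 → ℝ → E3 → ℝ) (t : ℝ) (x : E3) : 0 ≤ velHessSq v t x :=
  Finset.sum_nonneg fun _ _ => Finset.sum_nonneg fun _ _ => Finset.sum_nonneg fun _ _ =>
    sq_nonneg _

theorem continuous_weightedRate (h : ThermalFlow ν κ γ T v θ)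
    {t : ℝ} (ht : t ∈ Ioc 0 T) (hpos : ∀ x, 0 < θ t x) (a : ℝ) :
    Continuous (weightedRate a T v θ t) := by
  have c1 := (h.contDiff_rpow_temperature ht hpos (-a - 1)).continuous
  have c2 := (h.contDiff_rpow_temperature ht hpos (-a)).continuous
  have c3 : Continuous (timeDeriv T θ t) := h.regular_θ.timeC1.cont_deriv.slice ht
  have c4 : ∀ j, Continuous (timeDeriv T (v j) t) := fun j =>
    (h.regular_v j).timeC1.cont_deriv.slice ht
  have c5 : Continuous (velGradSq v t) := h.jointCont_velGradSq.slice ht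
  have c6 : ∀ i, Continuous (pd i (θ t)) := fun i => (h.regular_θ.jointCont_pd i).slice ht
  have c7 : ∀ i j, Continuous (pd i (v j t)) := fun i j =>
    ((h.regular_v j).jointCont_pd i).slice ht
  have c8 : ∀ i k j, Continuous (pd i (pd k (v j t))) := fun i k j =>
    ((h.regular_v j).jointCont_pd_pd i k).slice ht
  refine (((continuous_const.mul c1).mul c3).mul c5).sub
    (continuous_finsetSum _ fun i _ => continuous_finsetSum _ fun j _ => (c4 j).mul
      (continuous_const.mul ((((continuous_const.mul c1).mul (c6 i)).mul (c7 i j)).add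
        (c2.mul (c8 i i j)))))

theorem continuous_heatFlux (h : ThermalFlow ν κ γ T v θ) {t : ℝ} (ht : t ∈ Ioc 0 T)
    (hpos : ∀ x, 0 < θ t x) (a : ℝ) : Continuous (heatFlux a v θ t) :=
  continuous_finsetSum _ fun k _ => ((h.contDiff_rpow_temperature ht hpos (-a)).mul
    ((h.contDiff_velGradSq ht).mul
      ((h.regular_θ.contDiff_space t ht).pd (m := 1) (by norm_num) k))).continuous_pd k

theorem continuous_hessianFlux (h : ThermalFlow ν κ γ T v θ) {t : ℝ} (ht : t ∈ Ioc 0 T)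
    (hpos : ∀ x, 0 < θ t x) (a : ℝ) : Continuous (hessianFlux a v θ t) := by
  have wC := h.contDiff_rpow_temperature ht hpos (1 - a)
  have pC : ∀ k j, ContDiff ℝ 1 (pd k (v j t)) := fun k j =>
    (h.contDiff_velocity ht j).pd (by norm_num) k
  refine continuous_finsetSum _ fun i _ => continuous_finsetSum _ fun k _ =>
    continuous_finsetSum _ fun j _ => ?_
  exact (((wC.continuous.mul ((pC k j).continuous_pd k)).mul ((pC i j).continuous_pd i)).add
    (((pC k j).continuous.mul (wC.continuous_pd k)).mul ((pC i j).continuous_pd i))).sub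
    (((pC i j).continuous_pd k).mul (((pC k j).mul wC).continuous_pd i))

theorem integral_weightedRate_le (h : ThermalFlow ν κ γ T v θ) (hν : 0 < ν) (hγ : 2 ≤ γ) {a : ℝ}
    (ha : 0 < a) (ha2 : a ≤ 1 / 2) (hκ : a * κ = ν * (1 - a)) {t : ℝ} (ht : t ∈ Ioc 0 T) {l : ℝ}
    (hl : 1 ≤ l) (hlow : ∀ x, 1 / l ≤ θ t x) :
    ∫ x, weightedRate a T v θ t x ∂torusMeasure
      ≤ -ν * (∫ x, θ t x ^ (1 - a) * velHessSq v t x ∂torusMeasure)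
        - a * ν / 4 * (∫ x, θ t x ^ (-a - 1) * velGradSq v t x * gradSq (θ t) x ∂torusMeasure)
        - a * ν / 4 * (∫ x, θ t x ^ (-a - 1) * velGradSq v t x ^ 2 ∂torusMeasure)
        + l / ν * (∫ x, θ t x * velGradSq v t x ∂torusMeasure)
        + 1682 / (a * ν ^ 3) * l ^ 2 * ∫ x, speedWeight v t x ^ 2 ∂torusMeasure := by
  have hl0 : 0 < l := by linarith
  have hpos : ∀ x, 0 < θ t x := fun x => (by positivity : 0 < 1 / l).trans_le (hlow x)
  have c1 := (h.contDiff_rpow_temperature ht hpos (-a - 1)).continuous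
  have c2 := (h.contDiff_rpow_temperature ht hpos (1 - a)).continuous
  have c3 : Continuous (velGradSq v t) := h.jointCont_velGradSq.slice ht
  have c4 : Continuous (velHessSq v t) := h.jointCont_velHessSq.slice ht
  have c5 : Continuous (gradSq (θ t)) := h.jointCont_gradSq_temperature.slice ht
  have c6 : Continuous (speedWeight v t) := h.timeC1_speedWeight.cont.slice ht
  have c7 : Continuous (θ t) := h.regular_θ.timeC1.cont.slice ht
  have c8 := h.continuous_weightedRate ht hpos a
  have c9 := h.continuous_heatFlux ht hpos a
  have c10 := h.continuous_hessianFlux ht hpos a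
  have hle : ∀ x, weightedRate a T v θ t x + a * κ * heatFlux a v θ t x
        + 2 * ν * hessianFlux a v θ t x
      ≤ -ν * (θ t x ^ (1 - a) * velHessSq v t x)
        - a * ν / 4 * (θ t x ^ (-a - 1) * velGradSq v t x * gradSq (θ t) x)
        - a * ν / 4 * (θ t x ^ (-a - 1) * velGradSq v t x ^ 2)
        + l / ν * (θ t x * velGradSq v t x)
        + 1682 / (a * ν ^ 3) * l ^ 2 * speedWeight v t x ^ 2 := fun x => by
    refine (h.weightedRate_add_flux_le hν hγ ha ha2 hκ ht hpos x).trans ?_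
    have hq := hpos x
    have hω : 0 < θ t x ^ (-a - 1) := Real.rpow_pos_of_pos hq _
    have e1 : θ t x ^ (1 - a) = θ t x ^ (-a - 1) * θ t x ^ 2 := by
      rw [← Real.rpow_two, ← Real.rpow_add hq]
      congr 1
      ring
    have hinv : (θ t x)⁻¹ ≤ l := by
      rw [inv_le_comm₀ hq hl0, ← one_div]
      exact hlow x
    -- Negative powers of `θ` are rounded up to natural powers of `l ≥ 1`, so that the final growth
    -- in time can be read off as a polynomial.
    have hn : ∀ r : ℝ, 0 ≤ r → ∀ n : ℕ, r ≤ n → θ t x ^ (-r) ≤ l ^ n := fun r hr n hrn => by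
      rw [Real.rpow_neg hq.le, ← Real.inv_rpow hq.le, ← Real.rpow_natCast]
      exact (Real.rpow_le_rpow (by positivity) hinv hr).trans
        (Real.rpow_le_rpow_of_exponent_le hl hrn)
    have e2 : θ t x ^ (-a - 1) ≤ l ^ 2 := by
      rw [show -a - 1 = -(a + 1) by ring]
      exact hn (a + 1) (by linarith) 2 (by push_cast; linarith)
    have e3 : θ t x ^ (-a - 1) * θ t x ≤ l := by
      rw [← Real.rpow_add_one hq.ne', show -a - 1 + 1 = -a by ring]
      simpa using hn a ha.le 1 (by push_cast; linarith)
    have hg := velGradSq_nonneg v t x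
    have b1 : θ t x ^ (-a - 1) * (1 / ν * (θ t x ^ 2 * velGradSq v t x))
        ≤ l / ν * (θ t x * velGradSq v t x) := by
      have := mul_le_mul_of_nonneg_right e3 (by positivity : 0 ≤ 1 / ν * (θ t x * velGradSq v t x))
      calc _ = θ t x ^ (-a - 1) * θ t x * (1 / ν * (θ t x * velGradSq v t x)) := by ring
        _ ≤ _ := this
        _ = _ := by ring
    have hs0 : 0 ≤ ∑ j, v j t x ^ 2 := Finset.sum_nonneg fun _ _ => sq_nonneg _
    have b2 : θ t x ^ (-a - 1) * (1682 / (a * ν ^ 3) * (∑ j, v j t x ^ 2) ^ 2)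
        ≤ 1682 / (a * ν ^ 3) * l ^ 2 * speedWeight v t x ^ 2 := by
      have : ∑ j, v j t x ^ 2 ≤ speedWeight v t x := le_add_of_nonneg_left zero_le_one
      have hW : 0 ≤ speedWeight v t x := hs0.trans this
      calc _ ≤ l ^ 2 * (1682 / (a * ν ^ 3) * speedWeight v t x ^ 2) := by gcongr
        _ = _ := by ring
    rw [e1]
    generalize θ t x ^ (-a - 1) = ζ at *
    linarith
  obtain ⟨ζ, hω⟩ : ∃ f : E3 → ℝ, ∀ x, f x = θ t x ^ (-a - 1) := ⟨_, fun _ => rfl⟩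
  obtain ⟨z, hz⟩ : ∃ f : E3 → ℝ, ∀ x, f x = θ t x ^ (1 - a) := ⟨_, fun _ => rfl⟩
  have c1 : Continuous ζ := by rw [funext hω]; exact c1
  have c2 : Continuous z := by rw [funext hz]; exact c2
  simp only [← hω, ← hz] at hle ⊢
  have hm := integral_torus_mono (by fun_prop) (by fun_prop) hle
  rw [integral_torus_add (by fun_prop) (by fun_prop), integral_torus_add (by fun_prop) (by fun_prop),
    integral_const_mul, integral_const_mul, h.integral_heatFlux ht hpos,
    h.integral_hessianFlux ht hpos, mul_zero, mul_zero, add_zero, add_zero,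
    integral_torus_add (by fun_prop) (by fun_prop), integral_torus_add (by fun_prop) (by fun_prop),
    integral_torus_sub (by fun_prop) (by fun_prop), integral_torus_sub (by fun_prop) (by fun_prop),
    integral_const_mul, integral_const_mul, integral_const_mul, integral_const_mul,
    integral_const_mul] at hm
  exact hm

/-- A Gagliardo-Nirenberg type bound for `∫ (1 + |v|²)²`. -/
theorem integral_speedWeight_sq_le (h : ThermalFlow ν κ γ T v θ) {C : ℝ} (hC : SobolevConst C)
    {a : ℝ} (ha : 0 ≤ a) (ha2 : a ≤ 1) {t : ℝ} (ht : t ∈ Ioc 0 T) (hpos : ∀ x, 0 < θ t x) {N : ℝ}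
    (hN : 1 ≤ N) (hWN : ∫ x, speedWeight v t x ∂torusMeasure ≤ N) {η : ℝ} (hη : 0 < η) :
    ∫ x, speedWeight v t x ^ 2 ∂torusMeasure
      ≤ 2 * η * (∫ x, θ t x ^ (-a - 1) * velGradSq v t x ^ 2 ∂torusMeasure)
        + 2 * (32 * (N ^ 2 * C) ^ 3 / η + 2 * (N ^ 2 * C))
          * (∫ x, θ t x * velGradSq v t x ∂torusMeasure)
        + 2 * (N ^ 2 * C) ^ 2 * N := by
  have hC0 := hC.1
  -- With `W = 1 + |v|²`, write `W² = k² f²`, where `k = W^{1/3}` and `f = W^{2/3}`. Then `∫ k³ = ∫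
  -- W ≤ N ≤ N³` and `|∇f|² ≤ 2 W^{1/3} |∇v|²`, so Hölder and Sobolev apply with constant `N² C`.
  set l := N ^ 2 * C with hldef
  have hl : 0 < l := by positivity
  set W := speedWeight v t with hW
  have hW1 : ∀ x, 1 ≤ W x := one_le_speedWeight v t
  have hW0 : ∀ x, 0 < W x := fun x => zero_lt_one.trans_le (hW1 x)
  have WC : ContDiff ℝ 1 W := (h.contDiff_speedWeight ht).of_le (by norm_num)
  have ck := h.continuous_comp_speedWeight ht (continuousOn_rpow_const_Ioi (1 / 3))
  have fC : ContDiff ℝ 1 fun x => W x ^ (2 / 3 : ℝ) :=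
    contDiff_one_comp isOpen_Ioi (fun _ hr => hasDerivAt_rpow_const_of_pos (2 / 3) hr)
      (continuousOn_const.mul (continuousOn_rpow_const_Ioi _)) WC hW0
  have fP : IsPeriodic3 fun x => W x ^ (2 / 3 : ℝ) :=
    (h.periodic_speedWeight ht).comp fun r => r ^ (2 / 3 : ℝ)
  have cW : Continuous W := WC.continuous
  obtain ⟨y, hy⟩ : ∃ f : E3 → ℝ, ∀ x, f x = W x ^ (1 / 3 : ℝ) := ⟨_, fun _ => rfl⟩
  have cy : Continuous y := by rw [funext hy]; exact ck
  have hy1 : ∀ x, 1 ≤ y x := fun x => by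
    rw [hy]
    exact Real.one_le_rpow (hW1 x) (by norm_num)
  have hy3 : ∀ x, y x ^ 3 = W x := fun x => by
    rw [hy, ← Real.rpow_natCast, ← Real.rpow_mul (hW0 x).le]
    norm_num
  have hf : ∀ x, W x ^ (2 / 3 : ℝ) = y x ^ 2 := fun x => by
    rw [hy, ← Real.rpow_natCast, ← Real.rpow_mul (hW0 x).le]
    norm_num
  have hgrad : ∀ x, gradSq (fun x => W x ^ (2 / 3 : ℝ)) x ≤ 2 * (y x * velGradSq v t x) := fun x => by
    refine (h.gradSq_comp_speedWeight ht (φ := fun r => r ^ (2 / 3 : ℝ))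
      (fun _ hr => hasDerivAt_rpow_const_of_pos (2 / 3) hr) x).trans ?_
    have e : W x ^ (2 / 3 - 1 : ℝ) = (y x)⁻¹ := by
      rw [hy, ← Real.rpow_neg (hW0 x).le]
      norm_num
    have hy0 : 0 < y x := zero_lt_one.trans_le (hy1 x)
    change (2 / 3 * W x ^ (2 / 3 - 1 : ℝ)) ^ 2 * (4 * W x * velGradSq v t x) ≤ _
    rw [e, ← hy3 x]
    have e2 : (2 / 3 * (y x)⁻¹) ^ 2 * (4 * y x ^ 3 * velGradSq v t x)
        = 16 / 9 * (y x * velGradSq v t x) := by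
      field_simp
      ring
    rw [e2]
    have := mul_nonneg hy0.le (velGradSq_nonneg v t x)
    linarith
  have hNN : ∫ x, y x ^ 3 ∂torusMeasure ≤ N ^ 3 := by
    simp only [hy3]
    exact hWN.trans (le_self_pow₀ hN (by norm_num))
  have hsob := integral_sq_mul_sq_le hC.2 hC0 cy (fun x => zero_le_one.trans (hy1 x)) fC fP
    (by linarith) hNN
  have cθ : Continuous (θ t) := h.regular_θ.timeC1.cont.slice ht
  have cg : Continuous (velGradSq v t) := h.jointCont_velGradSq.slice ht
  have cgf := fC.continuous_gradSq
  have c1 := (h.contDiff_rpow_temperature ht hpos (-a - 1)).continuous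
  obtain ⟨ζ, hω⟩ : ∃ f : E3 → ℝ, ∀ x, f x = θ t x ^ (-a - 1) := ⟨_, fun _ => rfl⟩
  have cω : Continuous ζ := by rw [funext hω]; exact c1
  simp only [← hω]
  have hle : ∀ x, l * (2 * (y x * velGradSq v t x) + y x ^ 4)
      ≤ η * (ζ x * velGradSq v t x ^ 2) + 1 / 2 * W x ^ 2
        + (32 * l ^ 3 / η + 2 * l) * (θ t x * velGradSq v t x) + l ^ 2 * W x := fun x => by
    have hq := hpos x
    have h1 := interpolation_pointwise hη hl (hy1 x) (velGradSq_nonneg v t x) hq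
      (Real.rpow_pos_of_pos hq (a + 1)) (w := ζ x) (by
        rcases le_total (θ t x) 1 with hc | hc
        · left
          calc θ t x ^ (a + 1) ≤ θ t x ^ (1 : ℝ) :=
                Real.rpow_le_rpow_of_exponent_ge hq hc (by linarith)
            _ = _ := Real.rpow_one _
        · right
          rw [← Real.rpow_two]
          exact Real.rpow_le_rpow_of_exponent_le hc (by linarith)) (by
        rw [hω, ← Real.rpow_add hq]
        simp)
    have h2 : l * y x ^ 4 ≤ 1 / 4 * y x ^ 6 + l ^ 2 * y x ^ 2 := by
      nlinarith [sq_nonneg (1 / 2 * y x ^ 3 - l * y x)]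
    have h3 : l ^ 2 * y x ^ 2 ≤ l ^ 2 * y x ^ 3 := by
      have := pow_le_pow_right₀ (hy1 x) (by norm_num : 2 ≤ 3)
      gcongr
    rw [← hy3 x]
    linarith
  -- The right side contains half of the left side: a quarter from the gradient term and a quarter
  -- from `l y⁴`. Absorbing it doubles the other coefficients.
  have hfinal : ∫ x, W x ^ 2 ∂torusMeasure ≤ ∫ x, (η * (ζ x * velGradSq v t x ^ 2)
      + 1 / 2 * W x ^ 2 + (32 * l ^ 3 / η + 2 * l) * (θ t x * velGradSq v t x) + l ^ 2 * W x)
        ∂torusMeasure := by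
    have e1 : ∀ x, y x ^ 2 * (W x ^ (2 / 3 : ℝ)) ^ 2 = W x ^ 2 := fun x => by
      rw [hf, ← hy3 x]
      ring
    simp only [e1] at hsob
    refine hsob.trans (le_trans ?_ (integral_torus_mono (by fun_prop) (by fun_prop) hle))
    rw [integral_const_mul, integral_torus_add (by fun_prop) (by fun_prop), ← mul_assoc, ← hldef]
    refine mul_le_mul_of_nonneg_left (add_le_add (integral_torus_mono cgf (by fun_prop) hgrad)
      (le_of_eq ?_)) hl.le
    refine integral_congr_ae (.of_forall fun x => ?_)
    simp only [hf]
    ring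
  rw [integral_torus_add (by fun_prop) (by fun_prop), integral_torus_add (by fun_prop) (by fun_prop),
    integral_torus_add (by fun_prop) (by fun_prop), integral_const_mul, integral_const_mul,
    integral_const_mul, integral_const_mul] at hfinal
  have := mul_le_mul_of_nonneg_left hWN (sq_nonneg l)
  linarith

end ThermalFlow

/-! ### Time derivative of the weighted energy -/

/-- Factor the difference of squares and move `∂ᵢ` off `f - g`. With `f` and `g` the velocity at two
times, the increment then appears undifferentiated in space. -/
theorem integral_mul_pd_sq_sub {w f g : E3 → ℝ} (hw : ContDiff ℝ 1 w) (hf : ContDiff ℝ 2 f)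
    (hg : ContDiff ℝ 2 g) (pw : IsPeriodic3 w) (pf : IsPeriodic3 f) (pg : IsPeriodic3 g)
    (i : Fin 3) :
    ∫ x, w x * (pd i f x ^ 2 - pd i g x ^ 2) ∂torusMeasure
      = -∫ x, (f x - g x) * (pd i w x * (pd i f x + pd i g x)
        + w x * (pd i (pd i f) x + pd i (pd i g) x)) ∂torusMeasure := by
  have f1 : ContDiff ℝ 1 (pd i f) := hf.pd (by norm_num) i
  have g1 : ContDiff ℝ 1 (pd i g) := hg.pd (by norm_num) i
  have s1 : ContDiff ℝ 1 fun x => pd i f x + pd i g x := f1.add g1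
  have d1 : ContDiff ℝ 1 fun x => f x - g x :=
    (hf.of_le (by norm_num)).sub (hg.of_le (by norm_num))
  have h := integral_mul_pd (hw.mul s1) d1 (pw.mul ((pf.pd i).add (pg.pd i))) (pf.sub pg) i
  have e1 : ∀ x, w x * (pd i f x ^ 2 - pd i g x ^ 2)
      = w x * (pd i f x + pd i g x) * pd i (fun x => f x - g x) x := fun x => by
    rw [pd_sub (hf.differentiable (by norm_num) x) (hg.differentiable (by norm_num) x)]
    ring
  have e2 : ∀ x, (f x - g x) * (pd i w x * (pd i f x + pd i g x)
        + w x * (pd i (pd i f) x + pd i (pd i g) x))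
      = pd i (fun x => w x * (pd i f x + pd i g x)) x * (f x - g x) := fun x => by
    rw [pd_mul (g := fun x => pd i f x + pd i g x) (hw.differentiable (by norm_num) x)
      (s1.differentiable (by norm_num) x), pd_add (f1.differentiable (by norm_num) x)
      (g1.differentiable (by norm_num) x)]
    ring
  simp only [e1, e2]
  exact h

namespace ThermalFlow

variable {ν κ γ T : ℝ} {v : Fin 3 → ℝ → E3 → ℝ} {θ : ℝ → E3 → ℝ}

/-- `∫ θ^{-a} |∇v|²`. -/
noncomputable def weightedEnergy (a : ℝ) (v : Fin 3 → ℝ → E3 → ℝ) (θ : ℝ → E3 → ℝ) (t : ℝ) : ℝ :=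
  ∫ x, θ t x ^ (-a) * velGradSq v t x ∂torusMeasure

/-- The mixed derivatives `∂ₜ∂ᵢv` are not available, so the integration by parts is carried out
exactly for finite time increments. The increment of the energy splits into that of the weight, with
the gradient at the moving time, and that of `|∇v|²`, with the weight frozen. Only time quotients of
`θ^{-a}` and `v` remain. -/
theorem slope_weightedEnergy (h : ThermalFlow ν κ γ T v θ)
    (hpos : ∀ t ∈ Ioc 0 T, ∀ x, 0 < θ t x) (a : ℝ) {s t : ℝ} (hs : s ∈ Ioc 0 T) (ht : t ∈ Ioc 0 T) :
    slope (weightedEnergy a v θ) t s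
      = ∫ x, slope (fun r => θ r x ^ (-a)) t s * velGradSq v s x ∂torusMeasure
        - ∑ i, ∑ j, ∫ x, slope (fun r => v j r x) t s
          * (pd i (fun y => θ t y ^ (-a)) x * (pd i (v j s) x + pd i (v j t) x)
            + θ t x ^ (-a) * (pd i (pd i (v j s)) x + pd i (pd i (v j t)) x)) ∂torusMeasure := by
  have wC := h.contDiff_rpow_temperature ht (hpos t ht) (-a)
  have wP : IsPeriodic3 fun y => θ t y ^ (-a) := (h.regular_θ.periodic t ht).comp fun r => r ^ (-a)
  have c1 := wC.continuous
  have c2 := (h.contDiff_rpow_temperature hs (hpos s hs) (-a)).continuous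
  have c3 : ∀ t ∈ Ioc 0 T, Continuous (velGradSq v t) := fun t ht => h.jointCont_velGradSq.slice ht
  have c4 : ∀ t ∈ Ioc 0 T, ∀ i j, Continuous fun x => pd i (v j t) x ^ 2 := fun t ht i j =>
    (((h.regular_v j).jointCont_pd i).slice ht).pow 2
  have hibp := fun i j => integral_mul_pd_sq_sub wC (h.contDiff_velocity hs j)
    (h.contDiff_velocity ht j) wP ((h.regular_v j).periodic s hs) ((h.regular_v j).periodic t ht) i
  have c5 : ∀ i j, Continuous fun x => θ t x ^ (-a) * (pd i (v j s) x ^ 2 - pd i (v j t) x ^ 2) :=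
    fun i j => c1.mul ((c4 s hs i j).sub (c4 t ht i j))
  have hE : weightedEnergy a v θ s - weightedEnergy a v θ t
      = ∫ x, (θ s x ^ (-a) - θ t x ^ (-a)) * velGradSq v s x ∂torusMeasure
        + ∑ i, ∑ j, ∫ x, θ t x ^ (-a) * (pd i (v j s) x ^ 2 - pd i (v j t) x ^ 2)
          ∂torusMeasure := by
    rw [weightedEnergy, weightedEnergy,
      ← integral_torus_sub (c2.fun_mul (c3 s hs)) (c1.fun_mul (c3 t ht))]
    have e : ∀ x, θ s x ^ (-a) * velGradSq v s x - θ t x ^ (-a) * velGradSq v t x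
        = (θ s x ^ (-a) - θ t x ^ (-a)) * velGradSq v s x
          + ∑ i, ∑ j, θ t x ^ (-a) * (pd i (v j s) x ^ 2 - pd i (v j t) x ^ 2) := fun x => by
      simp only [velGradSq, frobSq, ← Finset.mul_sum, Finset.sum_sub_distrib]
      ring
    simp only [e]
    rw [integral_torus_add ((c2.fun_sub c1).fun_mul (c3 s hs))
      (continuous_finsetSum _ fun i _ => continuous_finsetSum _ fun j _ => c5 i j),
      integral_torus_sum _ fun i _ => continuous_finsetSum _ fun j _ => c5 i j]
    congr 1
    exact Finset.sum_congr rfl fun i _ => integral_torus_sum _ fun j _ => c5 i j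
  simp only [slope, vsub_eq_sub, smul_eq_mul, hE, hibp, mul_assoc, integral_const_mul]
  simp only [Finset.sum_neg_distrib, ← Finset.mul_sum]
  ring

theorem hasDerivAt_weightedEnergy (h : ThermalFlow ν κ γ T v θ)
    (hpos : ∀ t ∈ Ioc 0 T, ∀ x, 0 < θ t x) (a : ℝ) {t : ℝ} (ht : t ∈ Ioo 0 T) :
    HasDerivAt (weightedEnergy a v θ) (∫ x, weightedRate a T v θ t x ∂torusMeasure) t := by
  have htc := Ioo_subset_Ioc_self ht
  have wC := h.contDiff_rpow_temperature htc (hpos t htc) (-a)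
  rw [hasDerivAt_iff_tendsto_slope]
  have hw : TimeC1 T (fun t x => θ t x ^ (-a))
      fun t x => -a * θ t x ^ (-a - 1) * timeDeriv T θ t x :=
    h.regular_θ.timeC1.comp (S := Ioi 0) (fun r hr => hasDerivAt_rpow_const_of_pos (-a) hr)
      (continuousOn_const.mul (continuousOn_rpow_const_Ioi _)) hpos
  set ψ : Fin 3 → Fin 3 → ℝ → E3 → ℝ := fun i j s x =>
    pd i (fun y => θ t y ^ (-a)) x * (pd i (v j s) x + pd i (v j t) x)
      + θ t x ^ (-a) * (pd i (pd i (v j s)) x + pd i (pd i (v j t)) x) with hψ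
  have c1 : ∀ i j, JointCont T (ψ i j) := fun i j =>
    ((JointCont.const_slice (wC.continuous_pd i)).mul (((h.regular_v j).jointCont_pd i).add
      (.const_slice (((h.regular_v j).jointCont_pd i).slice htc)))).add
    ((JointCont.const_slice wC.continuous).mul (((h.regular_v j).jointCont_pd_pd i i).add
      (.const_slice (((h.regular_v j).jointCont_pd_pd i i).slice htc))))
  have hlim := (hw.tendsto_integral_slope_mul h.jointCont_velGradSq ht).sub
    (tendsto_finsetSum Finset.univ fun i _ => tendsto_finsetSum Finset.univ fun j _ =>
      (h.regular_v j).timeC1.tendsto_integral_slope_mul (c1 i j) ht)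
  have c2 : ∀ i j, Continuous fun x => timeDeriv T (v j) t x * ψ i j t x := fun i j =>
    ((h.regular_v j).timeC1.cont_deriv.slice htc).mul ((c1 i j).slice htc)
  have hval : ∫ x, weightedRate a T v θ t x ∂torusMeasure
      = ∫ x, -a * θ t x ^ (-a - 1) * timeDeriv T θ t x * velGradSq v t x ∂torusMeasure
        - ∑ i, ∑ j, ∫ x, timeDeriv T (v j) t x * ψ i j t x ∂torusMeasure := by
    have e : ∀ x, weightedRate a T v θ t x
        = -a * θ t x ^ (-a - 1) * timeDeriv T θ t x * velGradSq v t x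
          - ∑ i, ∑ j, timeDeriv T (v j) t x * ψ i j t x := fun x => by
      rw [weightedRate]
      congr 1
      refine Finset.sum_congr rfl fun i _ => Finset.sum_congr rfl fun j _ => ?_
      rw [hψ]
      dsimp only
      rw [h.pd_rpow_temperature htc (hpos t htc)]
      ring
    simp only [e]
    rw [integral_torus_sub ((hw.cont_deriv.slice htc).fun_mul (h.jointCont_velGradSq.slice htc))
      (continuous_finsetSum _ fun i _ => continuous_finsetSum _ fun j _ => c2 i j),
      integral_torus_sum _ fun i _ => continuous_finsetSum _ fun j _ => c2 i j]
    congr 1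
    exact Finset.sum_congr rfl fun i _ => integral_torus_sum _ fun j _ => c2 i j
  rw [hval]
  refine hlim.congr' ?_
  have hev : ∀ᶠ s in 𝓝[≠] t, s ∈ Ioo 0 T :=
    eventually_nhdsWithin_of_eventually_nhds (Ioo_mem_nhds ht.1 ht.2)
  filter_upwards [hev] with s hs
  exact (h.slope_weightedEnergy hpos a (Ioo_subset_Ioc_self hs) htc).symm

theorem continuousOn_weightedEnergy (h : ThermalFlow ν κ γ T v θ)
    (hpos : ∀ t ∈ Ioc 0 T, ∀ x, 0 < θ t x) (a : ℝ) :
    ContinuousOn (weightedEnergy a v θ) (Ioc 0 T) :=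
  ((h.jointCont_rpow_temperature hpos (-a)).mul h.jointCont_velGradSq).continuousOn_integral

end ThermalFlow

/-! ### Closing the weighted gradient estimate -/

namespace ThermalFlow

variable {ν κ γ T : ℝ} {v : Fin 3 → ℝ → E3 → ℝ} {θ : ℝ → E3 → ℝ}

/-- The three dissipation densities of the weighted gradient estimate. -/
noncomputable def dissipation (a : ℝ) (v : Fin 3 → ℝ → E3 → ℝ) (θ : ℝ → E3 → ℝ) (t : ℝ)
    (x : E3) : ℝ :=
  θ t x ^ (1 - a) * velHessSq v t x + θ t x ^ (-a - 1) * velGradSq v t x ^ 2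
    + θ t x ^ (-a - 1) * velGradSq v t x * gradSq (θ t) x

theorem jointCont_dissipation (h : ThermalFlow ν κ γ T v θ)
    (hpos : ∀ t ∈ Ioc 0 T, ∀ x, 0 < θ t x) (a : ℝ) : JointCont T (dissipation a v θ) :=
  (((h.jointCont_rpow_temperature hpos (1 - a)).mul h.jointCont_velHessSq).add
    ((h.jointCont_rpow_temperature hpos (-a - 1)).mul (h.jointCont_velGradSq.pow 2))).add
    (((h.jointCont_rpow_temperature hpos (-a - 1)).mul h.jointCont_velGradSq).mul
      h.jointCont_gradSq_temperature)

theorem integral_weightedRate_le_dissipation (h : ThermalFlow ν κ γ T v θ) (hν : 0 < ν)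
    (hγ : 2 ≤ γ) {a : ℝ} (ha : 0 < a) (ha2 : a ≤ 1 / 2) (hκ : a * κ = ν * (1 - a)) {t : ℝ}
    (ht : t ∈ Ioc 0 T) {l : ℝ} (hl : 1 ≤ l) (hlow : ∀ x, 1 / l ≤ θ t x) {C : ℝ}
    (hC : SobolevConst C) {N : ℝ} (hN : 1 ≤ N)
    (hWN : ∫ x, speedWeight v t x ∂torusMeasure ≤ N) {μ L : ℝ}
    (hμ : μ = 1682 / (a * ν ^ 3) * l ^ 2) (hL : L = N ^ 2 * C) :
    ∫ x, weightedRate a T v θ t x ∂torusMeasure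
      ≤ -(a * ν / 8) * (∫ x, dissipation a v θ t x ∂torusMeasure)
        + (l / ν + 2 * μ * (512 * μ * L ^ 3 / (a * ν) + 2 * L))
          * (∫ x, θ t x * velGradSq v t x ∂torusMeasure)
        + 2 * μ * L ^ 2 * N := by
  have hl0 : 0 < l := by linarith
  have hpos : ∀ x, 0 < θ t x := fun x => (by positivity : 0 < 1 / l).trans_le (hlow x)
  have hμ0 : 0 < μ := by rw [hμ]; positivity
  have h1 := h.integral_weightedRate_le hν hγ ha ha2 hκ ht hl hlow
  -- This `η` gives `2 η μ = a ν / 8`, so the quartic moment uses half of the quartic dissipation `a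
  -- ν / 4` and leaves the other half.
  have h2 := h.integral_speedWeight_sq_le hC ha.le (by linarith) ht hpos hN hWN
    (η := a * ν / (16 * μ)) (by positivity)
  rw [← hμ] at h1
  rw [← hL] at h2
  have c1 := (h.contDiff_rpow_temperature ht hpos (-a - 1)).continuous
  have c2 := (h.contDiff_rpow_temperature ht hpos (1 - a)).continuous
  have c3 : Continuous (velGradSq v t) := h.jointCont_velGradSq.slice ht
  have c4 : Continuous (velHessSq v t) := h.jointCont_velHessSq.slice ht
  have c5 : Continuous (gradSq (θ t)) := h.jointCont_gradSq_temperature.slice ht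
  have e1 : ∫ x, dissipation a v θ t x ∂torusMeasure
      = (∫ x, θ t x ^ (1 - a) * velHessSq v t x ∂torusMeasure)
        + (∫ x, θ t x ^ (-a - 1) * velGradSq v t x ^ 2 ∂torusMeasure)
        + ∫ x, θ t x ^ (-a - 1) * velGradSq v t x * gradSq (θ t) x ∂torusMeasure := by
    simp only [dissipation]
    rw [integral_torus_add ((c2.fun_mul c4).fun_add (c1.fun_mul (c3.fun_pow 2)))
      ((c1.fun_mul c3).fun_mul c5), integral_torus_add (c2.fun_mul c4) (c1.fun_mul (c3.fun_pow 2))]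
  have n1 : 0 ≤ ∫ x, θ t x ^ (1 - a) * velHessSq v t x ∂torusMeasure :=
    integral_nonneg fun x => mul_nonneg (Real.rpow_nonneg (hpos x).le _) (velHessSq_nonneg v t x)
  have n2 : 0 ≤ ∫ x, θ t x ^ (-a - 1) * velGradSq v t x * gradSq (θ t) x ∂torusMeasure :=
    integral_nonneg fun x => mul_nonneg (mul_nonneg (Real.rpow_nonneg (hpos x).le _)
      (velGradSq_nonneg v t x)) (gradSq_nonneg _ x)
  rw [e1]
  generalize (∫ x, θ t x ^ (1 - a) * velHessSq v t x ∂torusMeasure) = A at *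
  generalize (∫ x, θ t x ^ (-a - 1) * velGradSq v t x ^ 2 ∂torusMeasure) = B at *
  generalize (∫ x, θ t x ^ (-a - 1) * velGradSq v t x * gradSq (θ t) x ∂torusMeasure) = D at *
  generalize (∫ x, θ t x * velGradSq v t x ∂torusMeasure) = Y at *
  generalize (∫ x, speedWeight v t x ^ 2 ∂torusMeasure) = Q at *
  have h3 := mul_le_mul_of_nonneg_left h2 hμ0.le
  have e2 : μ * (2 * (a * ν / (16 * μ)) * B
      + 2 * (32 * L ^ 3 / (a * ν / (16 * μ)) + 2 * L) * Y + 2 * L ^ 2 * N)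
      = a * ν / 8 * B + 2 * μ * (512 * μ * L ^ 3 / (a * ν) + 2 * L) * Y + 2 * μ * L ^ 2 * N := by
    field_simp
    ring
  rw [e2] at h3
  have h4 : a * ν / 8 * A ≤ ν * A := by
    gcongr
    nlinarith
  have h5 : 0 ≤ a * ν * D := by positivity
  linarith

theorem exists_weighted_bound {ν γ a F0 : ℝ} (hν : 0 < ν) (hγ : 2 ≤ γ) (ha : 0 < a)
    (ha2 : a ≤ 1 / 2) (hF0 : 0 ≤ F0) :
    ∃ C, 0 < C ∧ ∀ (κ T : ℝ) (v : Fin 3 → ℝ → E3 → ℝ) (θ : ℝ → E3 → ℝ), a * κ = ν * (1 - a) →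
      ThermalFlow ν κ γ T v θ → AboveBarrier ν T θ →
      (∃ s0, 0 < s0 ∧ ∀ t ∈ Ioo 0 s0, ∫ x, speedWeight v t x ^ (γ / 2) ∂torusMeasure ≤ F0) →
      ∀ t ∈ Ioc 0 T, ∀ s, 0 < s → s ≤ t →
        weightedEnergy a v θ t
          + a * ν / 8 * (∫ r in s..t, ∫ x, dissipation a v θ r x ∂torusMeasure)
          ≤ weightedEnergy a v θ s + C * (1 + t) ^ (7 * γ + 6) := by
  obtain ⟨C1, hC1, hbound⟩ := exists_energy_bound hν hγ hF0
  obtain ⟨CS, hCS⟩ := exists_sobolev_torus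
  have hCS0 := hCS.1
  set c1 := 1 + 3 / (8 * ν) with hc1
  have hc10 : 1 ≤ c1 := by
    have : 0 < 3 / (8 * ν) := by positivity
    linarith
  set μ0 := 1682 / (a * ν ^ 3) * c1 ^ 2 with hμ0
  set L0 := C1 ^ 2 * CS with hL0
  refine ⟨C1 * c1 / ν + 1024 * μ0 ^ 2 * L0 ^ 3 / (a * ν) * C1 + 4 * μ0 * L0 * C1
    + 2 * μ0 * L0 ^ 2 * C1, by positivity, fun κ T v θ hκ h hb hs0 t ht s hs hst => ?_⟩
  have hbd := hbound κ T v θ h hb hs0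
  have hpos : ∀ t ∈ Ioc 0 T, ∀ x, 0 < θ t x := fun t ht x => hb.pos hν ht x
  have ht0 := ht.1
  have hR : 1 ≤ 1 + t := by linarith
  set R := 1 + t with hRdef
  have hP : 1 ≤ R ^ γ := Real.one_le_rpow hR (by linarith)
  have eP : R ^ (γ + 2) = R ^ γ * R ^ 2 := by
    rw [Real.rpow_add (by linarith), Real.rpow_two]
  have eP7 : R ^ (7 * γ + 6) = (R ^ γ) ^ 7 * R ^ 6 := by
    rw [Real.rpow_add (by linarith), mul_comm 7 γ, Real.rpow_mul (by linarith)]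
    norm_cast
  have hsub : Ioc 0 t ⊆ Ioc 0 T := Ioc_subset_Ioc_right ht.2
  have hIcc : uIcc s t ⊆ Ioc 0 T := by
    rw [uIcc_of_le hst]
    exact fun r hr => ⟨hs.trans_le hr.1, hr.2.trans ht.2⟩
  have hYc : ContinuousOn (fun r => ∫ x, θ r x * velGradSq v r x ∂torusMeasure) (Ioc 0 T) :=
    (h.regular_θ.timeC1.cont.mul h.jointCont_velGradSq).continuousOn_integral
  have hDc := (h.jointCont_dissipation hpos a).continuousOn_integral
  have hY := (hbd t ht).2 s hs hst
  rw [← hRdef, eP] at hY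
  rw [eP7]
  generalize hPdef : R ^ γ = P at *
  set l := c1 * R with hl
  set N := C1 * P with hN
  set μ := 1682 / (a * ν ^ 3) * l ^ 2 with hμ
  set L := N ^ 2 * CS with hL
  have hl1 : 1 ≤ l := one_le_mul_of_one_le_of_one_le hc10 hR
  have hN1 : 1 ≤ N := one_le_mul_of_one_le_of_one_le hC1 hP
  have hrate : ∀ r ∈ Ioo 0 t, ∫ x, weightedRate a T v θ r x ∂torusMeasure
      ≤ -(a * ν / 8) * (∫ x, dissipation a v θ r x ∂torusMeasure)
        + (l / ν + 2 * μ * (512 * μ * L ^ 3 / (a * ν) + 2 * L))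
          * (∫ x, θ r x * velGradSq v r x ∂torusMeasure)
        + 2 * μ * L ^ 2 * N := fun r hr => by
    have hrT : r ∈ Ioc 0 T := ⟨hr.1, hr.2.le.trans ht.2⟩
    have hr0 := hr.1
    refine h.integral_weightedRate_le_dissipation hν hγ ha ha2 hκ hrT hl1 (fun x => ?_) hCS hN1 ?_
      hμ hL
    · refine le_trans ?_ (hb r hrT x)
      have h1 : 0 < 3 / (8 * ν) := by positivity
      refine one_div_le_one_div_of_le (by positivity) ?_
      rw [hl, hc1, hRdef]
      have := hr.2
      nlinarith
    · have h2 : ∫ x, speedWeight v r x ∂torusMeasure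
          ≤ ∫ x, speedWeight v r x ^ (γ / 2) ∂torusMeasure :=
        integral_torus_mono (h.timeC1_speedWeight.cont.slice hrT)
          (h.continuous_comp_speedWeight hrT (continuousOn_rpow_const_Ioi (γ / 2))) fun x =>
          Real.self_le_rpow_of_one_le (one_le_speedWeight v r x) (by linarith)
      refine h2.trans ((hbd r hrT).1.trans ?_)
      rw [hN, ← hPdef]
      have := hr.2
      gcongr
      linarith
  have hle := sub_le_integral_of_hasDerivAt_le
    ((h.continuousOn_weightedEnergy hpos a).mono hsub)
    (fun r hr => h.hasDerivAt_weightedEnergy hpos a ⟨hr.1, hr.2.trans_le ht.2⟩)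
    (((continuousOn_const.fun_mul (hDc.mono hsub)).fun_add
      (continuousOn_const.fun_mul (hYc.mono hsub))).fun_add
      continuousOn_const) hrate hs hst le_rfl
  have iD := (hDc.mono hIcc).intervalIntegrable (μ := volume)
  have iY := (hYc.mono hIcc).intervalIntegrable (μ := volume)
  rw [intervalIntegral.integral_add ((iD.const_mul _).add (iY.const_mul _))
      intervalIntegrable_const, intervalIntegral.integral_add (iD.const_mul _) (iY.const_mul _),
    intervalIntegral.integral_const_mul, intervalIntegral.integral_const_mul,
    intervalIntegral.integral_const, smul_eq_mul] at hle
  have hk : 0 ≤ l / ν + 2 * μ * (512 * μ * L ^ 3 / (a * ν) + 2 * L) := by positivity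
  have h1 := mul_le_mul_of_nonneg_left hY hk
  have h2 : (t - s) * (2 * μ * L ^ 2 * N) ≤ R * (2 * μ * L ^ 2 * N) := by
    gcongr
    linarith
  -- Powers of time, with `R = 1 + t` and `P = R^γ`: `l` is of order `R`, `μ` of order `R²`, `L` of
  -- order `P²`. The worst product is `μ² L³ P R²`, of order `P⁷ R⁶`, hence the exponent `7γ + 6`.
  have e : (l / ν + 2 * μ * (512 * μ * L ^ 3 / (a * ν) + 2 * L)) * (C1 * (P * R ^ 2))
      + R * (2 * μ * L ^ 2 * N)
      = C1 * c1 / ν * (P * R ^ 3) + 1024 * μ0 ^ 2 * L0 ^ 3 / (a * ν) * C1 * (P ^ 7 * R ^ 6)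
        + 4 * μ0 * L0 * C1 * (P ^ 3 * R ^ 4) + 2 * μ0 * L0 ^ 2 * C1 * (P ^ 5 * R ^ 3) := by
    have e1 : μ = μ0 * R ^ 2 := by rw [hμ, hμ0, hl]; ring
    have e2 : L = L0 * P ^ 2 := by rw [hL, hL0, hN]; ring
    rw [e1, e2, hl, hN]
    ring
  have hmono : ∀ m n : ℕ, m ≤ 7 → n ≤ 6 → P ^ m * R ^ n ≤ P ^ 7 * R ^ 6 := fun m n hm hn => by
    gcongr
  have m1 := mul_le_mul_of_nonneg_left (hmono 1 3 (by norm_num) (by norm_num))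
    (by positivity : 0 ≤ C1 * c1 / ν)
  have m2 := mul_le_mul_of_nonneg_left (hmono 3 4 (by norm_num) (by norm_num))
    (by positivity : 0 ≤ 4 * μ0 * L0 * C1)
  have m3 := mul_le_mul_of_nonneg_left (hmono 5 3 (by norm_num) (by norm_num))
    (by positivity : 0 ≤ 2 * μ0 * L0 ^ 2 * C1)
  rw [pow_one] at m1
  linarith

end ThermalFlow

/-! ### Attainment of the initial data -/

/-- Cauchy-Schwarz for `f² - f0² = (f - f0)(f + f0)`, with `(f + f0)² ≤ 2(f - f0)² + 8 f0²` bounding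
the second factor. -/
theorem tendsto_integral_abs_sq_sub_sq {ι : Type*} {l : Filter ι} {f : ι → E3 → ℝ} {f0 : E3 → ℝ}
    (hf : ∀ᶠ t in l, MemLp (f t) 2 torusMeasure) (hf0 : MemLp f0 2 torusMeasure)
    (h : Tendsto (fun t => ∫ x, (f t x - f0 x) ^ 2 ∂torusMeasure) l (𝓝 0)) :
    Tendsto (fun t => ∫ x, |f t x ^ 2 - f0 x ^ 2| ∂torusMeasure) l (𝓝 0) := by
  set J := ∫ x, f0 x ^ 2 ∂torusMeasure with hJ
  have hlim : Tendsto (fun t => √(∫ x, (f t x - f0 x) ^ 2 ∂torusMeasure)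
      * √(2 * (∫ x, (f t x - f0 x) ^ 2 ∂torusMeasure) + 8 * J)) l (𝓝 0) := by
    have := h.sqrt.mul ((h.const_mul 2).add_const (8 * J)).sqrt
    simpa using this
  refine squeeze_zero' (.of_forall fun t => integral_nonneg fun x => abs_nonneg _) ?_ hlim
  filter_upwards [hf] with t ht
  have hd : MemLp (fun x => |f t x - f0 x|) 2 torusMeasure := (ht.sub hf0).abs
  have hs : MemLp (fun x => |f t x + f0 x|) 2 torusMeasure := (ht.add hf0).abs
  have h1 := integral_mul_le_Lp_mul_Lq_of_nonneg (μ := torusMeasure) (p := 2) (q := 2)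
    Real.HolderConjugate.two_two (.of_forall fun x => abs_nonneg (f t x - f0 x))
    (.of_forall fun x => abs_nonneg (f t x + f0 x)) (by simpa using hd) (by simpa using hs)
  simp only [Real.rpow_two, sq_abs, ← Real.sqrt_eq_rpow, ← abs_mul] at h1
  have e : ∀ x, (f t x - f0 x) * (f t x + f0 x) = f t x ^ 2 - f0 x ^ 2 := fun x => by ring
  simp only [e] at h1
  refine h1.trans (mul_le_mul_of_nonneg_left (Real.sqrt_le_sqrt ?_) (Real.sqrt_nonneg _))
  have i1 : Integrable (fun x => (f t x - f0 x) ^ 2) torusMeasure := (ht.sub hf0).integrable_sq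
  have i2 : Integrable (fun x => f0 x ^ 2) torusMeasure := hf0.integrable_sq
  rw [hJ, ← integral_const_mul, ← integral_const_mul,
    ← integral_add (i1.const_mul 2) (i2.const_mul 8)]
  refine integral_mono (ht.add hf0).integrable_sq ((i1.const_mul 2).add (i2.const_mul 8))
    fun x => ?_
  dsimp only
  nlinarith [sq_nonneg (f t x - 3 * f0 x)]

theorem tendsto_integral_abs_sum {ι κ : Type*} {l : Filter ι} {s : Finset κ}
    {f : κ → ι → E3 → ℝ} (hf : ∀ k ∈ s, ∀ᶠ t in l, Integrable (f k t) torusMeasure)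
    (h : ∀ k ∈ s, Tendsto (fun t => ∫ x, |f k t x| ∂torusMeasure) l (𝓝 0)) :
    Tendsto (fun t => ∫ x, |∑ k ∈ s, f k t x| ∂torusMeasure) l (𝓝 0) := by
  have hlim := tendsto_finsetSum s h
  rw [Finset.sum_const_zero] at hlim
  refine squeeze_zero' (.of_forall fun t => integral_nonneg fun x => abs_nonneg _) ?_ hlim
  filter_upwards [(Finset.eventually_all s).2 hf] with t ht
  rw [← integral_finsetSum s fun k hk => (ht k hk).abs]
  exact integral_mono (integrable_finsetSum s ht).abs
    (integrable_finsetSum s fun k hk => (ht k hk).abs) fun x => Finset.abs_sum_le_sum_abs _ _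

theorem eventually_mem_Ioc {T : ℝ} (hT : 0 < T) : ∀ᶠ t in 𝓝[>] (0 : ℝ), t ∈ Ioc 0 T :=
  Ioc_mem_nhdsGT hT

theorem eventually_integral_le_of_tendsto_abs_sub {l : Filter ℝ} {f : ℝ → E3 → ℝ}
    {f0 : E3 → ℝ} (hf : ∀ᶠ t in l, Integrable (f t) torusMeasure) (hf0 : Integrable f0 torusMeasure)
    (h : Tendsto (fun t => ∫ x, |f t x - f0 x| ∂torusMeasure) l (𝓝 0)) :
    ∀ᶠ t in l, ∫ x, f t x ∂torusMeasure ≤ ∫ x, f0 x ∂torusMeasure + 1 := by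
  filter_upwards [hf, h.eventually (gt_mem_nhds one_pos)] with t ht h1
  have h2 : ∫ x, f t x ∂torusMeasure - ∫ x, f0 x ∂torusMeasure
      ≤ ∫ x, |f t x - f0 x| ∂torusMeasure := by
    rw [← integral_sub ht hf0]
    exact integral_mono (ht.sub hf0) (ht.sub hf0).abs fun x => le_abs_self _
  linarith

/-- The Sobolev inequality for `(1 + |v|²)^{1/2}`, whose squared gradient is at most `|∇v|²`. It
converts `H¹` control into the cubic moment bound that the entropy rate requires. -/
theorem ThermalFlow.integral_speedWeight_cube_le {ν κ γ T : ℝ} {θ : ℝ → E3 → ℝ}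
    {v : Fin 3 → ℝ → E3 → ℝ}
    (h : ThermalFlow ν κ γ T v θ) {C : ℝ} (hC : SobolevConst C) {t : ℝ} (ht : t ∈ Ioc 0 T) :
    ∫ x, speedWeight v t x ^ 3 ∂torusMeasure
      ≤ (C * (∫ x, velGradSq v t x ∂torusMeasure + ∫ x, speedWeight v t x ∂torusMeasure)) ^ 3 := by
  have hW0 : ∀ x, 0 < speedWeight v t x := fun x => zero_lt_one.trans_le (one_le_speedWeight v t x)
  have fC : ContDiff ℝ 1 fun x => speedWeight v t x ^ (1 / 2 : ℝ) :=
    contDiff_one_comp isOpen_Ioi (fun _ hr => hasDerivAt_rpow_const_of_pos (1 / 2) hr)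
      (continuousOn_const.mul (continuousOn_rpow_const_Ioi _))
      ((h.contDiff_speedWeight ht).of_le (by norm_num)) hW0
  have hs := hC.2 _ fC ((h.periodic_speedWeight ht).comp fun r => r ^ (1 / 2 : ℝ))
  have e6 : ∀ x, (speedWeight v t x ^ (1 / 2 : ℝ)) ^ 6 = speedWeight v t x ^ 3 := fun x => by
    rw [← Real.rpow_natCast, ← Real.rpow_mul (hW0 x).le, ← Real.rpow_natCast]
    norm_num
  have e2 : ∀ x, (speedWeight v t x ^ (1 / 2 : ℝ)) ^ 2 = speedWeight v t x := fun x => by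
    rw [← Real.rpow_natCast, ← Real.rpow_mul (hW0 x).le]
    norm_num
  simp only [e6, e2] at hs
  have hC0 := hC.1
  have hg : ∫ x, gradSq (fun x => speedWeight v t x ^ (1 / 2 : ℝ)) x ∂torusMeasure
      ≤ ∫ x, velGradSq v t x ∂torusMeasure := by
    refine integral_torus_mono fC.continuous_gradSq (h.jointCont_velGradSq.slice ht) fun x => ?_
    refine (h.gradSq_comp_speedWeight ht (φ := fun r => r ^ (1 / 2 : ℝ))
      (fun _ hr => hasDerivAt_rpow_const_of_pos (1 / 2) hr) x).trans (le_of_eq ?_)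
    have e : (1 / 2 * speedWeight v t x ^ (1 / 2 - 1 : ℝ)) ^ 2
        = 1 / 4 * (speedWeight v t x)⁻¹ := by
      rw [mul_pow, ← Real.rpow_natCast, ← Real.rpow_natCast, ← Real.rpow_mul (hW0 x).le,
        ← Real.rpow_neg_one]
      norm_num
    change (1 / 2 * speedWeight v t x ^ (1 / 2 - 1 : ℝ)) ^ 2 * _ = _
    rw [e]
    have := (hW0 x).ne'
    field_simp
  refine hs.trans (pow_le_pow_left₀ ?_ ?_ 3)
  · exact mul_nonneg hC0.le (add_nonneg (integral_nonneg fun x => gradSq_nonneg _ x)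
      (integral_nonneg fun x => (hW0 x).le))
  · gcongr

namespace IsClassicalSolution

variable {ν κ γ T : ℝ} {u0 : E3 → E3} {G0 : E3 → Fin 3 → Fin 3 → ℝ} {θ0 : E3 → ℝ}
  {u : ℝ → E3 → E3} {θ : ℝ → E3 → ℝ}

theorem memLp_initial (h : IsClassicalSolution ν κ γ T u0 G0 θ0 u θ) (j : Fin 3) :
    MemLp (fun x => u0 x j) 2 torusMeasure := h.init_u_H1.memLp.eval_piLp j

theorem tendsto_velocity (h : IsClassicalSolution ν κ γ T u0 G0 θ0 u θ) (hT : 0 < T) (j : Fin 3) :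
    Tendsto (fun t => ∫ x, (u t x j - u0 x j) ^ 2 ∂torusMeasure) (𝓝[>] 0) (𝓝 0) := by
  refine tendsto_integral_sq_of_tendsto_eLpNorm ?_ (tendsto_of_tendsto_of_tendsto_of_le_of_le
    tendsto_const_nhds h.tendsto_u (fun t => zero_le) fun t => ?_)
  · filter_upwards [eventually_mem_Ioc hT] with t ht
    exact (memLp_torus (((h.regular_u j).timeC1.cont).slice ht) 2).sub (h.memLp_initial j)
  · exact eLpNorm_mono fun x => PiLp.norm_apply_le (u t x - u0 x) j

theorem tendsto_gradient (h : IsClassicalSolution ν κ γ T u0 G0 θ0 u θ) (hT : 0 < T)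
    (i j : Fin 3) :
    Tendsto (fun t => ∫ x, (pd i (fun y => u t y j) x - G0 x i j) ^ 2 ∂torusMeasure)
      (𝓝[>] 0) (𝓝 0) := by
  refine tendsto_integral_sq_of_tendsto_eLpNorm ?_ (h.tendsto_grad i j)
  filter_upwards [eventually_mem_Ioc hT] with t ht
  exact (memLp_torus (((h.regular_u j).jointCont_pd i).slice ht) 2).sub
    (h.init_u_H1.grad_memLp i j)

theorem tendsto_temperature (h : IsClassicalSolution ν κ γ T u0 G0 θ0 u θ) (hT : 0 < T) :
    Tendsto (fun t => ∫ x, (θ t x - θ0 x) ^ 2 ∂torusMeasure) (𝓝[>] 0) (𝓝 0) := by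
  refine tendsto_integral_sq_of_tendsto_eLpNorm ?_ h.tendsto_θ
  filter_upwards [eventually_mem_Ioc hT] with t ht
  exact (memLp_torus (h.regular_θ.timeC1.cont.slice ht) 2).sub h.init_θ_memLp

theorem aboveBarrier (h : IsClassicalSolution ν κ γ T u0 G0 θ0 u θ) (hν : 0 < ν) (hκ : 0 ≤ κ)
    (hT : 0 < T) (hθ0 : ∀ᵐ x ∂torusMeasure, 1 ≤ θ0 x) : ThermalFlow.AboveBarrier ν T θ :=
  h.thermalFlow.minimum_principle hν hκ hθ0 h.init_θ_memLp (h.tendsto_temperature hT) h.pos_θ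

theorem integrable_frobSq_initial (h : IsClassicalSolution ν κ γ T u0 G0 θ0 u θ) :
    Integrable (fun x => frobSq (G0 x)) torusMeasure :=
  integrable_finsetSum _ fun i _ => integrable_finsetSum _ fun j _ =>
    (h.init_u_H1.grad_memLp i j).integrable_sq

theorem tendsto_velGradSq (h : IsClassicalSolution ν κ γ T u0 G0 θ0 u θ) (hT : 0 < T) :
    Tendsto (fun t => ∫ x, |velGradSq (fun j t x => u t x j) t x - frobSq (G0 x)| ∂torusMeasure)
      (𝓝[>] 0) (𝓝 0) := by
  have e : ∀ t x, velGradSq (fun j t x => u t x j) t x - frobSq (G0 x)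
      = ∑ p : Fin 3 × Fin 3, (pd p.1 (fun y => u t y p.2) x ^ 2 - G0 x p.1 p.2 ^ 2) :=
    fun t x => by
      rw [Fintype.sum_prod_type]
      simp only [Finset.sum_sub_distrib]
      rfl
  simp only [e]
  have hm : ∀ i j, ∀ᶠ t in 𝓝[>] (0 : ℝ),
      MemLp (fun x => pd i (fun y => u t y j) x) 2 torusMeasure := fun i j => by
    filter_upwards [eventually_mem_Ioc hT] with t ht
    exact memLp_torus (((h.regular_u j).jointCont_pd i).slice ht) 2
  refine tendsto_integral_abs_sum (fun p _ => ?_) fun p _ => ?_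
  · filter_upwards [hm p.1 p.2] with t ht
    exact ht.integrable_sq.sub (h.init_u_H1.grad_memLp p.1 p.2).integrable_sq
  · exact tendsto_integral_abs_sq_sub_sq (hm p.1 p.2) (h.init_u_H1.grad_memLp p.1 p.2)
      (h.tendsto_gradient hT p.1 p.2)

theorem integrable_initial_speedWeight (h : IsClassicalSolution ν κ γ T u0 G0 θ0 u θ) :
    Integrable (fun x => 1 + ∑ j, u0 x j ^ 2) torusMeasure :=
  (integrable_const _).add (integrable_finsetSum _ fun j _ => (h.memLp_initial j).integrable_sq)

theorem tendsto_speedWeight (h : IsClassicalSolution ν κ γ T u0 G0 θ0 u θ) (hT : 0 < T) :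
    Tendsto (fun t => ∫ x, |speedWeight (fun j t x => u t x j) t x - (1 + ∑ j, u0 x j ^ 2)|
      ∂torusMeasure) (𝓝[>] 0) (𝓝 0) := by
  have e : ∀ t x, speedWeight (fun j t x => u t x j) t x - (1 + ∑ j, u0 x j ^ 2)
      = ∑ j, (u t x j ^ 2 - u0 x j ^ 2) := fun t x => by
    rw [speedWeight, Finset.sum_sub_distrib]
    ring
  simp only [e]
  have hm : ∀ j, ∀ᶠ t in 𝓝[>] (0 : ℝ), MemLp (fun x => u t x j) 2 torusMeasure := fun j => by
    filter_upwards [eventually_mem_Ioc hT] with t ht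
    exact memLp_torus ((h.regular_u j).timeC1.cont.slice ht) 2
  refine tendsto_integral_abs_sum (fun j _ => ?_) fun j _ => ?_
  · filter_upwards [hm j] with t ht
    exact ht.integrable_sq.sub (h.memLp_initial j).integrable_sq
  · exact tendsto_integral_abs_sq_sub_sq (hm j) (h.memLp_initial j) (h.tendsto_velocity hT j)

/-- The moment `∫ (1 + |u|²)^{γ/2}` near the initial time. -/
theorem exists_short_time_moment (h : IsClassicalSolution ν κ γ T u0 G0 θ0 u θ) (hν : 0 < ν)
    (hκ : 0 ≤ κ) (hγ : 2 ≤ γ) (hT : 0 < T) (hθ0 : ∀ᵐ x ∂torusMeasure, 1 ≤ θ0 x)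
    (hu0 : MemLp u0 (ENNReal.ofReal γ) torusMeasure) :
    ∃ s0, 0 < s0 ∧ ∀ t ∈ Ioo 0 s0,
      ∫ x, speedWeight (fun j t x => u t x j) t x ^ (γ / 2) ∂torusMeasure
        ≤ 2 ^ (γ / 2) * (γ / 2) * (2 ^ (γ / 2)
          * (1 + (eLpNorm u0 (ENNReal.ofReal γ) torusMeasure).toReal ^ γ) + 1) := by
  have hfl := h.thermalFlow
  have hb := h.aboveBarrier hν hκ hT hθ0
  have hγ0 : 0 < γ := by linarith
  obtain ⟨C, hC⟩ := exists_sobolev_torus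
  have ev1 := eventually_integral_le_of_tendsto_abs_sub (by
    filter_upwards [eventually_mem_Ioc hT] with t ht
    exact integrable_torus (hfl.jointCont_velGradSq.slice ht)) h.integrable_frobSq_initial
      (h.tendsto_velGradSq hT)
  have ev2 := eventually_integral_le_of_tendsto_abs_sub (by
    filter_upwards [eventually_mem_Ioc hT] with t ht
    exact integrable_torus (hfl.timeC1_speedWeight.cont.slice ht)) h.integrable_initial_speedWeight
      (h.tendsto_speedWeight hT)
  -- On a short interval the convergence in `H¹` bounds `∫ |∇u|²` and `∫ (1 + |u|²)`, hence the
  -- cubic moment. These bounds fix only the length of the interval; the moment bound itself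
  -- involves `γ` and the `L^γ` norm of the data alone.
  obtain ⟨S, hS0, hS⟩ := (mem_nhdsGT_iff_exists_Ioc_subset.1
    ((ev1.and ev2).and (eventually_mem_Ioc hT)) : ∃ S ∈ Ioi (0 : ℝ), _)
  have hS0 : 0 < S := hS0
  have hST : S ≤ T := (hS ⟨hS0, le_rfl⟩).2.2
  set W0 : E3 → ℝ := fun x => 1 + ∑ j, u0 x j ^ 2 with hW0
  have hW01 : ∀ x, 1 ≤ W0 x := fun x =>
    le_add_of_nonneg_right (Finset.sum_nonneg fun _ _ => sq_nonneg _)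
  have hp : (ENNReal.ofReal γ).toReal = γ := ENNReal.toReal_ofReal hγ0.le
  have hpne : ENNReal.ofReal γ ≠ 0 := by simpa using hγ0
  have hint : Integrable (fun x => ‖u0 x‖ ^ γ) torusMeasure := by
    have := hu0.integrable_norm_rpow hpne ENNReal.ofReal_ne_top
    rwa [hp] at this
  have hW0le : ∀ x, W0 x ^ (γ / 2) ≤ 2 ^ (γ / 2) * (1 + ‖u0 x‖ ^ γ) := fun x => by
    have e1 : W0 x = 1 + ‖u0 x‖ ^ 2 := by rw [EuclideanSpace.real_norm_sq_eq]
    have e2 : (‖u0 x‖ ^ 2) ^ (γ / 2) = ‖u0 x‖ ^ γ := by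
      rw [← Real.rpow_natCast, ← Real.rpow_mul (norm_nonneg _)]
      congr 1
      push_cast
      ring
    rw [e1]
    have hn : 0 ≤ ‖u0 x‖ ^ γ := Real.rpow_nonneg (norm_nonneg _) _
    rcases le_total (‖u0 x‖ ^ 2) 1 with hc | hc
    · calc (1 + ‖u0 x‖ ^ 2) ^ (γ / 2) ≤ 2 ^ (γ / 2) :=
            Real.rpow_le_rpow (by positivity) (by linarith) (by positivity)
        _ ≤ _ := le_mul_of_one_le_right (by positivity) (by linarith)
    · calc (1 + ‖u0 x‖ ^ 2) ^ (γ / 2) ≤ (2 * ‖u0 x‖ ^ 2) ^ (γ / 2) :=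
            Real.rpow_le_rpow (by positivity) (by linarith) (by positivity)
        _ = 2 ^ (γ / 2) * ‖u0 x‖ ^ γ := by rw [Real.mul_rpow (by norm_num) (by positivity), e2]
        _ ≤ _ := by gcongr; linarith
  have hbd : Integrable (fun x => 2 ^ (γ / 2) * (1 + ‖u0 x‖ ^ γ)) torusMeasure :=
    ((integrable_const _).add hint).const_mul _
  have hW0γ : Integrable (fun x => W0 x ^ (γ / 2)) torusMeasure := by
    refine hbd.mono' ?_ (.of_forall fun x => ?_)
    · have := h.integrable_initial_speedWeight.aestronglyMeasurable
      exact (this.aemeasurable.pow_const _).aestronglyMeasurable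
    · rw [Real.norm_of_nonneg (Real.rpow_nonneg (zero_le_one.trans (hW01 x)) _)]
      exact hW0le x
  have hγint : ∫ x, W0 x ^ (γ / 2) ∂torusMeasure
      ≤ 2 ^ (γ / 2) * (1 + (eLpNorm u0 (ENNReal.ofReal γ) torusMeasure).toReal ^ γ) := by
    refine (integral_mono hW0γ hbd hW0le).trans (le_of_eq ?_)
    have hn : 0 ≤ ∫ x, ‖u0 x‖ ^ γ ∂torusMeasure :=
      integral_nonneg fun x => Real.rpow_nonneg (norm_nonneg _) _
    rw [integral_const_mul, integral_add (integrable_const _) hint,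
      hu0.eLpNorm_eq_integral_rpow_norm hpne ENNReal.ofReal_ne_top, hp,
      ENNReal.toReal_ofReal (by positivity), ← Real.rpow_mul hn, inv_mul_cancel₀ hγ0.ne',
      Real.rpow_one]
    simp
  obtain ⟨s0, hs0, -, hs⟩ := hfl.exists_short_time_bound hν hγ hC
    (μ := 1 / (1 + 3 / (8 * ν) * S))
    (R := C * ((∫ x, frobSq (G0 x) ∂torusMeasure + 1) + (∫ x, W0 x ∂torusMeasure + 1)))
    (by positivity) (by
      have := hC.1
      have : 0 ≤ ∫ x, frobSq (G0 x) ∂torusMeasure := integral_nonneg fun x => frobSq_nonneg _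
      have : 0 ≤ ∫ x, W0 x ∂torusMeasure :=
        integral_nonneg fun x => zero_le_one.trans (hW01 x)
      positivity) hS0 hST (fun t ht x => by
      refine le_trans ?_ (hb t ⟨ht.1, ht.2.trans hST⟩ x)
      have := ht.1
      have := ht.2
      gcongr) (fun t ht => by
      have htT : t ∈ Ioc 0 T := ⟨ht.1, ht.2.trans hST⟩
      refine (hfl.integral_speedWeight_cube_le hC htT).trans (pow_le_pow_left₀ ?_ ?_ 3)
      · exact mul_nonneg hC.1.le (add_nonneg (integral_nonneg fun x => velGradSq_nonneg _ t x)
          (integral_nonneg fun x => zero_le_one.trans (one_le_speedWeight _ t x)))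
      · exact mul_le_mul_of_nonneg_left (add_le_add (hS ht).1.1 (hS ht).1.2) hC.1.le)
    hW01 h.integrable_initial_speedWeight hW0γ (h.tendsto_speedWeight hT)
  refine ⟨s0, hs0, fun t ht => (hs t ht).trans ?_⟩
  gcongr

end IsClassicalSolution

/-! ### Passage to time zero and uniform constants -/

namespace ThermalFlow

variable {ν κ γ T : ℝ} {v : Fin 3 → ℝ → E3 → ℝ} {θ : ℝ → E3 → ℝ}

theorem rpow_neg_temperature_le (hb : AboveBarrier ν T θ) (hν : 0 < ν) {a : ℝ} (ha : 0 ≤ a) {t : ℝ}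
    (ht : t ∈ Ioc 0 T) (x : E3) : θ t x ^ (-a) ≤ (1 / (1 + 3 / (8 * ν) * T)) ^ (-a) := by
  have h0 := ht.1
  have hT : 0 < T := h0.trans_le ht.2
  refine Real.rpow_le_rpow_of_nonpos (by positivity) (le_trans ?_ (hb t ht x)) (by linarith)
  have := ht.2
  gcongr

theorem timeIntegrable_of_le_dissipation (h : ThermalFlow ν κ γ T v θ)
    (hpos : ∀ t ∈ Ioc 0 T, ∀ x, 0 < θ t x) {a : ℝ}
    (hD : IntegrableOn (fun t => ∫ x, dissipation a v θ t x ∂torusMeasure) (Ioc 0 T))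
    {q : ℝ → E3 → ℝ} (hq : JointCont T q) (hq0 : ∀ t ∈ Ioc 0 T, ∀ x, 0 ≤ q t x)
    (hle : ∀ t ∈ Ioc 0 T, ∀ x, q t x ≤ dissipation a v θ t x) : TimeIntegrable T q := by
  refine ⟨fun t ht => integrable_torus (hq.slice ht), ?_⟩
  rw [integrableOn_Icc_iff_integrableOn_Ioc]
  refine Integrable.mono' hD (hq.continuousOn_integral.aestronglyMeasurable measurableSet_Ioc) ?_
  filter_upwards [ae_restrict_mem measurableSet_Ioc] with t ht
  rw [Real.norm_of_nonneg (integral_nonneg (hq0 t ht))]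
  exact integral_torus_mono (hq.slice ht) ((h.jointCont_dissipation hpos a).slice ht) (hle t ht)

end ThermalFlow

namespace IsClassicalSolution

open ThermalFlow

variable {ν κ γ T : ℝ} {u0 : E3 → E3} {G0 : E3 → Fin 3 → Fin 3 → ℝ} {θ0 : E3 → ℝ}
  {u : ℝ → E3 → E3} {θ : ℝ → E3 → ℝ}

theorem integrable_initial_weighted (h : IsClassicalSolution ν κ γ T u0 G0 θ0 u θ)
    (hθ0 : ∀ᵐ x ∂torusMeasure, 1 ≤ θ0 x) {a : ℝ} (ha : 0 ≤ a) :
    Integrable (fun x => θ0 x ^ (-a) * frobSq (G0 x)) torusMeasure := by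
  refine h.integrable_frobSq_initial.mono'
    ((h.init_θ_memLp.1.aemeasurable.pow_const _).aestronglyMeasurable.mul
      h.integrable_frobSq_initial.1) ?_
  filter_upwards [hθ0] with x hx
  have h1 := Real.rpow_nonneg (zero_le_one.trans hx) (-a)
  rw [Real.norm_of_nonneg (mul_nonneg h1 (frobSq_nonneg _))]
  exact mul_le_of_le_one_left (frobSq_nonneg _)
    (Real.rpow_le_one_of_one_le_of_nonpos hx (by linarith))

/-- Convergence of `θ` in `L²` gives almost everywhere convergence only along a sequence of times,
which is enough. The barrier bounds `θ^{-a}` uniformly, so dominated convergence treats the weight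
against the initial gradient, and `L¹` convergence of `|∇u|²` treats the rest. -/
theorem exists_seq_tendsto_weightedEnergy (h : IsClassicalSolution ν κ γ T u0 G0 θ0 u θ)
    (hν : 0 < ν) (hκ : 0 ≤ κ) (hT : 0 < T) (hθ0 : ∀ᵐ x ∂torusMeasure, 1 ≤ θ0 x) {a : ℝ}
    (ha : 0 ≤ a) :
    ∃ s : ℕ → ℝ, (∀ n, s n ∈ Ioc 0 T) ∧ Tendsto s atTop (𝓝 0) ∧
      Tendsto (fun n => weightedEnergy a (fun j t x => u t x j) θ (s n)) atTop
        (𝓝 (∫ x, θ0 x ^ (-a) * frobSq (G0 x) ∂torusMeasure)) := by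
  have hfl := h.thermalFlow
  have hb := h.aboveBarrier hν hκ hT hθ0
  have hpos : ∀ t ∈ Ioc 0 T, ∀ x, 0 < θ t x := fun t ht x => hb.pos hν ht x
  set r : ℕ → ℝ := fun n => T * (1 / ((n : ℝ) + 1)) with hr
  have hrT : ∀ n, r n ∈ Ioc 0 T := fun n => by
    refine ⟨by positivity, mul_le_of_le_one_right hT.le ?_⟩
    rw [div_le_one (by positivity)]
    linarith [(Nat.cast_nonneg n : (0 : ℝ) ≤ n)]
  have hr0 : Tendsto r atTop (𝓝[>] 0) := by
    refine tendsto_nhdsWithin_iff.2 ⟨?_, .of_forall fun n => (hrT n).1⟩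
    have := (tendsto_one_div_add_atTop_nhds_zero_nat (𝕜 := ℝ)).const_mul T
    rwa [mul_zero] at this
  obtain ⟨ns, hns, hae⟩ := (tendstoInMeasure_of_tendsto_eLpNorm (p := 2) (by norm_num)
    (fun n => (h.regular_θ.timeC1.cont.slice (hrT n)).aestronglyMeasurable) h.init_θ_memLp.1
    (h.tendsto_θ.comp hr0)).exists_seq_tendsto_ae
  have hs0 : Tendsto (fun n => r (ns n)) atTop (𝓝[>] 0) := hr0.comp hns.tendsto_atTop
  refine ⟨fun n => r (ns n), fun n => hrT _, hs0.mono_right nhdsWithin_le_nhds, ?_⟩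
  set B := (1 / (1 + 3 / (8 * ν) * T)) ^ (-a) with hB
  have hw : ∀ n x, 0 ≤ θ (r (ns n)) x ^ (-a) ∧ θ (r (ns n)) x ^ (-a) ≤ B := fun n x =>
    ⟨Real.rpow_nonneg (hpos _ (hrT _) x).le _, rpow_neg_temperature_le hb hν ha (hrT _) x⟩
  have hwm : ∀ n, Continuous fun x => θ (r (ns n)) x ^ (-a) := fun n =>
    (hfl.contDiff_rpow_temperature (hrT _) (hpos _ (hrT _)) (-a)).continuous
  have hg0 := h.integrable_frobSq_initial
  have hwg : ∀ n, Integrable (fun x => θ (r (ns n)) x ^ (-a) * frobSq (G0 x)) torusMeasure :=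
    fun n => (hg0.const_mul B).mono' ((hwm n).aestronglyMeasurable.mul hg0.1) (.of_forall fun x => by
      rw [Real.norm_of_nonneg (mul_nonneg (hw n x).1 (frobSq_nonneg _))]
      exact mul_le_mul_of_nonneg_right (hw n x).2 (frobSq_nonneg _))
  have lim1 : Tendsto (fun n => ∫ x, θ (r (ns n)) x ^ (-a) * frobSq (G0 x) ∂torusMeasure) atTop
      (𝓝 (∫ x, θ0 x ^ (-a) * frobSq (G0 x) ∂torusMeasure)) := by
    refine tendsto_integral_of_dominated_convergence (fun x => B * frobSq (G0 x))
      (fun n => (hwg n).1) (hg0.const_mul B) (fun n => .of_forall fun x => ?_) ?_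
    · rw [Real.norm_of_nonneg (mul_nonneg (hw n x).1 (frobSq_nonneg _))]
      exact mul_le_mul_of_nonneg_right (hw n x).2 (frobSq_nonneg _)
    · filter_upwards [hae, hθ0] with x hx hx1
      exact (hx.rpow_const (Or.inl (by linarith))).mul_const _
  have hcg : ∀ n, Continuous (velGradSq (fun j t x => u t x j) (r (ns n))) := fun n =>
    hfl.jointCont_velGradSq.slice (hrT _)
  have lim2 : Tendsto (fun n => weightedEnergy a (fun j t x => u t x j) θ (r (ns n))
      - ∫ x, θ (r (ns n)) x ^ (-a) * frobSq (G0 x) ∂torusMeasure) atTop (𝓝 0) := by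
    have hlim := ((h.tendsto_velGradSq hT).comp hs0).const_mul B
    rw [mul_zero] at hlim
    refine squeeze_zero_norm (fun n => ?_) hlim
    have hd := (integrable_torus (hcg n)).sub hg0
    rw [weightedEnergy, ← integral_sub (integrable_torus ((hwm n).fun_mul (hcg n))) (hwg n)]
    simp only [Function.comp_apply]
    rw [← integral_const_mul]
    refine norm_integral_le_of_norm_le (hd.abs.const_mul B) (.of_forall fun x => ?_)
    rw [← mul_sub, norm_mul, Real.norm_of_nonneg (hw n x).1]
    exact mul_le_mul_of_nonneg_right (hw n x).2 (abs_nonneg _)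
  simpa using lim2.add lim1

end IsClassicalSolution

/-- `C` is an admissible constant for velocity data of `Lᵞ` norm `A`: every classical solution
satisfies the weighted gradient estimate with `C`. -/
def IsGradientConstant (ν γ K A C : ℝ) : Prop :=
  ∀ (κ T : ℝ) (u0 : E3 → E3) (G0 : E3 → Fin 3 → Fin 3 → ℝ) (θ0 : E3 → ℝ)
    (u : ℝ → E3 → E3) (θ : ℝ → E3 → ℝ), K = κ / ν + 1 → 0 < T →
    IsClassicalSolution ν κ γ T u0 G0 θ0 u θ → MemLp u0 (ENNReal.ofReal γ) torusMeasure →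
    (eLpNorm u0 (ENNReal.ofReal γ) torusMeasure).toReal = A →
    (∀ᵐ x ∂torusMeasure, 1 ≤ θ0 x) → ∀ t ∈ Ioc 0 T,
      ThermalFlow.weightedEnergy (1 / K) (fun j t x => u t x j) θ t
          ≤ (∫ x, θ0 x ^ (-(1 / K)) * frobSq (G0 x) ∂torusMeasure) + C * (t ^ (7 * |γ| + 6) + 1) ∧
      IntegrableOn (fun t =>
        ∫ x, ThermalFlow.dissipation (1 / K) (fun j t x => u t x j) θ t x ∂torusMeasure) (Ioc 0 T)

theorem one_add_rpow_le {t M : ℝ} (ht : 0 ≤ t) (hM : 0 ≤ M) :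
    (1 + t) ^ M ≤ 2 ^ M * (t ^ M + 1) := by
  have h2 : (0 : ℝ) < 2 ^ M := by positivity
  have h3 : 0 ≤ t ^ M := by positivity
  rcases le_total t 1 with hc | hc
  · calc (1 + t) ^ M ≤ 2 ^ M := Real.rpow_le_rpow (by positivity) (by linarith) hM
      _ ≤ _ := le_mul_of_one_le_right h2.le (by linarith)
  · calc (1 + t) ^ M ≤ (2 * t) ^ M := Real.rpow_le_rpow (by positivity) (by linarith) hM
      _ = 2 ^ M * t ^ M := Real.mul_rpow (by norm_num) ht
      _ ≤ _ := by gcongr; linarith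

/-- The lower time in `exists_weighted_bound` runs to zero along the sequence above. Dropping the
dissipation gives the energy bound; dropping the final energy bounds the time integrals of the
dissipation. -/
theorem exists_isGradientConstant {ν γ K A : ℝ} (hν : 0 < ν) (hγ : 2 ≤ γ) (hK : 2 ≤ K)
    (hA : 0 ≤ A) : ∃ C, 0 < C ∧ IsGradientConstant ν γ K A C := by
  have hK0 : 0 < K := by linarith
  have ha : 0 < 1 / K := by positivity
  have ha2 : 1 / K ≤ 1 / 2 := one_div_le_one_div_of_le (by norm_num) hK
  obtain ⟨C, hC, hbound⟩ := ThermalFlow.exists_weighted_bound hν hγ ha ha2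
    (F0 := 2 ^ (γ / 2) * (γ / 2) * (2 ^ (γ / 2) * (1 + A ^ γ) + 1)) (by positivity)
  refine ⟨C * 2 ^ (7 * γ + 6), by positivity,
    fun κ T u0 G0 θ0 u θ hKκ hT h hu0 hA' hθ0 t ht => ?_⟩
  have hκeq : κ = ν * (K - 1) := by
    rw [hKκ]
    field_simp
    ring
  have hκ : 0 ≤ κ := by
    rw [hκeq]
    exact mul_nonneg hν.le (by linarith)
  have hrel : 1 / K * κ = ν * (1 - 1 / K) := by
    rw [hκeq]
    field_simp
  have hb := h.aboveBarrier hν hκ hT hθ0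
  have hpos : ∀ t ∈ Ioc 0 T, ∀ x, 0 < θ t x := fun t ht x => hb.pos hν ht x
  have hfl := h.thermalFlow
  have hs0 := h.exists_short_time_moment hν hκ hγ hT hθ0 hu0
  rw [hA'] at hs0
  have hest := hbound κ T _ θ hrel hfl hb hs0
  obtain ⟨s, hsT, hs, hlim⟩ := h.exists_seq_tendsto_weightedEnergy hν hκ hT hθ0 ha.le
  have hJ := hfl.jointCont_dissipation hpos (1 / K)
  have hDn : ∀ t ∈ Ioc 0 T, 0 ≤ ∫ x,
      ThermalFlow.dissipation (1 / K) (fun j t x => u t x j) θ t x ∂torusMeasure :=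
    fun t ht => integral_nonneg fun x => by
      have h1 := fun b : ℝ => Real.rpow_nonneg (hpos t ht x).le b
      have h2 := velGradSq_nonneg (fun j t x => u t x j) t x
      exact add_nonneg (add_nonneg (mul_nonneg (h1 _) (ThermalFlow.velHessSq_nonneg _ _ _))
        (mul_nonneg (h1 _) (sq_nonneg _))) (mul_nonneg (mul_nonneg (h1 _) h2) (gradSq_nonneg _ _))
  have hint : ∀ s t, 0 < s → s ≤ t → t ≤ T → 0 ≤ ∫ r in s..t, ∫ x,
      ThermalFlow.dissipation (1 / K) (fun j t x => u t x j) θ r x ∂torusMeasure :=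
    fun s t hs hst ht => intervalIntegral.integral_nonneg hst fun r hr =>
      hDn r ⟨hs.trans_le hr.1, hr.2.trans ht⟩
  refine ⟨?_, ?_⟩
  · have h1 : ∀ᶠ n in atTop, ThermalFlow.weightedEnergy (1 / K) (fun j t x => u t x j) θ t
        ≤ ThermalFlow.weightedEnergy (1 / K) (fun j t x => u t x j) θ (s n)
          + C * (1 + t) ^ (7 * γ + 6) := by
      filter_upwards [hs.eventually (gt_mem_nhds ht.1)] with n hn
      have h2 := hest t ht (s n) (hsT n).1 hn.le
      have h3 := hint (s n) t (hsT n).1 hn.le ht.2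
      have h4 : 0 ≤ 1 / K * ν / 8 := by positivity
      have := mul_nonneg h4 h3
      linarith
    refine (ge_of_tendsto (hlim.add_const _) h1).trans (add_le_add le_rfl ?_)
    rw [abs_of_pos (by linarith : 0 < γ), mul_assoc]
    exact mul_le_mul_of_nonneg_left (one_add_rpow_le ht.1.le (by linarith)) hC.le
  · obtain ⟨B, hB⟩ := hlim.bddAbove_range
    have hc : 0 < 1 / K * ν / 8 := by positivity
    have hen : 0 ≤ ThermalFlow.weightedEnergy (1 / K) (fun j t x => u t x j) θ T :=
      integral_nonneg fun x => mul_nonneg (Real.rpow_nonneg (hpos T ⟨hT, le_rfl⟩ x).le _)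
        (velGradSq_nonneg _ _ _)
    -- The dissipation is nonnegative and its integrals over `(sₙ, T]` are bounded independently of
    -- `n`, so it is integrable up to time zero.
    refine integrableOn_Ioc_of_intervalIntegral_norm_bounded_left (l := atTop) (a := s)
      (I := (B + C * (1 + T) ^ (7 * γ + 6)) / (1 / K * ν / 8)) (fun n => ?_) hs
      (.of_forall fun n => ?_)
    · exact ((hJ.continuousOn_integral.mono fun r hr =>
        ⟨(hsT n).1.trans_le hr.1, hr.2⟩).integrableOn_compact isCompact_Icc).mono_set
          Ioc_subset_Icc_self
    · have h2 := hest T ⟨hT, le_rfl⟩ (s n) (hsT n).1 (hsT n).2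
      have h3 := hB (mem_range_self n)
      rw [le_div_iff₀ hc, setIntegral_congr_fun measurableSet_Ioc fun r hr =>
        Real.norm_of_nonneg (hDn r ⟨(hsT n).1.trans hr.1, hr.2⟩),
        ← intervalIntegral.integral_of_le (hsT n).2]
      linarith

open Classical in
/-- A constant in the weighted gradient estimate. -/
noncomputable def gradientConstant (ν γ K A : ℝ) : ℝ :=
  if h : ∃ C, 0 < C ∧ IsGradientConstant ν γ K A C then h.choose else 1

theorem gradientConstant_pos (ν γ K A : ℝ) : 0 < gradientConstant ν γ K A := by
  rw [gradientConstant]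
  split_ifs with h
  · exact h.choose_spec.1
  · exact one_pos

theorem isGradientConstant_gradientConstant {ν γ K A : ℝ} (hν : 0 < ν) (hγ : 2 ≤ γ) (hK : 2 ≤ K)
    (hA : 0 ≤ A) : IsGradientConstant ν γ K A (gradientConstant ν γ K A) := by
  have h := exists_isGradientConstant hν hγ hK hA
  rw [gradientConstant, dif_pos h]
  exact h.choose_spec.2

theorem theorem1p2 :
    ∃ (M : ℝ → ℝ → ℝ) (C : ℝ → ℝ → ℝ → ℝ → ℝ → ℝ),
      (∀ K γ, 0 < M K γ) ∧ (∀ ν γ K a b, 0 < C ν γ K a b) ∧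
      ∀ (ν κ γ K T : ℝ) (u0 : E3 → E3) (G0 : E3 → Fin 3 → Fin 3 → ℝ) (θ0 : E3 → ℝ)
        (u : ℝ → E3 → E3) (θ : ℝ → E3 → ℝ),
        0 < ν → ν ≤ κ → K = κ / ν + 1 → (γ = 2 ∨ 9 / 4 ≤ γ) → 0 < T →
        IsClassicalSolution ν κ γ T u0 G0 θ0 u θ →
        MemLp u0 (ENNReal.ofReal γ) torusMeasure →
        (∀ᵐ x ∂torusMeasure, 1 ≤ θ0 x) →
        (∀ t ∈ Set.Icc 0 T,
          Integrable (fun x => θ t x ^ (-1 / K) * frobSq (velGrad G0 u t x)) torusMeasure ∧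
          ∫ x, θ t x ^ (-1 / K) * frobSq (velGrad G0 u t x) ∂torusMeasure
            ≤ (∫ x, θ0 x ^ (-1 / K) * frobSq (G0 x) ∂torusMeasure)
              + C ν γ K (eLpNorm u0 (ENNReal.ofReal γ) torusMeasure).toReal
                  (eLpNorm θ0 2 torusMeasure).toReal * (t ^ M K γ + 1)) ∧
        TimeIntegrable T (fun t x => θ t x ^ ((K - 1) / K) * hessSq (u t) x) ∧
        TimeIntegrable T (fun t x => θ t x ^ (-(K + 1) / K) * frobSq (jac (u t) x) ^ 2) ∧
        TimeIntegrable T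
          (fun t x => θ t x ^ (-(K + 1) / K) * frobSq (jac (u t) x) * gradSq (θ t) x) := by
  -- The absolute value makes the exponent positive for every real `γ`; for positive `γ` it is `7γ +
  -- 6`.
  refine ⟨fun _ γ => 7 * |γ| + 6, fun ν γ K A _ => gradientConstant ν γ K A,
    fun _ _ => by positivity, fun ν γ K A _ => gradientConstant_pos ν γ K A,
    fun ν κ γ K T u0 G0 θ0 u θ hν hνκ hK hγ hT h hu0 hθ0 => ?_⟩
  have hγ2 : 2 ≤ γ := by rcases hγ with h | h <;> linarith
  have hκ : 0 < κ := hν.trans_le hνκ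
  have hK2 : 2 ≤ K := by
    have := (one_le_div hν).2 hνκ
    linarith
  have hK0 : K ≠ 0 := by linarith
  have ha : 0 ≤ 1 / K := by positivity
  have hconst := fun t (ht : t ∈ Ioc 0 T) => isGradientConstant_gradientConstant hν hγ2 hK2
    ENNReal.toReal_nonneg κ T u0 G0 θ0 u θ hK hT h hu0 rfl hθ0 t ht
  have hb := h.aboveBarrier hν hκ.le hT hθ0
  have hpos : ∀ t ∈ Ioc 0 T, ∀ x, 0 < θ t x := fun t ht x => hb.pos hν ht x
  have hfl := h.thermalFlow
  have e1 : -1 / K = -(1 / K) := by ring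
  have e2 : (K - 1) / K = 1 - 1 / K := by field_simp
  have e3 : -(K + 1) / K = -(1 / K) - 1 := by field_simp; ring
  rw [e1, e2, e3]
  have hD := (hconst T ⟨hT, le_rfl⟩).2
  have n0 : ∀ (b : ℝ), ∀ t ∈ Ioc 0 T, ∀ x, 0 ≤ θ t x ^ b := fun b t ht x =>
    Real.rpow_nonneg (hpos t ht x).le b
  have n1 : ∀ t ∈ Ioc 0 T, ∀ x,
      0 ≤ θ t x ^ (1 - 1 / K) * ThermalFlow.velHessSq (fun j t x => u t x j) t x := fun t ht x =>
    mul_nonneg (n0 _ t ht x) (ThermalFlow.velHessSq_nonneg _ _ _)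
  have n2 : ∀ t ∈ Ioc 0 T, ∀ x,
      0 ≤ θ t x ^ (-(1 / K) - 1) * velGradSq (fun j t x => u t x j) t x ^ 2 := fun t ht x =>
    mul_nonneg (n0 _ t ht x) (sq_nonneg _)
  have n3 : ∀ t ∈ Ioc 0 T, ∀ x,
      0 ≤ θ t x ^ (-(1 / K) - 1) * velGradSq (fun j t x => u t x j) t x * gradSq (θ t) x :=
    fun t ht x =>
      mul_nonneg (mul_nonneg (n0 _ t ht x) (velGradSq_nonneg _ _ _)) (gradSq_nonneg _ _)
  have j1 := hfl.jointCont_rpow_temperature hpos (1 - 1 / K)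
  have j2 := hfl.jointCont_rpow_temperature hpos (-(1 / K) - 1)
  refine ⟨fun t ht => ?_, ?_, ?_, ?_⟩
  · rcases ht.1.eq_or_lt with rfl | ht0
    · simp only [velGrad, if_pos, h.θ_zero]
      refine ⟨h.integrable_initial_weighted hθ0 ha, le_add_of_nonneg_right ?_⟩
      have := gradientConstant_pos ν γ K (eLpNorm u0 (ENNReal.ofReal γ) torusMeasure).toReal
      positivity
    · simp only [velGrad, if_neg ht0.ne']
      have htT : t ∈ Ioc 0 T := ⟨ht0, ht.2⟩
      exact ⟨integrable_torus (((hfl.jointCont_rpow_temperature hpos _).mul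
        hfl.jointCont_velGradSq).slice htT), (hconst t htT).1⟩
  · refine hfl.timeIntegrable_of_le_dissipation hpos hD (j1.mul hfl.jointCont_velHessSq) n1
      fun t ht x => ?_
    exact (le_add_of_nonneg_right (n2 t ht x)).trans (le_add_of_nonneg_right (n3 t ht x))
  · refine hfl.timeIntegrable_of_le_dissipation hpos hD (j2.mul (hfl.jointCont_velGradSq.pow 2)) n2
      fun t ht x => ?_
    exact (le_add_of_nonneg_left (n1 t ht x)).trans (le_add_of_nonneg_right (n3 t ht x))
  · refine hfl.timeIntegrable_of_le_dissipation hpos hD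
      ((j2.mul hfl.jointCont_velGradSq).mul hfl.jointCont_gradSq_temperature) n3 fun t ht x => ?_
    exact le_add_of_nonneg_left (add_nonneg (n1 t ht x) (n2 t ht x))
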